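/- Let $b,T>0$, $A\in\mathbb R^{n\times n}$, $f\in C^2(\mathbb R^n,\mathbb R^n)$, and suppose there is $\lambda>0$ such that $Df(y)+\lambda I$ is positive semi-definite for all $y\in\mathbb R^n$, i.e. $\langle Df(y)v+\lambda v,v\rangle\ge 0$ for all $y,v\in\mathbb R^n$. Let $\varphi\in H^2(-b,0;\mathbb R^n)$, $g\in H^1(0,T;\mathbb R^n)$ and $x_d\in L^2(0,T;\mathbb R^n)$. For $\tau\in[0,b]$ the delay equation $$\dot x(t)+f(x(t))=A\,x(t-\tau)+g(t)\ \text{ for a.e. } t\in(0,T),\qquad x(t)=\varphi(t)\ \text{ for } t\in[-b,0],$$ has a unique solution $x=x[\tau]\in C([-b,T];\mathbb R^n)$ with $x|_{[0,T]}\in H^1(0,T;\mathbb R^n)$, and moreover $x[\tau]|_{[0,T]}\in H^2(0,T;\mathbb R^n)$. The adjoint equation $$-\dot p(t)+Df(x[\tau](t))^\top p(t)=A^\top p(t+\tau)+x[\tau](t)-x_d(t)\ \text{ for a.e. } t\in(0,T),\qquad p(t)=0\ \text{ for } t\in[T,T+b],$$ has a unique solution $p=p[\tau]\in H^1(0,T+b;\mathbb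 R^n)$. The mapping $\tau\mapsto x[\tau]$ from $[0,b]$ to $H^1(-b,T;\mathbb R^n)$ has a derivative $x'[\tau]\in H^1(-b,T;\mathbb R^n)$ at every $\tau\in[0,b]$ (one-sided at $0$ and $b$). The reduced cost $$j(\tau)=\tfrac12\int_0^T|x[\tau](t)-x_d(t)|^2\,dt$$ belongs to $C^2[0,b]$, and for every $\tau\in[0,b]$ $$\begin{aligned} j''(\tau)={}&\int_0^T|x'[\tau](t)|^2\,dt-\int_0^T\big\langle p[\tau](t),\,D^2f(x[\tau](t))(x'[\tau](t),x'[\tau](t))\big\rangle\,dt\\ &-2\int_\tau^T\big\langle p[\tau](t),\,A\,\dot x'[\tau](t-\tau)\big\rangle\,dt+\big\langle p[\tau](\tau),\,A\big(\dot x[\tau](0^+)-\dot\varphi(0)\big)\big\rangle\\ &+\int_0^\tau\big\langle p[\tau](t),\,A\,\ddot\varphi(t-\tau)\big\rangle\,dt+\int_\tau^T\big\langle p[\tau](t),\,A\,\ddot x[\tau](t-\tau)\big\rangle\,dt . \end{aligned}$$ Here dots denote (weak) derivatives with respect to $t$, $\dot x'[\tau]=\partial_t x'[\tau]$, $\ddot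 x[\tau]$ is the second derivative of $x[\tau]$ on $(0,T)$, $\dot\varphi(0)$ and $\dot x[\tau](0^+)$ are the one-sided limits at $0$ of $\dot\varphi$ and of $\dot x[\tau]$; if $\tau>T$, the integrals $\int_\tau^T$ vanish, since $p[\tau]=0$ on $[T,T+b]$. -/

import Mathlib

open Set Filter Topology MeasureTheory
open scoped ENNReal RealInnerProductSpace

noncomputable section

namespace DelayControl

/-- The state space `ℝⁿ` with its Euclidean structure. -/
abbrev Vec (n : ℕ) : Type := EuclideanSpace ℝ (Fin n)

/-- A matrix acting on `ℝⁿ`. -/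
abbrev act {n : ℕ} (A : Matrix (Fin n) (Fin n) ℝ) : Vec n →L[ℝ] Vec n :=
  Matrix.toEuclideanCLM (n := Fin n) (𝕜 := ℝ) A

/-- `u` is (the continuous representative on `[a, b]` of) an element of the Sobolev space
`H¹(a, b; ℝⁿ)` and `v ∈ L²(a, b; ℝⁿ)` is its weak derivative, i.e. `u` is absolutely continuous
with `u(t) = u(a) + ∫ₐᵗ v`. The function `v` is determined almost everywhere on `(a, b)`. -/
def HasH1Deriv {n : ℕ} (a b : ℝ) (u v : ℝ → Vec n) : Prop :=
  MemLp v 2 (volume.restrict (Ioc a b)) ∧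
    ∀ t ∈ Icc a b, u t = u a + ∫ s in a..t, v s

/-- Membership in `H¹(a, b; ℝⁿ)`. -/
def MemH1 {n : ℕ} (a b : ℝ) (u : ℝ → Vec n) : Prop :=
  ∃ v, HasH1Deriv a b u v

/-- `u ∈ H²(a, b; ℝⁿ)`; `u₁` is the first derivative of `u` (its continuous representative on the
closed interval `[a, b]`) and `u₂ ∈ L²(a, b; ℝⁿ)` is the second derivative. -/
def HasH2Derivs {n : ℕ} (a b : ℝ) (u u₁ u₂ : ℝ → Vec n) : Prop :=
  HasH1Deriv a b u u₁ ∧ HasH1Deriv a b u₁ u₂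

/-- The norm `(‖u‖²_{L²} + ‖u̇‖²_{L²})^{1/2}` of `H¹(a, b; ℝⁿ)`, equal to `∞` if `u` is not in
`H¹(a, b; ℝⁿ)`. (The infimum is over the almost everywhere equal versions of the weak
derivative, which all give the same value.) -/
def h1Norm {n : ℕ} (a b : ℝ) (u : ℝ → Vec n) : ℝ≥0∞ :=
  ⨅ v : ℝ → Vec n, ⨅ _ : HasH1Deriv a b u v,
    (eLpNorm u 2 (volume.restrict (Ioc a b)) ^ 2 +
      eLpNorm v 2 (volume.restrict (Ioc a b)) ^ 2) ^ (1 / 2 : ℝ)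

/-- `x` solves the delay equation `ẋ(t) + f(x(t)) = A x(t - τ) + g(t)` in `(0, T)`,
`x = φ` on `[-b, 0]`: it is continuous on `[-b, T]`, its restriction to `[0, T]` is in `H¹`,
and the equation holds almost everywhere. -/
structure IsState {n : ℕ} (b T : ℝ) (A : Matrix (Fin n) (Fin n) ℝ) (f : Vec n → Vec n)
    (φ g : ℝ → Vec n) (τ : ℝ) (x : ℝ → Vec n) : Prop where
  continuousOn : ContinuousOn x (Icc (-b) T)
  history : ∀ t ∈ Icc (-b) 0, x t = φ t
  equation : ∃ v, HasH1Deriv 0 T x v ∧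
    ∀ᵐ t ∂(volume.restrict (Ioc 0 T)), v t + f (x t) = act A (x (t - τ)) + g t

/-- `p ∈ H¹(0, T + b; ℝⁿ)` solves the adjoint equation
`-ṗ(t) + Df(x(t))ᵀ p(t) = Aᵀ p(t + τ) + x(t) - x_d(t)` in `(0, T)`, `p = 0` on `[T, T + b]`. -/
structure IsAdjoint {n : ℕ} (b T : ℝ) (A : Matrix (Fin n) (Fin n) ℝ) (f : Vec n → Vec n)
    (xd : ℝ → Vec n) (τ : ℝ) (x p : ℝ → Vec n) : Prop where
  terminal : ∀ t ∈ Icc T (T + b), p t = 0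
  equation : ∃ q, HasH1Deriv 0 (T + b) p q ∧
    ∀ᵐ t ∂(volume.restrict (Ioc 0 T)),
      -q t + (fderiv ℝ f (x t)).adjoint (p t)
        = act A.transpose (p (t + τ)) + x t - xd t

/-- `w ∈ H¹(-b, T; ℝⁿ)` is the derivative at `τ` of the mapping `τ ↦ x τ` from `[0, b]` to
`H¹(-b, T; ℝⁿ)` (one-sided at the end points of `[0, b]`): the difference quotients converge
to `w` in the norm of `H¹(-b, T; ℝⁿ)`. -/
def HasDelayDeriv {n : ℕ} (b T : ℝ) (x : ℝ → ℝ → Vec n) (τ : ℝ) (w : ℝ → Vec n) : Prop :=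
  MemH1 (-b) T w ∧
    Tendsto (fun σ => h1Norm (-b) T (fun t => (σ - τ)⁻¹ • (x σ t - x τ t) - w t))
      (𝓝[Icc 0 b \ {τ}] τ) (𝓝 0)

/-- The cost `j(τ) = ½ ∫₀ᵀ |x[τ](t) - x_d(t)|² dt`. -/
def reducedCost {n : ℕ} (T : ℝ) (xd : ℝ → Vec n) (x : ℝ → ℝ → Vec n) (τ : ℝ) : ℝ :=
  (1 / 2) * ∫ t in (0 : ℝ)..T, ‖x τ t - xd t‖ ^ 2

end DelayControl

end

/-!
The data are first extended to the whole line, with the derivatives `φ̈` and `ġ` continued by zero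
(`DelaySystem`, `DelaySystem.exists_of_data`), so that state, sensitivity and adjoint state become
functions on `ℝ` and no statement about them has to distinguish cases by the position of the
delayed argument.

*Well-posedness.* For globally Lipschitz `f` a solution is the fixed point of an integral operator
(`exists_delay_integral_solution`). In general `f` is multiplied by a cut-off function: the energy
`‖x‖²` satisfies a delay Gronwall inequality (`delay_gronwall`) whose constants see `f` only through
the lower bound `⟪f y, y⟫ ≥ -c‖y‖² - d‖y‖`, which the cut-off preserves, so solutions stay in the
region where nothing has been changed (`DelaySystem.exists_norm_le_withField`).

*The derivative of the state.* The sensitivity `x'[τ]` solves the linearized delay equation with the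
additional source `-A ẋ(t - τ)` (`DelaySystem.sens`). Difference quotients converge to it uniformly
by the Gronwall inequality in its asymptotic form `eventually_norm_le_of_delay_gronwall`, and
then also in `H¹` since their velocities converge pointwise and boundedly away from `t = τ`
(`DelaySystem.hasDelayDeriv_sens`).

*The second derivative of the cost.* The first derivative is `j'(τ) = ∫ ⟪x - x_d, x'⟫`. It is not
differentiated through a second derivative of the state, since the source of the equation for that
would contain the second derivative of `x`, a measure: `ẋ` jumps at `0`. Instead the difference
quotient of `x'` is tested against `x - x_d`, and the duality relation
`DelaySystem.integral_inner_eq_integral_costate` moves everything to the adjoint state. Apart from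
terms to which dominated convergence applies directly, what remains are difference quotients
`∫ ⟪p(t), A(K(t - σ) - K(t - τ))⟫ dt / (σ - τ)` with `K = x'` or `K = ẋ`. For an absolutely
continuous `K` Fubini's theorem turns them into averages of the continuous function
`r ↦ -∫ ⟪p(t), A K̇(t - r)⟫ dt`; the jump of `K = ẋ` at `0` is responsible for the point evaluation
`⟪p(τ), A(ẋ(0⁺) - φ̇(0))⟫` (`integral_inner_translate_sub`, `DelaySystem.hasDerivWithinAt_costDeriv`).
All the terms of the resulting formula depend continuously on `τ`
(`DelaySystem.continuousOn_costDeriv₂`), so `j` is of class `C²`.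

The formula of the theorem follows because all functions in it are unique: the state and the adjoint
state by Gronwall's inequality, weak derivatives almost everywhere.
-/

namespace DelayControl

/-! ### Delay integral inequalities and equations -/

section Gronwall

variable {E : Type*} [NormedAddCommGroup E] [NormedSpace ℝ E]

/-- A Gronwall inequality with delay, uniform in the delay `δ`. The hypothesis is evaluated at a
maximum point of `exp (-4 C t) u(t)` over `[0, T]`; the weight makes the part of the integral that
depends on `u` at most half the weighted maximum. Delayed arguments in `[0, T]` are covered since
`exp (4 C (t - δ)) ≤ exp (4 C t)`. -/
theorem delay_gronwall {C T δ a : ℝ} {u : ℝ → ℝ} (hC : 0 < C) (hT : 0 < T) (hδ : 0 ≤ δ)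
    (ha : 0 ≤ a) (hu : Continuous u) (hnn : ∀ t, 0 ≤ u t) (hneg : ∀ t ∈ Icc (-δ) 0, u t ≤ a)
    (h : ∀ t ∈ Icc 0 T, u t ≤ a + ∫ s in (0 : ℝ)..t, C * (u s + u (s - δ))) :
    ∀ t ∈ Icc 0 T, u t ≤ 2 * (1 + C * T) * Real.exp (4 * C * T) * a := by
  obtain ⟨t₀, ht₀, hmax⟩ := isCompact_Icc.exists_isMaxOn (nonempty_Icc.2 hT.le)
    (f := fun t => Real.exp (-(4 * C * t)) * u t) (by fun_prop)
  set m := Real.exp (-(4 * C * t₀)) * u t₀ with hm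
  have hm0 : 0 ≤ m := mul_nonneg (Real.exp_pos _).le (hnn _)
  have key : ∀ s ∈ Icc 0 T, u s ≤ m * Real.exp (4 * C * s) := by
    intro s hs
    have h1 : Real.exp (-(4 * C * s)) * u s ≤ m := hmax hs
    calc u s = (Real.exp (-(4 * C * s)) * u s) * Real.exp (4 * C * s) := by
          rw [mul_right_comm, ← Real.exp_add]; simp
      _ ≤ _ := by gcongr
  have key2 : ∀ s ∈ Icc 0 T, u (s - δ) ≤ a + m * Real.exp (4 * C * s) := by
    intro s hs
    rcases le_total (s - δ) 0 with h0 | h0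
    · have := hneg (s - δ) ⟨by linarith [hs.1], h0⟩
      have : 0 ≤ m * Real.exp (4 * C * s) := by positivity
      linarith
    · have h1 := key (s - δ) ⟨h0, by linarith [hs.2]⟩
      have h2 : m * Real.exp (4 * C * (s - δ)) ≤ m * Real.exp (4 * C * s) := by
        gcongr; linarith
      linarith
  have hmain : u t₀ ≤ a + (2⁻¹ * m * (Real.exp (4 * C * t₀) - 1) + C * a * t₀) := by
    refine (h t₀ ht₀).trans ?_
    gcongr
    have h2 : (∫ s in (0 : ℝ)..t₀, C * (2 * m * Real.exp (4 * C * s) + a))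
        = 2⁻¹ * m * (Real.exp (4 * C * t₀) - 1) + C * a * t₀ := by
      rw [intervalIntegral.integral_const_mul, intervalIntegral.integral_add
        (Continuous.intervalIntegrable (by fun_prop) _ _)
        (Continuous.intervalIntegrable (by fun_prop) _ _), intervalIntegral.integral_const_mul,
        intervalIntegral.integral_comp_mul_left (fun s => Real.exp s) (by positivity), integral_exp]
      simp only [mul_zero, Real.exp_zero, smul_eq_mul, intervalIntegral.integral_const]
      field_simp
      ring
    rw [← h2]
    refine intervalIntegral.integral_mono_on ht₀.1
      (Continuous.intervalIntegrable (by fun_prop) _ _)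
      (Continuous.intervalIntegrable (by fun_prop) _ _) fun s hs => ?_
    have hs' : s ∈ Icc 0 T := ⟨hs.1, hs.2.trans ht₀.2⟩
    have := key s hs'
    have := key2 s hs'
    refine mul_le_mul_of_nonneg_left ?_ hC.le
    linarith
  have hut₀ : u t₀ = m * Real.exp (4 * C * t₀) := by
    rw [hm, mul_right_comm, ← Real.exp_add]; simp
  have he : 1 ≤ Real.exp (4 * C * t₀) := Real.one_le_exp (by have := ht₀.1; positivity)
  have hm2 : m ≤ 2 * (1 + C * T) * a := by
    have h3 : C * a * t₀ ≤ C * a * T := by gcongr; exact ht₀.2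
    have h4 : m * 1 ≤ m * Real.exp (4 * C * t₀) := by gcongr
    rw [hut₀] at hmain
    linarith
  intro t ht
  calc u t ≤ m * Real.exp (4 * C * t) := key t ht
    _ ≤ (2 * (1 + C * T) * a) * Real.exp (4 * C * T) := by
        have := ht.2
        gcongr
    _ = _ := by ring

/-- A family of functions with zero history that satisfies a delay Gronwall inequality with
forcing terms `r i` tends to zero uniformly as soon as the `r i` tend to zero boundedly almost
everywhere: the integrals of the `r i` tend to zero by dominated convergence. -/
theorem eventually_norm_le_of_delay_gronwall {ι : Type*} {l : Filter ι} [l.IsCountablyGenerated]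
    {C M T : ℝ} (hC : 0 < C) (hT : 0 < T) {δ : ι → ℝ} {u e : ι → ℝ → E} {r : ι → ℝ → ℝ}
    (hδ : ∀ᶠ i in l, 0 ≤ δ i) (hu : ∀ᶠ i in l, Continuous (u i))
    (hneg : ∀ᶠ i in l, ∀ t ≤ 0, u i t = 0)
    (hint : ∀ᶠ i in l, ∀ t ∈ Icc 0 T, u i t = ∫ s in (0 : ℝ)..t, e i s)
    (hle : ∀ᶠ i in l, ∀ s ∈ Ioc 0 T, ‖e i s‖ ≤ C * (‖u i s‖ + ‖u i (s - δ i)‖) + r i s)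
    (hrm : ∀ᶠ i in l, AEStronglyMeasurable (r i) (volume.restrict (Ioc 0 T)))
    (hrM : ∀ᶠ i in l, ∀ s ∈ Ioc 0 T, ‖r i s‖ ≤ M)
    (hr0 : ∀ᵐ s, s ∈ Ioc 0 T → Tendsto (fun i => r i s) l (𝓝 0)) :
    ∀ ε > 0, ∀ᶠ i in l, ∀ t ≤ T, ‖u i t‖ ≤ ε := by
  intro ε hε
  set κ := 2 * (1 + C * T) * Real.exp (4 * C * T) with hκ
  have hκ0 : 0 < κ := by positivity
  have hlim : Tendsto (fun i => ∫ s in (0 : ℝ)..T, ‖r i s‖) l (𝓝 0) := by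
    have := intervalIntegral.tendsto_integral_filter_of_dominated_convergence (μ := volume)
      (a := 0) (b := T) (l := l) (F := fun i s => ‖r i s‖) (f := fun _ => (0 : ℝ)) (fun _ => M)
      (by rw [uIoc_of_le hT.le]; exact hrm.mono fun i hi => hi.norm)
      (hrM.mono fun i hi => .of_forall fun s hs => by
        rw [uIoc_of_le hT.le] at hs; simpa using hi s hs)
      intervalIntegrable_const
      (hr0.mono fun s hs hs' => by
        rw [uIoc_of_le hT.le] at hs'; simpa using (hs hs').norm)
    simpa using this
  filter_upwards [hδ, hu, hneg, hint, hle, hrm, hrM,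
    hlim.eventually (gt_mem_nhds (show (0 : ℝ) < ε / κ by positivity))]
    with i hδ hu hneg hint hle hrm hrM hsmall
  have hrint : IntervalIntegrable (fun s => ‖r i s‖) volume 0 T := by
    rw [intervalIntegrable_iff_integrableOn_Ioc_of_le hT.le]
    refine Integrable.of_bound hrm.norm M ?_
    filter_upwards [ae_restrict_mem measurableSet_Ioc] with s hs
    simpa using hrM s hs
  have hG := delay_gronwall (u := fun t => ‖u i t‖) (a := ∫ s in (0 : ℝ)..T, ‖r i s‖) hC hT hδ
    (intervalIntegral.integral_nonneg hT.le fun s _ => norm_nonneg _) hu.norm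
    (fun t => norm_nonneg _)
    (fun t ht => by
      rw [hneg t ht.2, norm_zero]
      exact intervalIntegral.integral_nonneg hT.le fun s _ => norm_nonneg _)
    (fun t ht => by
      have hrt : IntervalIntegrable (fun s => ‖r i s‖) volume 0 t :=
        hrint.mono_set (by rw [uIcc_of_le ht.1, uIcc_of_le hT.le]; exact Icc_subset_Icc_right ht.2)
      have hct : IntervalIntegrable (fun s => C * (‖u i s‖ + ‖u i (s - δ i)‖)) volume 0 t :=
        Continuous.intervalIntegrable (by fun_prop) _ _
      have h1 : ‖u i t‖ ≤ ∫ s in (0 : ℝ)..t, (C * (‖u i s‖ + ‖u i (s - δ i)‖) + ‖r i s‖) := by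
        rw [hint t ht]
        refine intervalIntegral.norm_integral_le_of_norm_le ht.1 (.of_forall fun s hs => ?_)
          (hct.add hrt)
        exact (hle s ⟨hs.1, hs.2.trans ht.2⟩).trans (by gcongr; exact Real.le_norm_self _)
      rw [intervalIntegral.integral_add hct hrt] at h1
      have h2 : ∫ s in (0 : ℝ)..t, ‖r i s‖ ≤ ∫ s in (0 : ℝ)..T, ‖r i s‖ :=
        intervalIntegral.integral_mono_interval le_rfl ht.1 ht.2
          (.of_forall fun s => norm_nonneg _) hrint
      linarith)
  intro t ht
  rcases le_total t 0 with h0 | h0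
  · rw [hneg t h0, norm_zero]; exact hε.le
  · refine (hG t ⟨h0, ht⟩).trans ?_
    have : κ * ∫ s in (0 : ℝ)..T, ‖r i s‖ ≤ κ * (ε / κ) := by gcongr
    rwa [mul_div_cancel₀ _ hκ0.ne'] at this

/-- The point of `[0, T]` nearest to `t`. -/
def clamp (T t : ℝ) : ℝ := max 0 (min t T)

theorem clamp_mem {T : ℝ} (hT : 0 ≤ T) (t : ℝ) : clamp T t ∈ Icc 0 T :=
  ⟨le_max_left _ _, max_le hT (min_le_right _ _)⟩

theorem clamp_of_mem {T t : ℝ} (ht : t ∈ Icc 0 T) : clamp T t = t := by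
  rw [clamp, min_eq_left ht.2, max_eq_right ht.1]

theorem clamp_of_le {T t : ℝ} (ht : t ≤ 0) : clamp T t = 0 :=
  max_eq_left ((min_le_left _ _).trans ht)

@[fun_prop]
theorem continuous_clamp (T : ℝ) : Continuous (clamp T) := by
  unfold clamp; fun_prop

theorem clamp_sub_le {T δ s : ℝ} (hδ : 0 ≤ δ) (hs : 0 ≤ s) : clamp T (s - δ) ≤ s :=
  max_le hs ((min_le_left _ _).trans (by linarith))

theorem integral_indicator_Ioc {T : ℝ} (hT : 0 ≤ T) (F : ℝ → E) (t : ℝ) :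
    ∫ s in (0 : ℝ)..t, (Ioc 0 T).indicator F s = ∫ s in (0 : ℝ)..clamp T t, F s := by
  rcases le_total t 0 with h0 | h0
  · rw [clamp_of_le h0, intervalIntegral.integral_same, intervalIntegral.integral_of_ge h0,
      setIntegral_congr_fun (g := fun _ => 0) measurableSet_Ioc]
    · simp
    · intro s hs
      exact indicator_of_notMem (fun h => absurd h.1 (not_lt.2 hs.2)) _
  · have hc : 0 ≤ clamp T t := (clamp_mem hT t).1
    rw [intervalIntegral.integral_of_le h0, setIntegral_indicator measurableSet_Ioc,
      intervalIntegral.integral_of_le hc, Ioc_inter_Ioc, max_self]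
    congr 3
    rw [clamp, max_eq_right (le_min h0 hT)]

/-- A delay integral equation with a Lipschitz nonlinearity and zero history is solvable: its
right-hand side is a contraction of `C([0, T])` for the norm weighted by `exp (-K t)` with `K`
large. The solution is extended by constants to the left of `0` and to the right of `T`. -/
theorem exists_delay_integral_solution [CompleteSpace E] {T δ L : ℝ} (hT : 0 < T) (hδ : 0 ≤ δ)
    (hL : 0 ≤ L) (N : ℝ → E → E) (hN : Continuous (Function.uncurry N))
    (hLip : ∀ s ∈ Icc 0 T, ∀ y z, ‖N s y - N s z‖ ≤ L * ‖y - z‖) (B : E →L[ℝ] E) (h : ℝ → E)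
    (hh : IntegrableOn h (Ioc 0 T)) :
    ∃ z : ℝ → E, Continuous z ∧ ∀ t, z t = ∫ s in (0 : ℝ)..t,
      (Ioc 0 T).indicator (fun s => N s (z s) + B (z (s - δ)) + h s) s := by
  set K : ℝ := 2 * (L + ‖B‖) + 1 with hK
  have hK0 : 0 < K := by positivity
  -- the extension to the real line of the unweighted function
  let ext : C(Icc (0 : ℝ) T, E) → ℝ → E := fun u t =>
    Real.exp (K * clamp T t) • u (projIcc 0 T hT.le t)
  have hext : ∀ u, Continuous (ext u) := fun u => by
    have := u.continuous
    have h2 : Continuous (projIcc 0 T hT.le) := continuous_projIcc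
    fun_prop
  let F : C(Icc (0 : ℝ) T, E) → ℝ → E := fun u s => N s (ext u s) + B (ext u (s - δ)) + h s
  have hNc : ∀ u, Continuous fun s => N s (ext u s) + B (ext u (s - δ)) := fun u => by
    have h1 : Continuous fun s => N s (ext u s) := hN.comp (continuous_id.prodMk (hext u))
    have := hext u
    fun_prop
  have hFi : ∀ u, IntervalIntegrable (F u) volume 0 T := fun u => by
    refine ((hNc u).intervalIntegrable 0 T).add ?_
    rwa [intervalIntegrable_iff_integrableOn_Ioc_of_le hT.le]
  have hFi' : ∀ u, ∀ t ∈ Icc 0 T, IntervalIntegrable (F u) volume 0 t := fun u t ht =>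
    (hFi u).mono_set (by rw [uIcc_of_le ht.1, uIcc_of_le hT.le]; exact Icc_subset_Icc_right ht.2)
  have hprim : ∀ u, ContinuousOn (fun t => ∫ s in (0 : ℝ)..t, F u s) (Icc 0 T) := fun u => by
    have := intervalIntegral.continuousOn_primitive_interval (f := F u) (a := 0) (b := T)
      (μ := volume)
      (by
        rw [uIcc_of_le hT.le, integrableOn_Icc_iff_integrableOn_Ioc]
        exact (intervalIntegrable_iff_integrableOn_Ioc_of_le hT.le).1 (hFi u))
    rwa [uIcc_of_le hT.le] at this
  let Φ : C(Icc (0 : ℝ) T, E) → C(Icc (0 : ℝ) T, E) := fun u =>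
    ⟨fun t => Real.exp (-(K * t)) • ∫ s in (0 : ℝ)..t, F u s, by
      have := (hprim u).domRestrict
      have h2 : Continuous fun t : Icc (0 : ℝ) T => ∫ s in (0 : ℝ)..t, F u s := this
      fun_prop⟩
  have hdiff : ∀ u v s, ‖ext u s - ext v s‖ ≤ Real.exp (K * clamp T s) * dist u v := by
    intro u v s
    rw [← smul_sub, norm_smul, Real.norm_of_nonneg (Real.exp_pos _).le, ← dist_eq_norm]
    gcongr
    exact ContinuousMap.dist_apply_le_dist _
  have hΦ : ∀ u v, dist (Φ u) (Φ v) ≤ (1 / 2 : NNReal) * dist u v := by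
    intro u v
    refine (ContinuousMap.dist_le (by positivity)).2 fun t => ?_
    have hbound : ∀ s ∈ Ioc 0 (t : ℝ), ‖F u s - F v s‖
        ≤ (L + ‖B‖) * dist u v * Real.exp (K * s) := by
      intro s hs
      have hsT : s ∈ Icc 0 T := ⟨hs.1.le, hs.2.trans t.2.2⟩
      have e1 : F u s - F v s
          = (N s (ext u s) - N s (ext v s)) + B (ext u (s - δ) - ext v (s - δ)) := by
        simp only [F, map_sub]; abel
      have e2 : ‖ext u s - ext v s‖ ≤ Real.exp (K * s) * dist u v := by
        simpa [clamp_of_mem hsT] using hdiff u v s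
      have e3 : ‖ext u (s - δ) - ext v (s - δ)‖ ≤ Real.exp (K * s) * dist u v := by
        refine (hdiff u v (s - δ)).trans ?_
        gcongr
        exact clamp_sub_le hδ hs.1.le
      rw [e1]
      calc _ ≤ ‖N s (ext u s) - N s (ext v s)‖ + ‖B (ext u (s - δ) - ext v (s - δ))‖ :=
            norm_add_le _ _
        _ ≤ L * (Real.exp (K * s) * dist u v) + ‖B‖ * (Real.exp (K * s) * dist u v) := by
            gcongr
            · exact (hLip s hsT _ _).trans (by gcongr)
            · exact (B.le_opNorm _).trans (by gcongr)
        _ = _ := by ring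
    have hI : ‖∫ s in (0 : ℝ)..t, (F u s - F v s)‖
        ≤ ∫ s in (0 : ℝ)..t, (L + ‖B‖) * dist u v * Real.exp (K * s) :=
      intervalIntegral.norm_integral_le_of_norm_le t.2.1 (.of_forall hbound)
        (Continuous.intervalIntegrable (by fun_prop) _ _)
    have hE : ∫ s in (0 : ℝ)..t, (L + ‖B‖) * dist u v * Real.exp (K * s)
        = (L + ‖B‖) * dist u v * (K⁻¹ * (Real.exp (K * t) - 1)) := by
      rw [intervalIntegral.integral_const_mul,
        intervalIntegral.integral_comp_mul_left (fun s => Real.exp s) hK0.ne', integral_exp]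
      simp
    have hd : dist (Φ u t) (Φ v t)
        = Real.exp (-(K * t)) * ‖∫ s in (0 : ℝ)..t, (F u s - F v s)‖ := by
      rw [intervalIntegral.integral_sub (hFi' u t t.2) (hFi' v t t.2), dist_eq_norm]
      simp only [Φ, ContinuousMap.coe_mk]
      rw [← smul_sub, norm_smul, Real.norm_of_nonneg (Real.exp_pos _).le]
    rw [hd]
    have hK2 : (L + ‖B‖) * K⁻¹ ≤ 1 / 2 := by
      rw [← div_eq_mul_inv, div_le_iff₀ hK0, hK]; linarith
    calc _ ≤ Real.exp (-(K * t)) * ((L + ‖B‖) * dist u v * (K⁻¹ * (Real.exp (K * t) - 1))) := by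
          gcongr; exact hI.trans hE.le
      _ ≤ Real.exp (-(K * t)) * ((L + ‖B‖) * dist u v * (K⁻¹ * Real.exp (K * t))) := by
          gcongr; linarith
      _ = (L + ‖B‖) * K⁻¹ * dist u v * (Real.exp (-(K * t)) * Real.exp (K * t)) := by ring
      _ = (L + ‖B‖) * K⁻¹ * dist u v := by rw [← Real.exp_add]; simp
      _ ≤ 1 / 2 * dist u v := by gcongr
      _ = _ := by simp
  have hcontr : ContractingWith (1 / 2 : NNReal) Φ :=
    ⟨by
      rw [← NNReal.coe_lt_coe]
      norm_num, LipschitzWith.of_dist_le_mul hΦ⟩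
  set u := ContractingWith.fixedPoint Φ hcontr
  have hu : Φ u = u := hcontr.fixedPoint_isFixedPt
  refine ⟨ext u, hext u, fun t => ?_⟩
  rw [integral_indicator_Ioc hT.le]
  have hc := clamp_mem hT.le t
  have e1 : ext u t = Real.exp (K * clamp T t) • u ⟨clamp T t, hc⟩ := by
    simp only [ext]
    congr 2
    exact Subtype.ext (by simp [projIcc, clamp, min_comm])
  rw [e1]
  conv_lhs => rw [← hu]
  simp only [Φ, ContinuousMap.coe_mk]
  rw [smul_smul, ← Real.exp_add]
  simp [F]

end Gronwall

/-! ### Primitives of integrable functions, integration by parts and translations -/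

section Primitives

variable {E : Type*} [NormedAddCommGroup E] [InnerProductSpace ℝ E]

/-- Integration by parts for absolutely continuous functions with values in an inner product
space, given as primitives of integrable functions. -/
theorem integral_inner_add_inner [CompleteSpace E] {a b : ℝ} (hab : a ≤ b) {p q u v : ℝ → E}
    (hq : IntervalIntegrable q volume a b) (hv : IntervalIntegrable v volume a b)
    (hp : ∀ t ∈ Icc a b, p t = p a + ∫ s in a..t, q s)
    (hu : ∀ t ∈ Icc a b, u t = u a + ∫ s in a..t, v s) :
    ∫ t in a..b, (⟪q t, u t⟫ + ⟪p t, v t⟫) = ⟪p b, u b⟫ - ⟪p a, u a⟫ := by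
  have hbb : b ∈ Icc a b := ⟨hab, le_rfl⟩
  set μ := (volume : Measure ℝ).restrict (Ioc a b) with hμ
  have hq' : Integrable q μ := (intervalIntegrable_iff_integrableOn_Ioc_of_le hab).1 hq
  have hv' : Integrable v μ := (intervalIntegrable_iff_integrableOn_Ioc_of_le hab).1 hv
  have hS : MeasurableSet {z : ℝ × ℝ | z.2 ≤ z.1} := measurableSet_le measurable_snd measurable_fst
  have hprod : Integrable (fun z : ℝ × ℝ => ⟪q z.1, v z.2⟫) (μ.prod μ) :=
    hq'.op_fst_snd (op := fun x y => ⟪x, y⟫) (by fun_prop)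
      ⟨1, fun x y => by simpa using norm_inner_le_norm (𝕜 := ℝ) x y⟩ hv'
  have hind := hprod.indicator hS
  have hswap := integral_integral_swap
    (f := fun t s => {z : ℝ × ℝ | z.2 ≤ z.1}.indicator (fun z => ⟪q z.1, v z.2⟫) (t, s)) hind
  have hsub : ∀ t ∈ Icc a b, IntervalIntegrable v volume a t := fun t ht =>
    hv.mono_set (by rw [uIcc_of_le ht.1, uIcc_of_le hab]; exact Icc_subset_Icc_right ht.2)
  have hsub' : ∀ t ∈ Icc a b, IntervalIntegrable q volume a t := fun t ht =>
    hq.mono_set (by rw [uIcc_of_le ht.1, uIcc_of_le hab]; exact Icc_subset_Icc_right ht.2)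
  have e1 : ∀ t ∈ Ioc a b,
      ∫ s, {z : ℝ × ℝ | z.2 ≤ z.1}.indicator (fun z => ⟪q z.1, v z.2⟫) (t, s) ∂μ
        = ⟪q t, u t - u a⟫ := by
    intro t ht
    have ht' : t ∈ Icc a b := ⟨ht.1.le, ht.2⟩
    have : ∀ s, {z : ℝ × ℝ | z.2 ≤ z.1}.indicator (fun z => ⟪q z.1, v z.2⟫) (t, s)
        = (Iic t).indicator (fun s => ⟪q t, v s⟫) s := fun s => by
      simp [indicator_apply]
    simp_rw [this]
    rw [hμ, setIntegral_indicator measurableSet_Iic, Ioc_inter_Iic, min_eq_right ht.2,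
      hu t ht', add_sub_cancel_left, intervalIntegral.integral_of_le ht.1.le]
    exact integral_inner ((intervalIntegrable_iff_integrableOn_Ioc_of_le ht.1.le).1 (hsub t ht')) _
  have e2 : ∀ s ∈ Ioc a b,
      ∫ t, {z : ℝ × ℝ | z.2 ≤ z.1}.indicator (fun z => ⟪q z.1, v z.2⟫) (t, s) ∂μ
        = ⟪p b - p s, v s⟫ := by
    intro s hs
    have hs' : s ∈ Icc a b := ⟨hs.1.le, hs.2⟩
    have : ∀ t, {z : ℝ × ℝ | z.2 ≤ z.1}.indicator (fun z => ⟪q z.1, v z.2⟫) (t, s)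
        = (Ici s).indicator (fun t => ⟪v s, q t⟫) t := fun t => by
      simp [indicator_apply, real_inner_comm]
    simp_rw [this]
    have hIcc : Ioc a b ∩ Ici s = Icc s b := by
      ext t; simp only [mem_inter_iff, mem_Ioc, mem_Ici, mem_Icc]
      exact ⟨fun h => ⟨h.2, h.1.2⟩, fun h => ⟨⟨hs.1.trans_le h.1, h.2⟩, h.1⟩⟩
    have hps : p b - p s = ∫ t in s..b, q t := by
      rw [hp b hbb, hp s hs', add_sub_add_left_eq_sub,
        intervalIntegral.integral_interval_sub_left hq (hsub' s hs')]
    rw [hμ, setIntegral_indicator measurableSet_Ici, hIcc, integral_Icc_eq_integral_Ioc, hps,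
      real_inner_comm, intervalIntegral.integral_of_le hs.2]
    exact integral_inner (hq'.mono_measure (Measure.restrict_mono
      (Ioc_subset_Ioc_left hs.1.le) le_rfl)) _
  rw [integral_congr_ae ((ae_restrict_mem measurableSet_Ioc).mono e1),
    integral_congr_ae ((ae_restrict_mem measurableSet_Ioc).mono e2)] at hswap
  have hcu : ContinuousOn u (Icc a b) := by
    have := intervalIntegral.continuousOn_primitive_interval (f := v) (a := a) (b := b)
      (μ := volume) (by
        rw [uIcc_of_le hab, integrableOn_Icc_iff_integrableOn_Ioc]; exact hv')
    rw [uIcc_of_le hab] at this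
    exact (continuousOn_const.add this).congr hu
  have hcp : ContinuousOn p (Icc a b) := by
    have := intervalIntegral.continuousOn_primitive_interval (f := q) (a := a) (b := b)
      (μ := volume) (by
        rw [uIcc_of_le hab, integrableOn_Icc_iff_integrableOn_Ioc]; exact hq')
    rw [uIcc_of_le hab] at this
    exact (continuousOn_const.add this).congr hp
  have hint : ∀ {x y : ℝ → E}, IntervalIntegrable x volume a b → ContinuousOn y (Icc a b) →
      IntervalIntegrable (fun t => ⟪y t, x t⟫) volume a b := by
    intro x y hx hy
    rw [intervalIntegrable_iff_integrableOn_Ioc_of_le hab] at hx ⊢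
    obtain ⟨M, hM⟩ := isCompact_Icc.exists_bound_of_continuousOn hy
    have hym : AEStronglyMeasurable y (volume.restrict (Ioc a b)) :=
      (hy.mono Ioc_subset_Icc_self).aestronglyMeasurable measurableSet_Ioc
    refine (hx.norm.const_mul M).mono' (hym.inner hx.aestronglyMeasurable) ?_
    filter_upwards [ae_restrict_mem measurableSet_Ioc] with t ht
    exact (norm_inner_le_norm _ _).trans (by gcongr; exact hM t ⟨ht.1.le, ht.2⟩)
  have i1 : IntervalIntegrable (fun t => ⟪q t, u t⟫) volume a b := by
    simpa only [real_inner_comm] using hint hq hcu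
  have i2 : IntervalIntegrable (fun t => ⟪p t, v t⟫) volume a b := hint hv hcp
  have i3 : IntervalIntegrable (fun t => ⟪q t, u a⟫) volume a b := by
    simpa only [real_inner_comm] using hint (y := fun _ => u a) hq continuousOn_const
  have i4 : IntervalIntegrable (fun t => ⟪p b, v t⟫) volume a b :=
    hint (y := fun _ => p b) hv continuousOn_const
  rw [← intervalIntegral.integral_of_le hab, ← intervalIntegral.integral_of_le hab] at hswap
  simp_rw [inner_sub_left, inner_sub_right] at hswap
  rw [intervalIntegral.integral_sub i1 i3, intervalIntegral.integral_sub i4 i2] at hswap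
  rw [intervalIntegral.integral_add i1 i2]
  have e3 : ∫ t in a..b, ⟪q t, u a⟫ = ⟪p b - p a, u a⟫ := by
    simp_rw [real_inner_comm _ (q _)]
    rw [hp b hbb, add_sub_cancel_left, real_inner_comm (u a),
      intervalIntegral.integral_of_le hab, intervalIntegral.integral_of_le hab]
    exact integral_inner hq' _
  have e4 : ∫ t in a..b, ⟪p b, v t⟫ = ⟪p b, u b - u a⟫ := by
    rw [hu b hbb, add_sub_cancel_left,
      intervalIntegral.integral_of_le hab, intervalIntegral.integral_of_le hab]
    exact integral_inner hv' _
  rw [e3, e4, inner_sub_left, inner_sub_right] at hswap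
  linarith

/-- Fubini's theorem for the increments of a translate of an absolutely continuous function. -/
theorem integral_inner_translate_sub [CompleteSpace E] {T : ℝ} (hT : 0 ≤ T) {p Y K : ℝ → E}
    (hp : Continuous p) (hK : Integrable K) (hY : ∀ t, Y t = Y 0 + ∫ s in (0 : ℝ)..t, K s)
    (B : E →L[ℝ] E) (σ τ : ℝ) :
    ∫ t in (0 : ℝ)..T, ⟪p t, B (Y (t - σ) - Y (t - τ))⟫
      = -∫ r in τ..σ, ∫ t in (0 : ℝ)..T, ⟪p t, B (K (t - r))⟫ := by
  have hII : ∀ c d, IntervalIntegrable K volume c d := fun c d => hK.intervalIntegrable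
  have e1 : ∀ t, ⟪p t, B (Y (t - σ) - Y (t - τ))⟫ = -∫ r in τ..σ, ⟪p t, B (K (t - r))⟫ := by
    intro t
    rw [hY (t - σ), hY (t - τ), add_sub_add_left_eq_sub,
      intervalIntegral.integral_interval_sub_left (hII _ _) (hII _ _)]
    have h1 : ∫ r in τ..σ, K (t - r) = ∫ s in t - σ..t - τ, K s :=
      intervalIntegral.integral_comp_sub_left (fun s => K s) t
    rw [intervalIntegral.integral_symm, ← h1, map_neg, inner_neg_right]
    have h2 : IntervalIntegrable (fun r => K (t - r)) volume τ σ :=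
      (hK.comp_sub_left t).intervalIntegrable
    have := ((innerSL ℝ (p t)).comp B).intervalIntegral_comp_comm h2
    simpa using this.symm
  simp_rw [e1]
  rw [intervalIntegral.integral_neg, intervalIntegral_intervalIntegral_swap]
  have hKp : IntegrableOn (fun z : ℝ × ℝ => K (z.1 - z.2)) (uIoc 0 T ×ˢ uIoc τ σ) := by
    have h1 : Integrable ((uIoc τ σ).indicator fun _ => (1 : ℝ)) :=
      (integrable_indicator_iff measurableSet_uIoc).2 (integrableOn_const (by simp))
    have h2 := h1.convolution_integrand (ContinuousLinearMap.lsmul ℝ ℝ) hK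
    refine h2.integrableOn.congr_fun ?_ (measurableSet_uIoc.prod measurableSet_uIoc)
    intro z hz
    simp [indicator_of_mem hz.2]
  obtain ⟨M, hM⟩ := isCompact_Icc.exists_bound_of_continuousOn (hp.continuousOn (s := Icc 0 T))
  refine (hKp.norm.const_mul (M * ‖B‖)).mono' ?_ ?_
  · exact (hp.comp continuous_fst).aestronglyMeasurable.inner
      (B.continuous.comp_aestronglyMeasurable hKp.aestronglyMeasurable)
  · filter_upwards [ae_restrict_mem (measurableSet_uIoc.prod measurableSet_uIoc)] with z hz
    have hz1 := hz.1
    rw [uIoc_of_le hT] at hz1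
    have hp1 := hM z.1 ⟨hz1.1.le, hz1.2⟩
    calc ‖⟪p z.1, B (K (z.1 - z.2))⟫‖ ≤ ‖p z.1‖ * ‖B (K (z.1 - z.2))‖ := norm_inner_le_norm _ _
      _ ≤ M * (‖B‖ * ‖K (z.1 - z.2)‖) := by
          gcongr
          · exact (norm_nonneg _).trans hp1
          · exact B.le_opNorm _
      _ = _ := by ring

/-- Pairings of uniformly convergent functions with translates of a dominated, almost everywhere
convergent family converge: after translation of the variable this is dominated convergence, since
the translated cut-off functions of `(0, T]` converge off two points. -/
theorem tendsto_integral_inner_translate {ι : Type*} {l : Filter ι} [l.IsCountablyGenerated]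
    {T : ℝ} (hT : 0 ≤ T) {p K : ι → ℝ → E} {p₀ K₀ : ℝ → E} {ρ : ι → ℝ} {ρ₀ : ℝ} {k : ℝ → ℝ}
    (B : E →L[ℝ] E) (hρ : Tendsto ρ l (𝓝 ρ₀)) (hp : ∀ᶠ i in l, Continuous (p i))
    (hp₀ : Continuous p₀) (hpu : ∀ ε > 0, ∀ᶠ i in l, ∀ t ∈ Icc 0 T, ‖p i t - p₀ t‖ ≤ ε)
    (hKm : ∀ᶠ i in l, AEStronglyMeasurable (K i)) (hk : Integrable k)
    (hKk : ∀ᶠ i in l, ∀ s, ‖K i s‖ ≤ k s)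
    (hKt : ∀ᵐ s, Tendsto (fun i => K i s) l (𝓝 (K₀ s))) :
    Tendsto (fun i => ∫ t in (0 : ℝ)..T, ⟪p i t, B (K i (t - ρ i))⟫) l
      (𝓝 (∫ t in (0 : ℝ)..T, ⟪p₀ t, B (K₀ (t - ρ₀))⟫)) := by
  have hrw : ∀ (q L : ℝ → E) (r : ℝ), ∫ t in (0 : ℝ)..T, ⟪q t, B (L (t - r))⟫
      = ∫ s, (Ioc 0 T).indicator (fun t => ⟪q t, B (L (t - r))⟫) (s + r) := by
    intro q L r
    rw [integral_add_right_eq_self (fun s => (Ioc 0 T).indicator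
      (fun t => ⟪q t, B (L (t - r))⟫) s), integral_indicator measurableSet_Ioc,
      intervalIntegral.integral_of_le hT]
  simp_rw [hrw]
  obtain ⟨M, hM⟩ := isCompact_Icc.exists_bound_of_continuousOn (hp₀.continuousOn (s := Icc 0 T))
  have hM0 : 0 ≤ M := (norm_nonneg _).trans (hM 0 ⟨le_rfl, hT⟩)
  refine tendsto_integral_filter_of_dominated_convergence
    (fun s => (M + 1) * (‖B‖ * k s)) ?_ ?_ ((hk.const_mul _).const_mul _) ?_
  · filter_upwards [hp, hKm] with i hp hKm
    have h1 : AEStronglyMeasurable (fun t => K i (t - ρ i)) :=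
      hKm.comp_quasiMeasurePreserving
        (measurePreserving_sub_right volume (ρ i)).quasiMeasurePreserving
    have h2 : AEStronglyMeasurable ((Ioc 0 T).indicator fun t => ⟪p i t, B (K i (t - ρ i))⟫) :=
      (hp.aestronglyMeasurable.inner (B.continuous.comp_aestronglyMeasurable h1)).indicator
        measurableSet_Ioc
    exact h2.comp_quasiMeasurePreserving
      (measurePreserving_add_right volume (ρ i)).quasiMeasurePreserving
  · filter_upwards [hpu 1 one_pos, hKk] with i hpu hKk
    refine .of_forall fun s => ?_
    have hk0 : 0 ≤ k s := (norm_nonneg _).trans (hKk s)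
    by_cases hs : s + ρ i ∈ Ioc 0 T
    · rw [indicator_of_mem hs, add_sub_cancel_right]
      have hs' : s + ρ i ∈ Icc 0 T := ⟨hs.1.le, hs.2⟩
      have h1 : ‖p i (s + ρ i)‖ ≤ M + 1 := by
        have h2 := hpu _ hs'
        have h3 := hM _ hs'
        have h4 := norm_add_le (p i (s + ρ i) - p₀ (s + ρ i)) (p₀ (s + ρ i))
        rw [sub_add_cancel] at h4
        linarith
      refine (norm_inner_le_norm _ _).trans ?_
      gcongr
      exact (B.le_opNorm _).trans (by gcongr; exact hKk s)
    · rw [indicator_of_notMem hs, norm_zero]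
      positivity
  · have hne : ∀ c : ℝ, ∀ᵐ s : ℝ, s ≠ c := fun c => by simp [ae_iff, measure_singleton]
    filter_upwards [hKt, hne (-ρ₀), hne (T - ρ₀)] with s hKt h0 hT'
    have hlim : Tendsto (fun i => s + ρ i) l (𝓝 (s + ρ₀)) := tendsto_const_nhds.add hρ
    simp only [indicator_apply, add_sub_cancel_right]
    by_cases hs : s + ρ₀ ∈ Ioc 0 T
    · have hs' : s + ρ₀ ∈ Ioo 0 T := ⟨hs.1, lt_of_le_of_ne hs.2 fun h => hT' (by linarith)⟩
      rw [if_pos hs]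
      have hev : ∀ᶠ i in l, s + ρ i ∈ Ioo 0 T := hlim.eventually (isOpen_Ioo.mem_nhds hs')
      have hpt : Tendsto (fun i => p i (s + ρ i)) l (𝓝 (p₀ (s + ρ₀))) := by
        have h1 : Tendsto (fun i => p i (s + ρ i) - p₀ (s + ρ i)) l (𝓝 0) := by
          rw [Metric.tendsto_nhds]
          intro ε hε
          filter_upwards [hev, hpu (ε / 2) (half_pos hε)] with i h2 h3
          rw [dist_zero_right]
          exact (h3 _ ⟨h2.1.le, h2.2.le⟩).trans_lt (half_lt_self hε)
        simpa using h1.add ((hp₀.tendsto _).comp hlim)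
      refine (hpt.inner ((B.continuous.tendsto _).comp hKt)).congr' ?_
      filter_upwards [hev] with i hi
      rw [if_pos ⟨hi.1, hi.2.le⟩]
      rfl
    · rw [if_neg hs]
      refine tendsto_const_nhds.congr' ?_
      have hs' : s + ρ₀ ∈ (Icc 0 T)ᶜ := fun h =>
        hs ⟨lt_of_le_of_ne h.1 fun h' => h0 (by linarith), h.2⟩
      filter_upwards [hlim.eventually (isClosed_Icc.isOpen_compl.mem_nhds hs')] with i hi
      rw [if_neg fun h => hi ⟨h.1.le, h.2⟩]

end Primitives

/-! ### The delay equation on the whole line -/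

/-- The data of the delay equation, with history, inhomogeneity and target extended to the whole
line. Of the lower bound for `Df` only its consequence `growth` is kept, because this bound is
stable under multiplication of `f` by a cut-off function. -/
structure DelaySystem (n : ℕ) where
  (b T : ℝ)
  b_pos : 0 < b
  T_pos : 0 < T
  A : Vec n →L[ℝ] Vec n
  f : Vec n → Vec n
  contDiff : ContDiff ℝ 2 f
  (c d : ℝ)
  c_nonneg : 0 ≤ c
  d_nonneg : 0 ≤ d
  growth : ∀ y, -(c * ‖y‖ ^ 2) - d * ‖y‖ ≤ ⟪f y, y⟫
  (φ φ₁ φ₂ g g₁ xd : ℝ → Vec n)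
  φ_eq : ∀ t, φ t = φ 0 + ∫ s in (0 : ℝ)..t, φ₁ s
  φ₁_eq : ∀ t, φ₁ t = φ₁ 0 + ∫ s in (0 : ℝ)..t, φ₂ s
  g_eq : ∀ t, g t = g 0 + ∫ s in (0 : ℝ)..t, g₁ s
  φ₂_int : Integrable φ₂
  g₁_int : Integrable g₁
  xd_memLp : MemLp xd 2 (volume.restrict (Ioc 0 T))

theorem continuous_of_eq_integral {E : Type*} [NormedAddCommGroup E] [NormedSpace ℝ E]
    {u v : ℝ → E} (hv : ∀ a b, IntervalIntegrable v volume a b)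
    (hu : ∀ t, u t = u 0 + ∫ s in (0 : ℝ)..t, v s) : Continuous u := by
  rw [show u = fun t => u 0 + ∫ s in (0 : ℝ)..t, v s from funext hu]
  exact continuous_const.add (intervalIntegral.continuous_primitive hv 0)

theorem norm_le_of_eq_integral {E : Type*} [NormedAddCommGroup E] [NormedSpace ℝ E]
    {u v : ℝ → E} (hv : Integrable v) (hu : ∀ t, u t = u 0 + ∫ s in (0 : ℝ)..t, v s) (t : ℝ) :
    ‖u t‖ ≤ ‖u 0‖ + ∫ s, ‖v s‖ := by
  rw [hu t]
  refine (norm_add_le _ _).trans ?_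
  gcongr
  · refine intervalIntegral.norm_integral_le_integral_norm_uIoc.trans ?_
    exact setIntegral_le_integral hv.norm (.of_forall fun s => norm_nonneg _)

theorem exists_lipschitz_ball {E F : Type*} [NormedAddCommGroup E] [NormedSpace ℝ E]
    [ProperSpace E] [NormedAddCommGroup F] [NormedSpace ℝ F] {f : E → F} (hf : ContDiff ℝ 1 f)
    (M : ℝ) : ∃ L, 0 < L ∧ (∀ y, ‖y‖ ≤ M → ‖fderiv ℝ f y‖ ≤ L) ∧
      ∀ y z, ‖y‖ ≤ M → ‖z‖ ≤ M → ‖f y - f z‖ ≤ L * ‖y - z‖ := by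
  obtain ⟨L, hL⟩ := (isCompact_closedBall (0 : E) M).exists_bound_of_continuousOn
    (hf.continuous_fderiv one_ne_zero).continuousOn
  have h1 : ∀ y, ‖y‖ ≤ M → ‖fderiv ℝ f y‖ ≤ max L 1 := fun y hy =>
    (hL y (by simpa using hy)).trans (le_max_left _ _)
  refine ⟨max L 1, by positivity, h1, fun y z hy hz => ?_⟩
  exact (convex_closedBall (0 : E) M).norm_image_sub_le_of_norm_fderiv_le
    (fun x _ => (hf.differentiable one_ne_zero) x) (fun x hx => h1 x (by simpa using hx))
    (by simpa using hz) (by simpa using hy)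

namespace DelaySystem

variable {n : ℕ} (S : DelaySystem n)

theorem continuous_φ₁ : Continuous S.φ₁ :=
  continuous_of_eq_integral (fun _ _ => S.φ₂_int.intervalIntegrable) S.φ₁_eq

theorem continuous_φ : Continuous S.φ :=
  continuous_of_eq_integral (fun _ _ => S.continuous_φ₁.intervalIntegrable _ _) S.φ_eq

theorem continuous_g : Continuous S.g :=
  continuous_of_eq_integral (fun _ _ => S.g₁_int.intervalIntegrable) S.g_eq

theorem continuous_f : Continuous S.f := S.contDiff.continuous

/-- The velocity `-f(x(s)) + A x(s - τ) + g(s)` prescribed by the delay equation. -/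
def field (τ : ℝ) (x : ℝ → Vec n) (s : ℝ) : Vec n := -S.f (x s) + S.A (x (s - τ)) + S.g s

/-- The derivative of a solution: the derivative of the history on the left of `0`, the prescribed
velocity on `(0, T]`, continued by a constant beyond `T`. At `0` it has a jump. -/
noncomputable def slope (τ : ℝ) (x : ℝ → Vec n) (t : ℝ) : Vec n :=
  if t ≤ 0 then S.φ₁ t else S.field τ x (clamp S.T t)

/-- A solution of the delay equation on the whole line, in integrated form. -/
structure IsSolution (τ : ℝ) (x : ℝ → Vec n) : Prop where
  continuous : Continuous x
  eq : ∀ t, x t = S.φ 0 + ∫ s in (0 : ℝ)..t, S.slope τ x s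

variable {S} {τ σ : ℝ} {x y : ℝ → Vec n}

theorem continuous_field_clamp (hτ : τ ∈ Icc 0 S.b) (hx : ContinuousOn x (Icc (-S.b) S.T)) :
    Continuous fun t => S.field τ x (clamp S.T t) := by
  have hb := S.b_pos
  have hc := fun t => clamp_mem S.T_pos.le t
  have h1 : Continuous fun t => x (clamp S.T t) :=
    hx.comp_continuous (continuous_clamp _) fun t => ⟨by linarith [(hc t).1], (hc t).2⟩
  have h2 : Continuous fun t => x (clamp S.T t - τ) :=
    hx.comp_continuous ((continuous_clamp _).sub continuous_const) fun t =>
      ⟨by linarith [(hc t).1, hτ.2], by linarith [(hc t).2, hτ.1]⟩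
  have h3 := S.continuous_f.comp h1
  have h4 := S.continuous_g.comp (continuous_clamp S.T)
  exact (h3.neg.add (S.A.continuous.comp h2)).add h4

theorem measurable_slope (hτ : τ ∈ Icc 0 S.b) (hx : ContinuousOn x (Icc (-S.b) S.T)) :
    Measurable (S.slope τ x) :=
  Measurable.ite measurableSet_Iic S.continuous_φ₁.measurable
    (continuous_field_clamp hτ hx).measurable

theorem norm_φ₁_le (t : ℝ) : ‖S.φ₁ t‖ ≤ ‖S.φ₁ 0‖ + ∫ s, ‖S.φ₂ s‖ :=
  norm_le_of_eq_integral S.φ₂_int S.φ₁_eq t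

theorem norm_g_le (t : ℝ) : ‖S.g t‖ ≤ ‖S.g 0‖ + ∫ s, ‖S.g₁ s‖ :=
  norm_le_of_eq_integral S.g₁_int S.g_eq t

theorem intervalIntegrable_slope (hτ : τ ∈ Icc 0 S.b) (hx : ContinuousOn x (Icc (-S.b) S.T))
    (p q : ℝ) : IntervalIntegrable (S.slope τ x) volume p q := by
  obtain ⟨M, hM⟩ := isCompact_uIcc.exists_bound_of_continuousOn
    ((continuous_field_clamp hτ hx).continuousOn (s := uIcc p q))
  rw [intervalIntegrable_iff]
  have : IsFiniteMeasure (volume.restrict (uIoc p q)) := ⟨by simp [uIoc]⟩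
  refine Integrable.of_bound (measurable_slope hτ hx).aestronglyMeasurable
    (max (‖S.φ₁ 0‖ + ∫ s, ‖S.φ₂ s‖) M) ?_
  filter_upwards [ae_restrict_mem measurableSet_uIoc] with t ht
  rw [slope]
  split_ifs with h
  · exact (norm_φ₁_le t).trans (le_max_left _ _)
  · exact (hM t (uIoc_subset_uIcc ht)).trans (le_max_right _ _)

theorem slope_congr (hτ : τ ∈ Icc 0 S.b) (h : EqOn x y (Icc (-S.b) S.T)) :
    S.slope τ x = S.slope τ y := by
  have hb := S.b_pos
  ext1 t
  have hc := clamp_mem S.T_pos.le t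
  rw [slope, slope, field, field, h ⟨by linarith [hc.1], hc.2⟩,
    h ⟨by linarith [hc.1, hτ.2], by linarith [hc.2, hτ.1]⟩]

theorem slope_of_nonpos {t : ℝ} (ht : t ≤ 0) : S.slope τ x t = S.φ₁ t := if_pos ht

theorem slope_of_mem {t : ℝ} (ht : t ∈ Ioc 0 S.T) : S.slope τ x t = S.field τ x t := by
  rw [slope, if_neg (not_le.2 ht.1), clamp_of_mem ⟨ht.1.le, ht.2⟩]

theorem integral_slope_of_nonpos {t : ℝ} (ht : t ≤ 0) :
    S.φ 0 + ∫ s in (0 : ℝ)..t, S.slope τ x s = S.φ t := by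
  rw [S.φ_eq t]
  congr 1
  refine intervalIntegral.integral_congr fun s hs => ?_
  rw [uIcc_of_ge ht] at hs
  exact slope_of_nonpos hs.2

theorem integral_slope_of_mem {t : ℝ} (ht : t ∈ Icc 0 S.T) :
    ∫ s in (0 : ℝ)..t, S.slope τ x s = ∫ s in (0 : ℝ)..t, S.field τ x s := by
  refine intervalIntegral.integral_congr_ae (.of_forall fun s hs => ?_)
  rw [uIoc_of_le ht.1] at hs
  exact slope_of_mem ⟨hs.1, hs.2.trans ht.2⟩

/-- A solution on `[-b, T]` extends to a solution on the whole line. -/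
theorem isSolution_extension (hτ : τ ∈ Icc 0 S.b) (hx : ContinuousOn x (Icc (-S.b) S.T))
    (hhist : ∀ t ∈ Icc (-S.b) 0, x t = S.φ t)
    (heq : ∀ t ∈ Icc 0 S.T, x t = S.φ 0 + ∫ s in (0 : ℝ)..t, S.field τ x s) :
    S.IsSolution τ (fun t => S.φ 0 + ∫ s in (0 : ℝ)..t, S.slope τ x s) ∧
      EqOn (fun t => S.φ 0 + ∫ s in (0 : ℝ)..t, S.slope τ x s) x (Icc (-S.b) S.T) := by
  have hE : EqOn (fun t => S.φ 0 + ∫ s in (0 : ℝ)..t, S.slope τ x s) x (Icc (-S.b) S.T) := by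
    intro t ht
    rcases le_total t 0 with h0 | h0
    · rw [hhist t ⟨ht.1, h0⟩]
      exact integral_slope_of_nonpos h0
    · have ht' : t ∈ Icc 0 S.T := ⟨h0, ht.2⟩
      rw [heq t ht', ← integral_slope_of_mem ht']
  refine ⟨⟨continuous_const.add (intervalIntegral.continuous_primitive
    (intervalIntegrable_slope hτ hx) 0), fun t => ?_⟩, hE⟩
  rw [slope_congr hτ hE]

namespace IsSolution

theorem apply_of_nonpos (hx : S.IsSolution τ x) {t : ℝ} (ht : t ≤ 0) : x t = S.φ t := by
  rw [hx.eq t, integral_slope_of_nonpos ht]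

theorem apply_sub (hτ : τ ∈ Icc 0 S.b) (hx : S.IsSolution τ x) (s t : ℝ) :
    x t - x s = ∫ r in s..t, S.slope τ x r := by
  have hI := intervalIntegrable_slope (S := S) hτ hx.continuous.continuousOn
  rw [hx.eq t, hx.eq s, add_sub_add_left_eq_sub,
    intervalIntegral.integral_interval_sub_left (hI _ _) (hI _ _)]

theorem continuousAt_slope (hτ : τ ∈ Icc 0 S.b) (hx : S.IsSolution τ x) {t : ℝ} (ht : t ≠ 0) :
    ContinuousAt (S.slope τ x) t := by
  rcases lt_or_gt_of_ne ht with h | h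
  · refine S.continuous_φ₁.continuousAt.congr ?_
    filter_upwards [Iio_mem_nhds h] with s hs
    exact (slope_of_nonpos (le_of_lt hs)).symm
  · refine (continuous_field_clamp hτ hx.continuous.continuousOn).continuousAt.congr ?_
    filter_upwards [Ioi_mem_nhds h] with s hs
    rw [slope, if_neg (not_le.2 hs)]

theorem hasDerivAt (hτ : τ ∈ Icc 0 S.b) (hx : S.IsSolution τ x) {t : ℝ} (ht : t ≠ 0) :
    HasDerivAt x (S.slope τ x t) t := by
  have hc := hx.continuous.continuousOn (s := Icc (-S.b) S.T)
  have h := intervalIntegral.integral_hasDerivAt_right (intervalIntegrable_slope hτ hc 0 t)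
    ((measurable_slope hτ hc).stronglyMeasurable.stronglyMeasurableAtFilter)
    (hx.continuousAt_slope hτ ht)
  exact (h.const_add (S.φ 0)).congr_of_eventuallyEq (.of_forall hx.eq)

end IsSolution

/-- The same data with another nonlinearity satisfying the same growth bound. -/
def withField (S : DelaySystem n) (f' : Vec n → Vec n) (hf' : ContDiff ℝ 2 f')
    (hg' : ∀ y, -(S.c * ‖y‖ ^ 2) - S.d * ‖y‖ ≤ ⟪f' y, y⟫) : DelaySystem n :=
  { S with f := f', contDiff := hf', growth := hg' }

/-- A priori bound, uniform in the delay and in the nonlinearity: the energy `‖x‖²` satisfies a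
delay Gronwall inequality whose constants depend on `f` only through its growth bound. -/
theorem exists_norm_le_withField (S : DelaySystem n) : ∃ M, ∀ f' hf' hg', ∀ τ ∈ Icc 0 S.b, ∀ x,
    (S.withField f' hf' hg').IsSolution τ x → ∀ t ∈ Icc (-S.b) S.T, ‖x t‖ ≤ M := by
  have hb := S.b_pos
  have hT := S.T_pos
  have hc := S.c_nonneg
  obtain ⟨Mφ, hMφ⟩ := isCompact_Icc.exists_bound_of_continuousOn
    (S.continuous_φ.continuousOn (s := Icc (-S.b) 0))
  set G := ‖S.g 0‖ + ∫ s, ‖S.g₁ s‖ with hG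
  have hMφ0 : 0 ≤ Mφ := (norm_nonneg _).trans (hMφ 0 ⟨by linarith, le_rfl⟩)
  set C := 2 * S.c + 2 + ‖S.A‖ with hC
  have hC0 : 0 < C := by positivity
  set a := Mφ ^ 2 + S.T * (S.d ^ 2 + G ^ 2) with ha
  have ha0 : 0 ≤ a := by positivity
  refine ⟨√(2 * (1 + C * S.T) * Real.exp (4 * C * S.T) * a) + Mφ, ?_⟩
  intro f' hf' hg' τ hτ x hx t ht
  have hx0 : ∀ t ∈ Icc (-S.b) 0, ‖x t‖ ≤ Mφ := fun t ht => by
    rw [hx.apply_of_nonpos ht.2]; exact hMφ t ht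
  rcases le_total t 0 with h0 | h0
  · exact (hx0 t ⟨ht.1, h0⟩).trans (le_add_of_nonneg_left (Real.sqrt_nonneg _))
  have hxc := hx.continuous
  have hfc : Continuous ((S.withField f' hf' hg').field τ x) := by
    have h1 := hf'.continuous.comp hxc
    have h2 : Continuous fun s => x (s - τ) := by fun_prop
    exact (h1.neg.add (S.A.continuous.comp h2)).add S.continuous_g
  have hG' := delay_gronwall (u := fun t => ‖x t‖ ^ 2) (δ := τ) hC0 hT hτ.1 ha0 (by fun_prop)
    (fun t => by positivity)
    (fun t ht => by
      have h1 := hx0 t ⟨by linarith [ht.1, hτ.2], ht.2⟩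
      have h2 : ‖x t‖ ^ 2 ≤ Mφ ^ 2 := by gcongr
      have h3 : 0 ≤ S.T * (S.d ^ 2 + G ^ 2) := by positivity
      linarith) (fun t ht => by
      have e1 : ∫ s in (0 : ℝ)..t, 2 * ⟪x s, (S.withField f' hf' hg').field τ x s⟫
          = ‖x t‖ ^ 2 - ‖x 0‖ ^ 2 := by
        refine intervalIntegral.integral_eq_sub_of_hasDerivAt_of_le (f := fun s => ‖x s‖ ^ 2) ht.1
          (by fun_prop) (fun s hs => ?_) (Continuous.intervalIntegrable (by fun_prop) _ _)
        have h1 := (hx.hasDerivAt (S := S.withField f' hf' hg') hτ hs.1.ne').norm_sq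
        rwa [slope_of_mem (S := S.withField f' hf' hg') ⟨hs.1, hs.2.le.trans ht.2⟩] at h1
      have e2 : ∫ s in (0 : ℝ)..t, 2 * ⟪x s, (S.withField f' hf' hg').field τ x s⟫
          ≤ ∫ s in (0 : ℝ)..t, (C * (‖x s‖ ^ 2 + ‖x (s - τ)‖ ^ 2) + (S.d ^ 2 + G ^ 2)) := by
        refine intervalIntegral.integral_mono_on ht.1
          (Continuous.intervalIntegrable (by fun_prop) _ _)
          (Continuous.intervalIntegrable (by fun_prop) _ _) fun s hs => ?_
        have h1 := hg' (x s)
        have h2 : ⟪x s, S.A (x (s - τ))⟫ ≤ ‖x s‖ * (‖S.A‖ * ‖x (s - τ)‖) :=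
          (real_inner_le_norm _ _).trans (by gcongr; exact S.A.le_opNorm _)
        have h3 : ⟪x s, S.g s⟫ ≤ ‖x s‖ * G :=
          (real_inner_le_norm _ _).trans (by gcongr; exact norm_g_le s)
        have e : ⟪x s, (S.withField f' hf' hg').field τ x s⟫
            = -⟪f' (x s), x s⟫ + ⟪x s, S.A (x (s - τ))⟫ + ⟪x s, S.g s⟫ := by
          rw [field, inner_add_right, inner_add_right, inner_neg_right, real_inner_comm]
          rfl
        rw [e]
        have h4 : 2 * (‖S.A‖ * (‖x s‖ * ‖x (s - τ)‖))
            ≤ ‖S.A‖ * (‖x s‖ ^ 2 + ‖x (s - τ)‖ ^ 2) := by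
          have := two_mul_le_add_sq ‖x s‖ ‖x (s - τ)‖
          have hA := norm_nonneg S.A
          nlinarith
        have h5 : 0 ≤ S.c * ‖x (s - τ)‖ ^ 2 := by positivity
        have h6 := sq_nonneg (‖x s‖ - S.d)
        have h7 := sq_nonneg (‖x s‖ - G)
        have h8 := sq_nonneg ‖x (s - τ)‖
        rw [hC]
        nlinarith
      rw [intervalIntegral.integral_add (Continuous.intervalIntegrable (by fun_prop) _ _)
        intervalIntegrable_const, intervalIntegral.integral_const, e1] at e2
      have h1 : ‖x 0‖ ^ 2 ≤ Mφ ^ 2 := by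
        have := hx0 0 ⟨by linarith, le_rfl⟩
        gcongr
      have h2 : (t - 0) • (S.d ^ 2 + G ^ 2) ≤ S.T * (S.d ^ 2 + G ^ 2) := by
        rw [smul_eq_mul, sub_zero]
        have := ht.2
        gcongr
      linarith)
  have h1 := hG' t ⟨h0, ht.2⟩
  exact (Real.le_sqrt_of_sq_le h1).trans (le_add_of_nonneg_right hMφ0)

theorem exists_norm_le (S : DelaySystem n) : ∃ M, ∀ τ ∈ Icc 0 S.b, ∀ x,
    S.IsSolution τ x → ∀ t ∈ Icc (-S.b) S.T, ‖x t‖ ≤ M := by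
  obtain ⟨M, hM⟩ := S.exists_norm_le_withField
  exact ⟨M, hM S.f S.contDiff S.growth⟩

theorem exists_isSolution_of_lipschitz (S : DelaySystem n) {L : NNReal} (hL : LipschitzWith L S.f)
    (hτ : τ ∈ Icc 0 S.b) : ∃ x, S.IsSolution τ x := by
  have hT := S.T_pos
  set H : ℝ → Vec n := fun t => S.φ (min t 0) with hH
  have hHc : Continuous H := S.continuous_φ.comp (by fun_prop)
  have hfc := S.continuous_f
  have hgc := S.continuous_g
  obtain ⟨z, hzc, hz⟩ := exists_delay_integral_solution (δ := τ) (L := L) hT hτ.1 L.2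
    (fun s y => -S.f (H s + y))
    (by
      have : Continuous fun p : ℝ × Vec n => -S.f (H p.1 + p.2) := by fun_prop
      exact this)
    (fun s _ y z => by
      rw [neg_sub_neg, ← norm_neg, neg_sub, ← add_sub_add_left_eq_sub y z (H s)]
      simpa [dist_eq_norm] using hL.dist_le_mul (H s + y) (H s + z)) S.A
    (fun s => S.A (H (s - τ)) + S.g s)
    (Continuous.integrableOn_Ioc (by fun_prop))
  have hz' := fun t => (hz t).trans (integral_indicator_Ioc hT.le _ t)
  refine ⟨_, (isSolution_extension (x := fun t => H t + z t) hτ (by fun_prop) ?_ ?_).1⟩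
  · intro t ht
    have : z t = 0 := by rw [hz' t, clamp_of_le ht.2, intervalIntegral.integral_same]
    simp [this, hH, min_eq_left ht.2]
  · intro t ht
    have h1 : H t = S.φ 0 := by simp [hH, min_eq_right ht.1]
    rw [h1, hz' t, clamp_of_mem ht]
    congr 1
    refine intervalIntegral.integral_congr fun s _ => ?_
    simp only [field, map_add]
    abel

theorem exists_isSolution (S : DelaySystem n) (hτ : τ ∈ Icc 0 S.b) : ∃ x, S.IsSolution τ x := by
  obtain ⟨M, hM⟩ := S.exists_norm_le_withField
  -- a cut-off function that is `1` on the ball given by the a priori bound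
  let χ : ContDiffBump (0 : Vec n) := ⟨max M 1, max M 1 + 1, by positivity, by linarith⟩
  have hχ2 : ContDiff ℝ 2 fun y => χ y • S.f y := (χ.contDiff (n := 2)).smul S.contDiff
  have hχs : HasCompactSupport fun y => χ y • S.f y := χ.hasCompactSupport.smul_right
  have hχg : ∀ y, -(S.c * ‖y‖ ^ 2) - S.d * ‖y‖ ≤ ⟪χ y • S.f y, y⟫ := by
    intro y
    have h1 := S.growth y
    have h2 : 0 ≤ S.c * ‖y‖ ^ 2 + S.d * ‖y‖ := by
      have := S.c_nonneg
      have := S.d_nonneg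
      positivity
    rw [real_inner_smul_left]
    nlinarith [χ.nonneg (x := y), χ.le_one (x := y)]
  obtain ⟨L, hL⟩ := ContDiff.lipschitzWith_of_hasCompactSupport hχs hχ2 two_ne_zero
  obtain ⟨x, hx⟩ := exists_isSolution_of_lipschitz (S.withField _ hχ2 hχg) (L := L) hL hτ
  have hxM := hM _ hχ2 hχg τ hτ x hx
  have hone : ∀ t ∈ Icc (-S.b) S.T, χ (x t) • S.f (x t) = S.f (x t) := fun t ht => by
    rw [χ.one_of_mem_closedBall (by simpa [χ] using Or.inl (hxM t ht)), one_smul]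
  have hs : (S.withField _ hχ2 hχg).slope τ x = S.slope τ x := by
    have hb := S.b_pos
    ext1 t
    have hc := clamp_mem S.T_pos.le t
    have := hone _ ⟨by linarith [hc.1], hc.2⟩
    simp only [slope, field, withField, this]
  refine ⟨x, hx.continuous, fun t => ?_⟩
  rw [← hs]
  exact hx.eq t

end DelaySystem

namespace DelaySystem

/-! ### Uniform bounds and dependence of the state on the delay -/

variable {n : ℕ} {S : DelaySystem n} {τ σ : ℝ} {x y : ℝ → Vec n}

theorem exists_norm_slope_le (S : DelaySystem n) : ∃ M, 0 < M ∧ ∀ τ ∈ Icc 0 S.b, ∀ x,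
    S.IsSolution τ x → ∀ t, ‖S.slope τ x t‖ ≤ M := by
  have hb := S.b_pos
  obtain ⟨M, hM⟩ := S.exists_norm_le
  obtain ⟨F, hF⟩ := (isCompact_closedBall (0 : Vec n) M).exists_bound_of_continuousOn
    S.continuous_f.continuousOn
  refine ⟨max (max (‖S.φ₁ 0‖ + ∫ s, ‖S.φ₂ s‖) (F + ‖S.A‖ * M + (‖S.g 0‖ + ∫ s, ‖S.g₁ s‖))) 1,
    by positivity, fun τ hτ x hx t => le_max_of_le_left ?_⟩
  rw [slope]
  split_ifs with h
  · exact (norm_φ₁_le t).trans (le_max_left _ _)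
  · refine le_max_of_le_right ?_
    have hc := clamp_mem S.T_pos.le t
    have h1 := hM τ hτ x hx (clamp S.T t) ⟨by linarith [hc.1], hc.2⟩
    have h2 := hM τ hτ x hx (clamp S.T t - τ) ⟨by linarith [hc.1, hτ.2], by linarith [hc.2, hτ.1]⟩
    have h3 := hF (x (clamp S.T t)) (by simpa using h1)
    refine (norm_add₃_le).trans ?_
    rw [norm_neg]
    gcongr
    · exact (S.A.le_opNorm _).trans (by gcongr)
    · exact norm_g_le _

theorem IsSolution.norm_sub_le (hτ : τ ∈ Icc 0 S.b) (hx : S.IsSolution τ x) {M : ℝ}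
    (hM : ∀ t, ‖S.slope τ x t‖ ≤ M) (s t : ℝ) : ‖x t - x s‖ ≤ M * |t - s| := by
  rw [hx.apply_sub hτ]
  exact intervalIntegral.norm_integral_le_of_norm_le_const fun r _ => hM r

/-- Solutions and their slopes are Lipschitz continuous in the delay. For the slopes this also holds
at the jump: at `t = 0` both are equal to `φ̇(0)`. -/
theorem exists_norm_sub_le (S : DelaySystem n) : ∃ C, 0 < C ∧ ∀ σ ∈ Icc 0 S.b, ∀ τ ∈ Icc 0 S.b,
    ∀ x y, S.IsSolution σ x → S.IsSolution τ y →
      (∀ t ≤ S.T, ‖x t - y t‖ ≤ C * |σ - τ|) ∧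
        ∀ t, ‖S.slope σ x t - S.slope τ y t‖ ≤ C * |σ - τ| := by
  have hb := S.b_pos
  have hT := S.T_pos
  obtain ⟨M, hM⟩ := S.exists_norm_le
  obtain ⟨M₁, hM₁0, hM₁⟩ := S.exists_norm_slope_le
  obtain ⟨L, hL0, -, hL⟩ := exists_lipschitz_ball (S.contDiff.of_le one_le_two) M
  set C := L + ‖S.A‖ with hC
  have hC0 : 0 < C := by positivity
  set κ := 2 * (1 + C * S.T) * Real.exp (4 * C * S.T) with hκ
  have hκ0 : 0 < κ := by positivity
  set D := κ * (S.T * (‖S.A‖ * M₁)) with hD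
  have hD0 : 0 ≤ D := by positivity
  refine ⟨2 * C * D + ‖S.A‖ * M₁ + D + 1, by positivity, ?_⟩
  intro σ hσ τ hτ x y hx hy
  have hxc := hx.continuous
  have hyc := hy.continuous
  have hfield : ∀ s ∈ Icc 0 S.T, ‖S.field σ x s - S.field τ y s‖
      ≤ C * (‖x s - y s‖ + ‖x (s - σ) - y (s - σ)‖) + ‖S.A‖ * (M₁ * |σ - τ|) := by
    intro s hs
    have e : S.field σ x s - S.field τ y s = -(S.f (x s) - S.f (y s))
        + S.A (x (s - σ) - y (s - σ)) + S.A (y (s - σ) - y (s - τ)) := by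
      simp only [field, map_sub]; abel
    have h1 : ‖S.f (x s) - S.f (y s)‖ ≤ L * ‖x s - y s‖ :=
      hL _ _ (hM σ hσ x hx s ⟨by linarith [hs.1], hs.2⟩) (hM τ hτ y hy s ⟨by linarith [hs.1], hs.2⟩)
    have h2 := S.A.le_opNorm (x (s - σ) - y (s - σ))
    have h3 : ‖S.A (y (s - σ) - y (s - τ))‖ ≤ ‖S.A‖ * (M₁ * |σ - τ|) := by
      refine (S.A.le_opNorm _).trans ?_
      gcongr
      refine (hy.norm_sub_le hτ (hM₁ τ hτ y hy) _ _).trans_eq ?_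
      rw [sub_sub_sub_cancel_left, abs_sub_comm]
    rw [e]
    refine norm_add₃_le.trans ?_
    rw [norm_neg]
    have h4 : 0 ≤ L * ‖x (s - σ) - y (s - σ)‖ := by positivity
    have h5 : 0 ≤ ‖S.A‖ * ‖x s - y s‖ := by positivity
    rw [hC]
    nlinarith
  have hdiff : ∀ t ≤ S.T, ‖x t - y t‖ ≤ D * |σ - τ| := by
    intro t ht
    rcases le_total t 0 with h0 | h0
    · rw [hx.apply_of_nonpos h0, hy.apply_of_nonpos h0, sub_self, norm_zero]
      positivity
    have hG := delay_gronwall (u := fun t => ‖x t - y t‖) (δ := σ)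
      (a := S.T * (‖S.A‖ * (M₁ * |σ - τ|))) hC0 hT hσ.1 (by positivity) (by fun_prop)
      (fun t => norm_nonneg _)
      (fun t ht => by
        rw [hx.apply_of_nonpos ht.2, hy.apply_of_nonpos ht.2, sub_self, norm_zero]
        positivity)
      (fun t ht => by
        have hxI := intervalIntegrable_slope (S := S) hσ hxc.continuousOn 0 t
        have hyI := intervalIntegrable_slope (S := S) hτ hyc.continuousOn 0 t
        have e : x t - y t = ∫ s in (0 : ℝ)..t, (S.slope σ x s - S.slope τ y s) := by
          rw [intervalIntegral.integral_sub hxI hyI, hx.eq t, hy.eq t, add_sub_add_left_eq_sub]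
        have h1 : ‖x t - y t‖ ≤ ∫ s in (0 : ℝ)..t, (C * (‖x s - y s‖ + ‖x (s - σ) - y (s - σ)‖)
            + ‖S.A‖ * (M₁ * |σ - τ|)) := by
          rw [e]
          refine intervalIntegral.norm_integral_le_of_norm_le ht.1 (.of_forall fun s hs => ?_)
            (Continuous.intervalIntegrable (by fun_prop) _ _)
          have hs' : s ∈ Ioc 0 S.T := ⟨hs.1, hs.2.trans ht.2⟩
          rw [slope_of_mem hs', slope_of_mem hs']
          exact hfield s ⟨hs'.1.le, hs'.2⟩
        rw [intervalIntegral.integral_add (Continuous.intervalIntegrable (by fun_prop) _ _)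
          intervalIntegrable_const, intervalIntegral.integral_const, smul_eq_mul, sub_zero] at h1
        have h2 : t * (‖S.A‖ * (M₁ * |σ - τ|)) ≤ S.T * (‖S.A‖ * (M₁ * |σ - τ|)) := by
          have := ht.2
          gcongr
        linarith)
    refine (hG t ⟨h0, ht⟩).trans_eq ?_
    rw [hD, hκ]; ring
  have habs := abs_nonneg (σ - τ)
  have hAM : 0 ≤ ‖S.A‖ * M₁ := by positivity
  refine ⟨fun t ht => (hdiff t ht).trans ?_, fun t => ?_⟩
  · gcongr
    have : 0 ≤ 2 * C * D := by positivity
    linarith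
  · rw [slope, slope]
    split_ifs with h
    · rw [sub_self, norm_zero]; positivity
    · have hc := clamp_mem hT.le t
      refine (hfield _ hc).trans ?_
      have h1 := hdiff (clamp S.T t) hc.2
      have h2 := hdiff (clamp S.T t - σ) (by linarith [hc.2, hσ.1])
      have h3 : C * (‖x (clamp S.T t) - y (clamp S.T t)‖
          + ‖x (clamp S.T t - σ) - y (clamp S.T t - σ)‖)
          ≤ C * (D * |σ - τ| + D * |σ - τ|) := by gcongr
      have h4 : 0 ≤ D * |σ - τ| := by positivity
      nlinarith

theorem IsSolution.unique (hτ : τ ∈ Icc 0 S.b) (hx : S.IsSolution τ x) (hy : S.IsSolution τ y) :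
    x = y := by
  obtain ⟨C, -, hC⟩ := S.exists_norm_sub_le
  have h := (hC τ hτ τ hτ x y hx hy).2
  have hs : S.slope τ x = S.slope τ y := by
    ext1 t
    simpa [sub_eq_zero] using h t
  ext1 t
  rw [hx.eq t, hy.eq t, hs]

variable (S) in
open Classical in
/-- The solution of the delay equation for the delay `τ ∈ [0, b]`. -/
noncomputable def state (τ : ℝ) : ℝ → Vec n :=
  if h : τ ∈ Icc 0 S.b then Classical.choose (S.exists_isSolution h) else 0

variable (S) in
/-- The time derivative of the state. -/
noncomputable def vel (τ : ℝ) : ℝ → Vec n := S.slope τ (S.state τ)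

theorem isSolution_state (hτ : τ ∈ Icc 0 S.b) : S.IsSolution τ (S.state τ) := by
  rw [state, dif_pos hτ]
  exact Classical.choose_spec (S.exists_isSolution hτ)

theorem continuous_state (hτ : τ ∈ Icc 0 S.b) : Continuous (S.state τ) :=
  (isSolution_state hτ).continuous

theorem state_of_nonpos (hτ : τ ∈ Icc 0 S.b) {t : ℝ} (ht : t ≤ 0) : S.state τ t = S.φ t :=
  (isSolution_state hτ).apply_of_nonpos ht

theorem measurable_vel (hτ : τ ∈ Icc 0 S.b) : Measurable (S.vel τ) :=
  measurable_slope hτ (continuous_state hτ).continuousOn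

theorem intervalIntegrable_vel (hτ : τ ∈ Icc 0 S.b) (p q : ℝ) :
    IntervalIntegrable (S.vel τ) volume p q :=
  intervalIntegrable_slope hτ (continuous_state hτ).continuousOn p q

theorem state_eq (hτ : τ ∈ Icc 0 S.b) (t : ℝ) :
    S.state τ t = S.φ 0 + ∫ s in (0 : ℝ)..t, S.vel τ s :=
  (isSolution_state hτ).eq t

theorem hasDerivAt_state (hτ : τ ∈ Icc 0 S.b) {t : ℝ} (ht : t ≠ 0) :
    HasDerivAt (S.state τ) (S.vel τ t) t :=
  (isSolution_state hτ).hasDerivAt hτ ht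

theorem continuousAt_vel (hτ : τ ∈ Icc 0 S.b) {t : ℝ} (ht : t ≠ 0) :
    ContinuousAt (S.vel τ) t :=
  (isSolution_state hτ).continuousAt_slope hτ ht

theorem vel_of_nonpos {t : ℝ} (ht : t ≤ 0) : S.vel τ t = S.φ₁ t := slope_of_nonpos ht

theorem vel_of_mem {t : ℝ} (ht : t ∈ Ioc 0 S.T) :
    S.vel τ t = -S.f (S.state τ t) + S.A (S.state τ (t - τ)) + S.g t := slope_of_mem ht

/-- All the constants in one place: bounds for the state, for its velocity and for their Lipschitz
constants with respect to the delay, and for `f` on the ball of radius `M`. -/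
theorem exists_bounds (S : DelaySystem n) : ∃ M L, 0 < M ∧ 0 < L ∧
    (∀ τ ∈ Icc 0 S.b, (∀ t ∈ Icc (-S.b) S.T, ‖S.state τ t‖ ≤ M) ∧ (∀ t, ‖S.vel τ t‖ ≤ M) ∧
      (∀ s t, ‖S.state τ t - S.state τ s‖ ≤ M * |t - s|)) ∧
    (∀ σ ∈ Icc 0 S.b, ∀ τ ∈ Icc 0 S.b,
      (∀ t ≤ S.T, ‖S.state σ t - S.state τ t‖ ≤ M * |σ - τ|) ∧
        ∀ t, ‖S.vel σ t - S.vel τ t‖ ≤ M * |σ - τ|) ∧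
    (∀ y, ‖y‖ ≤ M → ‖fderiv ℝ S.f y‖ ≤ L) ∧
    ∀ y z, ‖y‖ ≤ M → ‖z‖ ≤ M → ‖S.f y - S.f z‖ ≤ L * ‖y - z‖ := by
  obtain ⟨M₀, h₀⟩ := S.exists_norm_le
  obtain ⟨M₁, hM₁, h₁⟩ := S.exists_norm_slope_le
  obtain ⟨M₂, hM₂, h₂⟩ := S.exists_norm_sub_le
  set M := max M₀ (max M₁ M₂) with hM
  have hM0 : M₀ ≤ M := le_max_left _ _
  have hM1 : M₁ ≤ M := (le_max_left _ _).trans (le_max_right _ _)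
  have hM2 : M₂ ≤ M := (le_max_right _ _).trans (le_max_right _ _)
  obtain ⟨L, hL0, hL1, hL2⟩ := exists_lipschitz_ball (S.contDiff.of_le one_le_two) M
  refine ⟨M, L, hM₁.trans_le hM1, hL0, fun τ hτ => ⟨fun t ht => ?_, fun t => ?_, fun s t => ?_⟩,
    fun σ hσ τ hτ => ⟨fun t ht => ?_, fun t => ?_⟩, hL1, hL2⟩
  · exact (h₀ τ hτ _ (isSolution_state hτ) t ht).trans hM0
  · exact (h₁ τ hτ _ (isSolution_state hτ) t).trans hM1
  · exact (isSolution_state hτ).norm_sub_le hτ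
      (fun t => (h₁ τ hτ _ (isSolution_state hτ) t).trans hM1) s t
  · exact ((h₂ σ hσ τ hτ _ _ (isSolution_state hσ) (isSolution_state hτ)).1 t ht).trans (by gcongr)
  · exact ((h₂ σ hσ τ hτ _ _ (isSolution_state hσ) (isSolution_state hτ)).2 t).trans (by gcongr)

section Limits

variable {ι : Type*} {l : Filter ι} {s r : ι → ℝ}

theorem tendsto_abs_sub (hs : Tendsto s l (𝓝 τ)) (M : ℝ) :
    Tendsto (fun i => M * |s i - τ|) l (𝓝 0) := by
  have h := ((hs.sub_const τ).abs).const_mul M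
  simpa using h

theorem tendsto_state (hτ : τ ∈ Icc 0 S.b) (hs : Tendsto s l (𝓝 τ))
    (hsI : ∀ᶠ i in l, s i ∈ Icc 0 S.b) {t : ℝ} (hr : Tendsto r l (𝓝 t))
    (hrT : ∀ᶠ i in l, r i ≤ S.T) :
    Tendsto (fun i => S.state (s i) (r i)) l (𝓝 (S.state τ t)) := by
  obtain ⟨M, -, -, -, -, hM, -⟩ := S.exists_bounds
  have h1 : Tendsto (fun i => S.state (s i) (r i) - S.state τ (r i)) l (𝓝 0) := by
    refine squeeze_zero_norm' ?_ (tendsto_abs_sub hs M)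
    filter_upwards [hsI, hrT] with i hi hT
    exact (hM _ hi _ hτ).1 _ hT
  simpa using h1.add (((continuous_state hτ).tendsto t).comp hr)

theorem tendsto_vel (hτ : τ ∈ Icc 0 S.b) (hs : Tendsto s l (𝓝 τ))
    (hsI : ∀ᶠ i in l, s i ∈ Icc 0 S.b) {t : ℝ} (ht : t ≠ 0) (hr : Tendsto r l (𝓝 t)) :
    Tendsto (fun i => S.vel (s i) (r i)) l (𝓝 (S.vel τ t)) := by
  obtain ⟨M, -, -, -, -, hM, -⟩ := S.exists_bounds
  have h1 : Tendsto (fun i => S.vel (s i) (r i) - S.vel τ (r i)) l (𝓝 0) := by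
    refine squeeze_zero_norm' ?_ (tendsto_abs_sub hs M)
    filter_upwards [hsI] with i hi
    exact (hM _ hi _ hτ).2 _
  simpa using h1.add ((continuousAt_vel hτ ht).tendsto.comp hr)

end Limits

end DelaySystem

/-! ### Linear delay equations with zero history -/

/-- The solution of `ż(s) = N(s) z(s) + B z(s - δ) + h(s)` on `[0, T]` with `z = 0` for negative
times, in integrated form; beyond `T` it is continued by a constant. -/
structure IsLinearSolution {n : ℕ} (T δ : ℝ) (N : ℝ → Vec n →L[ℝ] Vec n) (B : Vec n →L[ℝ] Vec n)
    (h z : ℝ → Vec n) : Prop where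
  continuous : Continuous z
  eq : ∀ t, z t = ∫ s in (0 : ℝ)..t,
    (Ioc 0 T).indicator (fun s => N s (z s) + B (z (s - δ)) + h s) s

namespace IsLinearSolution

variable {n : ℕ} {T δ : ℝ} {N : ℝ → Vec n →L[ℝ] Vec n} {B : Vec n →L[ℝ] Vec n} {h z : ℝ → Vec n}

theorem exists_solution (hT : 0 < T) (hδ : 0 ≤ δ) (hN : Continuous N)
    (hh : IntegrableOn h (Ioc 0 T)) : ∃ z, IsLinearSolution T δ N B h z := by
  obtain ⟨L, hL⟩ := isCompact_Icc.exists_bound_of_continuousOn (hN.continuousOn (s := Icc 0 T))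
  obtain ⟨z, hz, hz'⟩ := exists_delay_integral_solution hT hδ
    ((norm_nonneg _).trans (hL 0 ⟨le_rfl, hT.le⟩)) (fun s y => N s y)
    (by
      have : Continuous fun p : ℝ × Vec n => N p.1 p.2 := by fun_prop
      exact this)
    (fun s hs y z => by
      rw [← map_sub]
      exact ((N s).le_opNorm _).trans (by gcongr; exact hL s hs)) B h hh
  exact ⟨z, hz, hz'⟩

theorem eq_clamp (hT : 0 ≤ T) (hz : IsLinearSolution T δ N B h z) (t : ℝ) :
    z t = ∫ s in (0 : ℝ)..clamp T t, (N s (z s) + B (z (s - δ)) + h s) :=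
  (hz.eq t).trans (integral_indicator_Ioc hT _ t)

theorem apply_clamp (hT : 0 ≤ T) (hz : IsLinearSolution T δ N B h z) (t : ℝ) :
    z (clamp T t) = z t := by
  rw [hz.eq_clamp hT t, hz.eq_clamp hT (clamp T t), clamp_of_mem (clamp_mem hT t)]

theorem apply_of_nonpos (hT : 0 ≤ T) (hz : IsLinearSolution T δ N B h z) {t : ℝ} (ht : t ≤ 0) :
    z t = 0 := by
  rw [hz.eq_clamp hT, clamp_of_le ht, intervalIntegral.integral_same]

theorem exists_norm_le (hT : 0 ≤ T) (hz : IsLinearSolution T δ N B h z) :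
    ∃ Z, 0 ≤ Z ∧ ∀ t, ‖z t‖ ≤ Z := by
  obtain ⟨Z, hZ⟩ := isCompact_Icc.exists_bound_of_continuousOn
    (hz.continuous.continuousOn (s := Icc 0 T))
  have := fun t => hz.apply_clamp hT t ▸ hZ _ (clamp_mem hT t)
  exact ⟨Z, (norm_nonneg _).trans (this 0), this⟩

theorem intervalIntegrable (hz : Continuous z) (hN : Continuous N)
    (hh : IntegrableOn h (Ioc 0 T)) {t : ℝ} (ht : t ∈ Icc 0 T) :
    IntervalIntegrable (fun s => N s (z s) + B (z (s - δ)) + h s) volume 0 t := by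
  have h1 : Continuous fun s => N s (z s) + B (z (s - δ)) := by fun_prop
  refine (h1.intervalIntegrable _ _).add ?_
  rw [intervalIntegrable_iff_integrableOn_Ioc_of_le ht.1]
  exact hh.mono_set (Ioc_subset_Ioc_right ht.2)

theorem norm_le (hT : 0 < T) (hδ : 0 ≤ δ) (hz : IsLinearSolution T δ N B h z) {L H : ℝ}
    (hL : 0 < L) (hH : 0 ≤ H) (hNL : ∀ s ∈ Ioc 0 T, ‖N s‖ ≤ L) (hhH : ∀ s ∈ Ioc 0 T, ‖h s‖ ≤ H)
    (t : ℝ) : ‖z t‖ ≤ 2 * (1 + (L + ‖B‖) * T) * Real.exp (4 * (L + ‖B‖) * T) * (T * H) := by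
  have hzc := hz.continuous
  rw [← hz.apply_clamp hT.le]
  refine delay_gronwall (u := fun t => ‖z t‖) (δ := δ) (by positivity) hT hδ (by positivity)
    (by fun_prop) (fun _ => norm_nonneg _) (fun t ht => ?_) (fun t ht => ?_) _ (clamp_mem hT.le t)
  · rw [hz.apply_of_nonpos hT.le ht.2, norm_zero]; positivity
  · have h1 : ‖z t‖ ≤ ∫ s in (0 : ℝ)..t, ((L + ‖B‖) * (‖z s‖ + ‖z (s - δ)‖) + H) := by
      conv_lhs => rw [hz.eq_clamp hT.le t, clamp_of_mem ht]
      refine intervalIntegral.norm_integral_le_of_norm_le ht.1 (.of_forall fun s hs => ?_)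
        (Continuous.intervalIntegrable (by fun_prop) _ _)
      have hs' : s ∈ Ioc 0 T := ⟨hs.1, hs.2.trans ht.2⟩
      have h2 : ‖N s (z s)‖ ≤ L * ‖z s‖ := ((N s).le_opNorm _).trans (by gcongr; exact hNL s hs')
      have h3 := B.le_opNorm (z (s - δ))
      have h4 := hhH s hs'
      have h5 : 0 ≤ L * ‖z (s - δ)‖ := by positivity
      have h6 : 0 ≤ ‖B‖ * ‖z s‖ := by positivity
      refine norm_add₃_le.trans ?_
      nlinarith
    rw [intervalIntegral.integral_add (Continuous.intervalIntegrable (by fun_prop) _ _)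
      intervalIntegrable_const, intervalIntegral.integral_const, smul_eq_mul, sub_zero] at h1
    have h2 : t * H ≤ T * H := by
      have := ht.2
      gcongr
    linarith

/-- Continuous dependence on the data: the coefficients need only converge boundedly and almost
everywhere, while the solutions converge uniformly. -/
theorem eventually_norm_sub_le {ι : Type*} {l : Filter ι} [l.IsCountablyGenerated] (hT : 0 < T)
    {δ' : ι → ℝ} {N' : ι → ℝ → Vec n →L[ℝ] Vec n} {h' z' : ι → ℝ → Vec n} {L H : ℝ} (hL : 0 < L)
    (hz : IsLinearSolution T δ N B h z) (hN : Continuous N) (hNL : ∀ s ∈ Ioc 0 T, ‖N s‖ ≤ L)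
    (hh : IntegrableOn h (Ioc 0 T)) (hδ0 : ∀ᶠ i in l, 0 ≤ δ' i) (hδ : Tendsto δ' l (𝓝 δ))
    (hz' : ∀ᶠ i in l, IsLinearSolution T (δ' i) (N' i) B (h' i) (z' i))
    (hN' : ∀ᶠ i in l, Continuous (N' i)) (hNL' : ∀ᶠ i in l, ∀ s ∈ Ioc 0 T, ‖N' i s‖ ≤ L)
    (hNt : ∀ s ∈ Ioc 0 T, Tendsto (fun i => N' i s) l (𝓝 (N s)))
    (hh' : ∀ᶠ i in l, IntegrableOn (h' i) (Ioc 0 T))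
    (hhH : ∀ᶠ i in l, ∀ s ∈ Ioc 0 T, ‖h' i s - h s‖ ≤ H)
    (hht : ∀ᵐ s, s ∈ Ioc 0 T → Tendsto (fun i => h' i s - h s) l (𝓝 0)) :
    ∀ ε > 0, ∀ᶠ i in l, ∀ t, ‖z' i t - z t‖ ≤ ε := by
  obtain ⟨Z, hZ0, hZ⟩ := hz.exists_norm_le hT.le
  have hzc := hz.continuous
  have main := eventually_norm_le_of_delay_gronwall (l := l) (C := L + ‖B‖) (T := T)
    (M := (L + L) * Z + ‖B‖ * (Z + Z) + H) (by positivity) hT (δ := δ')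
    (u := fun i t => z' i t - z t)
    (e := fun i s => (N' i s (z' i s) + B (z' i (s - δ' i)) + h' i s)
      - (N s (z s) + B (z (s - δ)) + h s))
    (r := fun i s => ‖N' i s - N s‖ * ‖z s‖ + ‖B‖ * ‖z (s - δ' i) - z (s - δ)‖ + ‖h' i s - h s‖)
    hδ0 (hz'.mono fun i hi => hi.continuous.sub hzc)
    (hz'.mono fun i hi t ht => by
      rw [hi.apply_of_nonpos hT.le ht, hz.apply_of_nonpos hT.le ht, sub_self]) ?_ ?_ ?_ ?_ ?_
  · intro ε hε
    filter_upwards [main ε hε, hz'] with i hi hzi t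
    rw [← hzi.apply_clamp hT.le t, ← hz.apply_clamp hT.le t]
    exact hi _ (clamp_mem hT.le t).2
  · filter_upwards [hz', hN', hh'] with i hzi hNi hhi t ht
    rw [intervalIntegral.integral_sub
      (intervalIntegrable hzi.continuous hNi hhi ht) (intervalIntegrable hzc hN hh ht),
      hzi.eq_clamp hT.le t, hz.eq_clamp hT.le t, clamp_of_mem ht]
  · filter_upwards [hNL'] with i hNi s hs
    have e : (N' i s (z' i s) + B (z' i (s - δ' i)) + h' i s) - (N s (z s) + B (z (s - δ)) + h s)
        = (N' i s (z' i s - z s) + B (z' i (s - δ' i) - z (s - δ' i)))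
          + ((N' i s - N s) (z s) + B (z (s - δ' i) - z (s - δ)) + (h' i s - h s)) := by
      simp only [map_sub, _root_.sub_apply]; abel
    rw [e]
    have h1 : ‖N' i s (z' i s - z s)‖ ≤ L * ‖z' i s - z s‖ :=
      ((N' i s).le_opNorm _).trans (by gcongr; exact hNi s hs)
    have h2 := B.le_opNorm (z' i (s - δ' i) - z (s - δ' i))
    have h3 := (N' i s - N s).le_opNorm (z s)
    have h4 := B.le_opNorm (z (s - δ' i) - z (s - δ))
    have h5 := norm_add_le (N' i s (z' i s - z s)) (B (z' i (s - δ' i) - z (s - δ' i)))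
    have h6 := norm_add₃_le (a := (N' i s - N s) (z s)) (b := B (z (s - δ' i) - z (s - δ)))
      (c := h' i s - h s)
    have h7 : 0 ≤ L * ‖z' i (s - δ' i) - z (s - δ' i)‖ := by positivity
    have h8 : 0 ≤ ‖B‖ * ‖z' i s - z s‖ := by positivity
    refine (norm_add_le _ _).trans ?_
    nlinarith
  · filter_upwards [hN', hh'] with i hNi hhi
    have h1 : Continuous fun s =>
        ‖N' i s - N s‖ * ‖z s‖ + ‖B‖ * ‖z (s - δ' i) - z (s - δ)‖ := by fun_prop
    exact h1.aestronglyMeasurable.add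
      (hhi.aestronglyMeasurable.sub hh.aestronglyMeasurable).norm
  · filter_upwards [hNL', hhH] with i hNi hhi s hs
    rw [Real.norm_of_nonneg (by positivity)]
    gcongr
    · exact (norm_sub_le _ _).trans (add_le_add (hNi s hs) (hNL s hs))
    · exact hZ s
    · exact (norm_sub_le _ _).trans (add_le_add (hZ _) (hZ _))
    · exact hhi s hs
  · filter_upwards [hht] with s hhs hs
    have h1 : Tendsto (fun i => ‖N' i s - N s‖) l (𝓝 0) := by
      simpa using ((hNt s hs).sub_const (N s)).norm
    have h2 : Tendsto (fun i => ‖z (s - δ' i) - z (s - δ)‖) l (𝓝 0) := by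
      have h3 : Tendsto (fun i => z (s - δ' i)) l (𝓝 (z (s - δ))) :=
        (hzc.tendsto _).comp (tendsto_const_nhds.sub hδ)
      simpa using (h3.sub_const (z (s - δ))).norm
    simpa using ((h1.mul_const ‖z s‖).add (h2.const_mul ‖B‖)).add (hhs hs).norm

theorem unique (hT : 0 < T) (hδ : 0 ≤ δ) (hN : Continuous N) (hh : IntegrableOn h (Ioc 0 T))
    {z' : ℝ → Vec n} (hz : IsLinearSolution T δ N B h z) (hz' : IsLinearSolution T δ N B h z') :
    z' = z := by
  obtain ⟨L, hL⟩ := isCompact_Icc.exists_bound_of_continuousOn (hN.continuousOn (s := Icc 0 T))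
  have hL' : ∀ s ∈ Ioc 0 T, ‖N s‖ ≤ max L 1 := fun s hs =>
    (hL s ⟨hs.1.le, hs.2⟩).trans (le_max_left _ _)
  have h1 := hz.eventually_norm_sub_le (ι := Unit) (l := ⊤) (L := max L 1) (H := 0)
    (δ' := fun _ => δ) (N' := fun _ => N) (h' := fun _ => h) (z' := fun _ => z') hT (by positivity)
    hN hL' hh (by simpa) tendsto_const_nhds (by simpa) (by simpa) (.of_forall fun _ => hL')
    (fun _ _ => tendsto_const_nhds) (by simpa) (by simp) (by simp)
  ext1 t
  rw [← sub_eq_zero, ← norm_le_zero_iff]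
  refine le_of_forall_pos_le_add fun ε hε => ?_
  obtain ⟨-, h2⟩ := (h1 ε hε).exists
  simpa using h2 t

end IsLinearSolution

namespace DelaySystem

/-! ### The derivative of the state with respect to the delay -/

variable {n : ℕ} {S : DelaySystem n} {τ σ : ℝ}

theorem continuous_fderiv (S : DelaySystem n) : Continuous (fderiv ℝ S.f) :=
  S.contDiff.continuous_fderiv two_ne_zero

variable (S) in
/-- The operator `-Df(x(t))` of the linearized equation. -/
noncomputable def linOp (τ s : ℝ) : Vec n →L[ℝ] Vec n := -fderiv ℝ S.f (S.state τ s)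

theorem continuous_linOp (hτ : τ ∈ Icc 0 S.b) : Continuous (S.linOp τ) :=
  (S.continuous_fderiv.comp (continuous_state hτ)).neg

theorem integrableOn_vel_sub (hτ : τ ∈ Icc 0 S.b) (σ : ℝ) :
    IntegrableOn (fun s => -S.A (S.vel τ (s - σ))) (Ioc 0 S.T) := by
  obtain ⟨M, L, -, -, hM, -⟩ := S.exists_bounds
  refine Integrable.of_bound (S.A.continuous.measurable.comp ((measurable_vel hτ).comp
    (measurable_id.sub_const σ))).neg.aestronglyMeasurable (‖S.A‖ * M) (.of_forall fun s => ?_)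
  rw [norm_neg]
  exact (S.A.le_opNorm _).trans (by gcongr; exact (hM τ hτ).2.1 _)

variable (S) in
open Classical in
/-- The derivative `x'[τ]` of the state with respect to the delay: the solution of the linearized
equation with right-hand side `-A ẋ(t - τ)`. -/
noncomputable def sens (τ : ℝ) : ℝ → Vec n :=
  if h : τ ∈ Icc 0 S.b then Classical.choose (IsLinearSolution.exists_solution (B := S.A) S.T_pos
    h.1 (continuous_linOp h) (integrableOn_vel_sub h τ)) else 0

variable (S) in
/-- The time derivative of `x'[τ]` on `(0, T]`, extended by zero. -/
noncomputable def sensVel (τ : ℝ) : ℝ → Vec n :=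
  (Ioc 0 S.T).indicator fun s =>
    S.linOp τ s (S.sens τ s) + S.A (S.sens τ (s - τ)) + -S.A (S.vel τ (s - τ))

theorem isLinearSolution_sens (hτ : τ ∈ Icc 0 S.b) : IsLinearSolution S.T τ (S.linOp τ) S.A
    (fun s => -S.A (S.vel τ (s - τ))) (S.sens τ) := by
  rw [sens, dif_pos hτ]
  exact Classical.choose_spec (IsLinearSolution.exists_solution (B := S.A) S.T_pos
    hτ.1 (continuous_linOp hτ) (integrableOn_vel_sub hτ τ))

theorem continuous_sens (hτ : τ ∈ Icc 0 S.b) : Continuous (S.sens τ) :=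
  (isLinearSolution_sens hτ).continuous

theorem sens_eq (hτ : τ ∈ Icc 0 S.b) (t : ℝ) :
    S.sens τ t = ∫ s in (0 : ℝ)..t, S.sensVel τ s :=
  (isLinearSolution_sens hτ).eq t

theorem sens_of_nonpos (hτ : τ ∈ Icc 0 S.b) {t : ℝ} (ht : t ≤ 0) : S.sens τ t = 0 :=
  (isLinearSolution_sens hτ).apply_of_nonpos S.T_pos.le ht

theorem sensVel_of_mem {t : ℝ} (ht : t ∈ Ioc 0 S.T) : S.sensVel τ t =
    S.linOp τ t (S.sens τ t) + S.A (S.sens τ (t - τ)) + -S.A (S.vel τ (t - τ)) :=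
  indicator_of_mem ht _

theorem sensVel_of_notMem {t : ℝ} (ht : t ∉ Ioc 0 S.T) : S.sensVel τ t = 0 :=
  indicator_of_notMem ht _

theorem measurable_sensVel (hτ : τ ∈ Icc 0 S.b) : Measurable (S.sensVel τ) := by
  have h1 := continuous_linOp hτ
  have h2 := continuous_sens hτ
  have h3 : Continuous fun s => S.linOp τ s (S.sens τ s) + S.A (S.sens τ (s - τ)) := by fun_prop
  exact (h3.measurable.add (S.A.continuous.measurable.comp ((measurable_vel hτ).comp
    (measurable_id.sub_const τ))).neg).indicator measurableSet_Ioc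

theorem exists_sens_bounds (S : DelaySystem n) : ∃ W, 0 < W ∧ ∀ τ ∈ Icc 0 S.b, ∀ t,
    ‖S.sens τ t‖ ≤ W ∧ ‖S.sensVel τ t‖ ≤ (Ioc 0 S.T).indicator (fun _ => W) t := by
  obtain ⟨M, L, hM0, hL0, hM, -, hL, -⟩ := S.exists_bounds
  have hb := S.b_pos
  have hT := S.T_pos
  have hN : ∀ τ ∈ Icc 0 S.b, ∀ s ∈ Ioc 0 S.T, ‖S.linOp τ s‖ ≤ L := fun τ hτ s hs => by
    rw [linOp, norm_neg]
    exact hL _ ((hM τ hτ).1 s ⟨by linarith [hs.1], hs.2⟩)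
  have hh : ∀ τ ∈ Icc 0 S.b, ∀ s, ‖-S.A (S.vel τ (s - τ))‖ ≤ ‖S.A‖ * M := fun τ hτ s => by
    rw [norm_neg]
    exact (S.A.le_opNorm _).trans (by gcongr; exact (hM τ hτ).2.1 _)
  set W := 2 * (1 + (L + ‖S.A‖) * S.T) * Real.exp (4 * (L + ‖S.A‖) * S.T) * (S.T * (‖S.A‖ * M))
    with hW
  have hW0 : 0 ≤ W := by positivity
  have h1 : ∀ τ ∈ Icc 0 S.b, ∀ t, ‖S.sens τ t‖ ≤ W := fun τ hτ t =>
    (isLinearSolution_sens hτ).norm_le hT hτ.1 hL0 (by positivity) (hN τ hτ) (fun s _ => hh τ hτ s) t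
  refine ⟨W + (L * W + ‖S.A‖ * W + ‖S.A‖ * M) + 1, by positivity, fun τ hτ t => ⟨?_, ?_⟩⟩
  · refine (h1 τ hτ t).trans ?_
    have : 0 ≤ L * W + ‖S.A‖ * W + ‖S.A‖ * M := by positivity
    linarith
  · by_cases ht : t ∈ Ioc 0 S.T
    · rw [sensVel_of_mem ht, indicator_of_mem ht]
      have h2 : ‖S.linOp τ t (S.sens τ t)‖ ≤ L * W :=
        ((S.linOp τ t).le_opNorm _).trans (by gcongr; exacts [hN τ hτ t ht, h1 τ hτ t])
      have h3 : ‖S.A (S.sens τ (t - τ))‖ ≤ ‖S.A‖ * W :=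
        (S.A.le_opNorm _).trans (by gcongr; exact h1 τ hτ _)
      have h4 := hh τ hτ t
      refine norm_add₃_le.trans ?_
      linarith
    · rw [sensVel_of_notMem ht, indicator_of_notMem ht, norm_zero]

theorem integrable_sensVel (hτ : τ ∈ Icc 0 S.b) : Integrable (S.sensVel τ) := by
  obtain ⟨W, -, hW⟩ := S.exists_sens_bounds
  have h : Integrable ((Ioc 0 S.T).indicator fun _ => W) :=
    (integrable_indicator_iff measurableSet_Ioc).2 (integrableOn_const (by simp))
  exact h.mono' (measurable_sensVel hτ).aestronglyMeasurable (.of_forall fun t => (hW τ hτ t).2)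

section Limits

variable {ι : Type*} {l : Filter ι} {s : ι → ℝ}

theorem eventually_norm_sens_sub_le [l.IsCountablyGenerated] (hτ : τ ∈ Icc 0 S.b)
    (hs : Tendsto s l (𝓝 τ)) (hsI : ∀ᶠ i in l, s i ∈ Icc 0 S.b) :
    ∀ ε > 0, ∀ᶠ i in l, ∀ t, ‖S.sens (s i) t - S.sens τ t‖ ≤ ε := by
  obtain ⟨M, L, hM0, hL0, hM, -, hL, -⟩ := S.exists_bounds
  have hb := S.b_pos
  have hN : ∀ τ ∈ Icc 0 S.b, ∀ s ∈ Ioc 0 S.T, ‖S.linOp τ s‖ ≤ L := fun τ hτ s hs => by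
    rw [linOp, norm_neg]
    exact hL _ ((hM τ hτ).1 s ⟨by linarith [hs.1], hs.2⟩)
  refine (isLinearSolution_sens hτ).eventually_norm_sub_le (H := ‖S.A‖ * (M + M)) S.T_pos hL0
    (continuous_linOp hτ) (hN τ hτ) (integrableOn_vel_sub hτ τ) (hsI.mono fun i hi => hi.1) hs
    (hsI.mono fun i hi => isLinearSolution_sens hi) (hsI.mono fun i hi => continuous_linOp hi)
    (hsI.mono fun i hi => hN _ hi) (fun r hr => ?_)
    (hsI.mono fun i hi => integrableOn_vel_sub hi _) (hsI.mono fun i hi r _ => ?_) ?_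
  · exact ((S.continuous_fderiv.tendsto _).comp (tendsto_state hτ hs hsI
      (tendsto_const_nhds (x := r)) (.of_forall fun _ => hr.2))).neg
  · rw [neg_sub_neg, ← map_sub]
    refine (S.A.le_opNorm _).trans ?_
    gcongr
    exact (norm_sub_le _ _).trans (add_le_add ((hM _ hτ).2.1 _) ((hM _ hi).2.1 _))
  · have hne : ∀ᵐ r : ℝ, r ≠ τ := by simp [ae_iff, measure_singleton]
    filter_upwards [hne] with r hr _
    have h1 := (tendsto_vel hτ hs hsI (sub_ne_zero.2 hr)
      (tendsto_const_nhds.sub hs : Tendsto (fun i => r - s i) l (𝓝 (r - τ))))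
    have h2 := (((S.A.continuous.tendsto _).comp h1).neg).sub_const (-S.A (S.vel τ (r - τ)))
    simpa using h2

theorem tendsto_of_uniform {E : Type*} [NormedAddCommGroup E] {u : ι → ℝ → E} {u₀ : ℝ → E}
    {r : ι → ℝ} {t : ℝ} (hu : ∀ ε > 0, ∀ᶠ i in l, ∀ t, ‖u i t - u₀ t‖ ≤ ε) (hu₀ : Continuous u₀)
    (hr : Tendsto r l (𝓝 t)) : Tendsto (fun i => u i (r i)) l (𝓝 (u₀ t)) := by
  have h1 : Tendsto (fun i => u i (r i) - u₀ (r i)) l (𝓝 0) := by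
    rw [Metric.tendsto_nhds]
    intro ε hε
    filter_upwards [hu (ε / 2) (half_pos hε)] with i hi
    rw [dist_zero_right]
    exact (hi _).trans_lt (half_lt_self hε)
  simpa using h1.add ((hu₀.tendsto t).comp hr)

theorem tendsto_clm_apply {E F : Type*} [NormedAddCommGroup E] [NormedSpace ℝ E]
    [NormedAddCommGroup F] [NormedSpace ℝ F] {N : ι → E →L[ℝ] F} {N₀ : E →L[ℝ] F} {u : ι → E}
    {u₀ : E} (hN : Tendsto N l (𝓝 N₀)) (hu : Tendsto u l (𝓝 u₀)) :
    Tendsto (fun i => N i (u i)) l (𝓝 (N₀ u₀)) :=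
  (isBoundedBilinearMap_apply.continuous.tendsto (N₀, u₀)).comp (hN.prodMk_nhds hu)

/-- The velocity of the sensitivity depends continuously on the delay except at `t = τ`, where its
source `-A ẋ(t - τ)` inherits the jump of `ẋ` at `0`. -/
theorem tendsto_sensVel [l.IsCountablyGenerated] (hτ : τ ∈ Icc 0 S.b)
    (hs : Tendsto s l (𝓝 τ)) (hsI : ∀ᶠ i in l, s i ∈ Icc 0 S.b) {t : ℝ} (ht : t ≠ τ) :
    Tendsto (fun i => S.sensVel (s i) t) l (𝓝 (S.sensVel τ t)) := by
  by_cases htT : t ∈ Ioc 0 S.T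
  · simp_rw [sensVel_of_mem htT]
    have hu := eventually_norm_sens_sub_le hτ hs hsI
    have hr : Tendsto (fun i => t - s i) l (𝓝 (t - τ)) := tendsto_const_nhds.sub hs
    have h0 : Tendsto (fun i => S.linOp (s i) t) l (𝓝 (S.linOp τ t)) :=
      ((S.continuous_fderiv.tendsto _).comp (tendsto_state hτ hs hsI
        (tendsto_const_nhds (x := t)) (.of_forall fun _ => htT.2))).neg
    have h1 := tendsto_of_uniform hu (continuous_sens hτ) (tendsto_const_nhds (x := t))
    have h2 := tendsto_of_uniform hu (continuous_sens hτ) hr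
    have h3 := tendsto_vel hτ hs hsI (sub_ne_zero.2 ht) hr
    exact ((tendsto_clm_apply h0 h1).add ((S.A.continuous.tendsto _).comp h2)).add
      (((S.A.continuous.tendsto _).comp h3).neg)
  · simp_rw [sensVel_of_notMem htT]
    exact tendsto_const_nhds

end Limits

variable (S) in
/-- The filter of the delays in `[0, b]` that tend to `τ` and differ from it. -/
abbrev puncturedNhds (τ : ℝ) : Filter ℝ := 𝓝[Icc 0 S.b \ {τ}] τ

theorem tendsto_id_punctured : Tendsto id (S.puncturedNhds τ) (𝓝 τ) :=
  tendsto_id.mono_left nhdsWithin_le_nhds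

theorem eventually_mem_punctured : ∀ᶠ σ in S.puncturedNhds τ, σ ∈ Icc 0 S.b ∧ σ ≠ τ := by
  filter_upwards [self_mem_nhdsWithin] with σ hσ using ⟨hσ.1, hσ.2⟩

variable (S) in
/-- The error committed at time `s` when the difference quotient of the velocity is replaced by the
right-hand side of the linearized equation: the second-order remainder of `f`, the variation of
`x'[τ]` between `s - σ` and `s - τ`, and the remainder of the difference quotient of the state in
time. -/
noncomputable def quotientError (τ σ s : ℝ) : ℝ :=
  ‖(σ - τ)⁻¹ • (S.f (S.state σ s) - S.f (S.state τ s)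
      - fderiv ℝ S.f (S.state τ s) (S.state σ s - S.state τ s))‖
    + ‖S.A‖ * ‖S.sens τ (s - σ) - S.sens τ (s - τ)‖
    + ‖S.A‖ * ‖(σ - τ)⁻¹ • (S.state τ (s - σ) - S.state τ (s - τ)) + S.vel τ (s - τ)‖

/-- The error of the difference quotient satisfies the differential inequality required for
Gronwall's lemma. -/
theorem norm_vel_quotient_sub_le {L : ℝ} (hL0 : 0 ≤ L) {s : ℝ} (hs : s ∈ Ioc 0 S.T)
    (hL : ‖fderiv ℝ S.f (S.state τ s)‖ ≤ L) :
    ‖(σ - τ)⁻¹ • (S.vel σ s - S.vel τ s) - S.sensVel τ s‖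
      ≤ (L + ‖S.A‖) * (‖(σ - τ)⁻¹ • (S.state σ s - S.state τ s) - S.sens τ s‖
        + ‖(σ - τ)⁻¹ • (S.state σ (s - σ) - S.state τ (s - σ)) - S.sens τ (s - σ)‖)
        + S.quotientError τ σ s := by
  set k := (σ - τ)⁻¹
  have e : k • (S.vel σ s - S.vel τ s) - S.sensVel τ s
      = (-(fderiv ℝ S.f (S.state τ s) (k • (S.state σ s - S.state τ s) - S.sens τ s))
        + S.A (k • (S.state σ (s - σ) - S.state τ (s - σ)) - S.sens τ (s - σ)))
        + (-(k • (S.f (S.state σ s) - S.f (S.state τ s)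
            - fderiv ℝ S.f (S.state τ s) (S.state σ s - S.state τ s)))
          + S.A (S.sens τ (s - σ) - S.sens τ (s - τ))
          + S.A (k • (S.state τ (s - σ) - S.state τ (s - τ)) + S.vel τ (s - τ))) := by
    rw [vel_of_mem hs, vel_of_mem hs, sensVel_of_mem hs, linOp]
    simp only [map_sub, map_add, map_smul, smul_sub, smul_add, smul_neg, neg_apply]
    abel
  rw [e, quotientError]
  have h1 := ((fderiv ℝ S.f (S.state τ s)).le_opNorm
    (k • (S.state σ s - S.state τ s) - S.sens τ s)).trans (mul_le_mul_of_nonneg_right hL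
      (norm_nonneg _))
  have h2 := S.A.le_opNorm (k • (S.state σ (s - σ) - S.state τ (s - σ)) - S.sens τ (s - σ))
  have h3 := S.A.le_opNorm (S.sens τ (s - σ) - S.sens τ (s - τ))
  have h4 := S.A.le_opNorm (k • (S.state τ (s - σ) - S.state τ (s - τ)) + S.vel τ (s - τ))
  refine (norm_add_le _ _).trans ?_
  refine (add_le_add (norm_add_le _ _) norm_add₃_le).trans ?_
  rw [norm_neg, norm_neg]
  have h5 : 0 ≤ ‖S.A‖ * ‖k • (S.state σ s - S.state τ s) - S.sens τ s‖ := by positivity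
  have h6 : 0 ≤ L * ‖k • (S.state σ (s - σ) - S.state τ (s - σ)) - S.sens τ (s - σ)‖ := by
    positivity
  nlinarith

theorem tendsto_quotientError (hτ : τ ∈ Icc 0 S.b) {s : ℝ} (hs : s ∈ Ioc 0 S.T) (hsτ : s ≠ τ) :
    Tendsto (fun σ => S.quotientError τ σ s) (S.puncturedNhds τ) (𝓝 0) := by
  obtain ⟨M, L, -, -, -, hM, -⟩ := S.exists_bounds
  have hI : ∀ᶠ σ in S.puncturedNhds τ, id σ ∈ Icc 0 S.b :=
    eventually_mem_punctured.mono fun σ h => h.1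
  have h1 : Tendsto (fun σ => (σ - τ)⁻¹ • (S.f (S.state σ s) - S.f (S.state τ s)
      - fderiv ℝ S.f (S.state τ s) (S.state σ s - S.state τ s))) (S.puncturedNhds τ) (𝓝 0) := by
    have hd := ((S.contDiff.differentiable two_ne_zero) (S.state τ s)).hasFDerivAt.isLittleO
    have hc : Tendsto (fun σ => S.state σ s) (S.puncturedNhds τ) (𝓝 (S.state τ s)) :=
      tendsto_state hτ tendsto_id_punctured hI (tendsto_const_nhds (x := s))
        (.of_forall fun _ => hs.2)
    have hO : (fun σ => S.state σ s - S.state τ s) =O[S.puncturedNhds τ] fun σ => σ - τ := by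
      refine Asymptotics.IsBigO.of_bound M ?_
      filter_upwards [hI] with σ hσ
      exact (hM σ hσ τ hτ).1 s hs.2
    exact ((hd.comp_tendsto hc).trans_isBigO hO).tendsto_inv_smul_nhds_zero
  have h2 : Tendsto (fun σ => S.sens τ (s - σ) - S.sens τ (s - τ)) (S.puncturedNhds τ) (𝓝 0) := by
    have hr : Tendsto (fun σ => s - σ) (S.puncturedNhds τ) (𝓝 (s - τ)) :=
      tendsto_const_nhds.sub tendsto_id_punctured
    simpa using (((continuous_sens hτ).tendsto _).comp hr).sub_const (S.sens τ (s - τ))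
  have h3 : Tendsto (fun σ => (σ - τ)⁻¹ • (S.state τ (s - σ) - S.state τ (s - τ))
      + S.vel τ (s - τ)) (S.puncturedNhds τ) (𝓝 0) := by
    have hd : HasDerivAt (fun σ => S.state τ (s - σ)) (-S.vel τ (s - τ)) τ := by
      have h := (hasDerivAt_state hτ (sub_ne_zero.2 hsτ)).scomp τ
        ((hasDerivAt_id' τ).const_sub s)
      rw [neg_one_smul] at h
      exact h
    rw [hasDerivAt_iff_tendsto_slope] at hd
    have hd' := hd.mono_left (nhdsWithin_mono τ (s := Icc 0 S.b \ {τ}) fun σ hσ => hσ.2)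
    simpa [slope_def_module] using hd'.add_const (S.vel τ (s - τ))
  have h := (h1.norm.add (h2.norm.const_mul ‖S.A‖)).add (h3.norm.const_mul ‖S.A‖)
  simp only [norm_zero, mul_zero, add_zero] at h
  exact h

theorem abs_inv_sub_mul_le (σ τ M : ℝ) (hM : 0 ≤ M) : ‖(σ - τ)⁻¹‖ * (M * |σ - τ|) ≤ M := by
  rw [norm_inv, Real.norm_eq_abs, mul_left_comm]
  exact mul_le_of_le_one_right hM (inv_mul_le_one)

/-- The difference quotients of the state converge uniformly on `(-∞, T]`. -/
theorem eventually_norm_state_quotient_sub_le (hτ : τ ∈ Icc 0 S.b) :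
    ∀ ε > 0, ∀ᶠ σ in S.puncturedNhds τ, ∀ t ≤ S.T,
      ‖(σ - τ)⁻¹ • (S.state σ t - S.state τ t) - S.sens τ t‖ ≤ ε := by
  obtain ⟨M, L, hM0, hL0, hM, hMσ, hL, hLf⟩ := S.exists_bounds
  obtain ⟨W, hW0, hW⟩ := S.exists_sens_bounds
  have hb := S.b_pos
  have hI : ∀ᶠ σ in S.puncturedNhds τ, σ ∈ Icc 0 S.b :=
    eventually_mem_punctured.mono fun σ h => h.1
  have hxτ := continuous_state hτ
  have hmem : ∀ s ∈ Ioc 0 S.T, s ∈ Icc (-S.b) S.T := fun s hs => ⟨by linarith [hs.1], hs.2⟩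
  refine eventually_norm_le_of_delay_gronwall (C := L + ‖S.A‖) (δ := fun σ => σ)
    (M := (L * M + L * M) + ‖S.A‖ * (W + W) + ‖S.A‖ * (M + M)) (by positivity) S.T_pos
    (e := fun σ s => (σ - τ)⁻¹ • (S.vel σ s - S.vel τ s) - S.sensVel τ s)
    (r := fun σ s => S.quotientError τ σ s) (hI.mono fun σ h => h.1) ?_ ?_ ?_ ?_ ?_ ?_ ?_
  · filter_upwards [hI] with σ hσ
    exact (((continuous_state hσ).sub hxτ).const_smul (σ - τ)⁻¹).sub (continuous_sens hτ)
  · filter_upwards [hI] with σ hσ t ht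
    rw [state_of_nonpos hσ ht, state_of_nonpos hτ ht, sens_of_nonpos hτ ht]
    simp
  · filter_upwards [hI] with σ hσ t _
    have i1 := intervalIntegrable_vel hσ 0 t
    have i2 := intervalIntegrable_vel hτ 0 t
    have e : ∫ s in (0 : ℝ)..t, (σ - τ)⁻¹ • (S.vel σ s - S.vel τ s)
        = (σ - τ)⁻¹ • ((∫ s in (0 : ℝ)..t, S.vel σ s) - ∫ s in (0 : ℝ)..t, S.vel τ s) := by
      rw [intervalIntegral.integral_smul, intervalIntegral.integral_sub i1 i2]
    have i3 : IntervalIntegrable (fun s => (σ - τ)⁻¹ • (S.vel σ s - S.vel τ s)) volume 0 t :=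
      (i1.sub i2).smul (σ - τ)⁻¹
    rw [intervalIntegral.integral_sub i3 (integrable_sensVel hτ).intervalIntegrable, e]
    rw [state_eq hσ t, state_eq hτ t, sens_eq hτ t, add_sub_add_left_eq_sub]
  · filter_upwards [hI] with σ hσ s hs
    exact norm_vel_quotient_sub_le hL0.le hs (hL _ ((hM τ hτ).1 s (hmem s hs)))
  · filter_upwards [hI] with σ hσ
    have hxσ := continuous_state hσ
    have hw := continuous_sens hτ
    have hf := S.continuous_f
    have hf' := S.continuous_fderiv
    have hv : Measurable fun s => S.vel τ (s - τ) :=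
      (measurable_vel hτ).comp (measurable_id.sub_const τ)
    have h1 : Continuous fun s => ‖(σ - τ)⁻¹ • (S.f (S.state σ s) - S.f (S.state τ s)
        - fderiv ℝ S.f (S.state τ s) (S.state σ s - S.state τ s))‖
        + ‖S.A‖ * ‖S.sens τ (s - σ) - S.sens τ (s - τ)‖ := by fun_prop
    have h2 : Continuous fun s => (σ - τ)⁻¹ • (S.state τ (s - σ) - S.state τ (s - τ)) := by
      fun_prop
    exact (h1.measurable.add ((h2.measurable.add hv).norm.const_mul _)).aestronglyMeasurable
  · filter_upwards [hI] with σ hσ s hs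
    have h0 : 0 ≤ S.quotientError τ σ s := by unfold quotientError; positivity
    rw [Real.norm_of_nonneg h0, quotientError]
    have hd := (hMσ σ hσ τ hτ).1 s hs.2
    gcongr
    · rw [norm_smul]
      have h1 : ‖S.f (S.state σ s) - S.f (S.state τ s)‖ ≤ L * (M * |σ - τ|) :=
        (hLf _ _ ((hM σ hσ).1 s (hmem s hs)) ((hM τ hτ).1 s (hmem s hs))).trans (by gcongr)
      have h2 : ‖fderiv ℝ S.f (S.state τ s) (S.state σ s - S.state τ s)‖ ≤ L * (M * |σ - τ|) :=
        ((fderiv ℝ S.f (S.state τ s)).le_opNorm _).trans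
          (by gcongr; exact hL _ ((hM τ hτ).1 s (hmem s hs)))
      calc _ ≤ ‖(σ - τ)⁻¹‖ * (L * (M * |σ - τ|) + L * (M * |σ - τ|)) := by
            gcongr
            exact (norm_sub_le _ _).trans (add_le_add h1 h2)
        _ = ‖(σ - τ)⁻¹‖ * ((L * M + L * M) * |σ - τ|) := by ring
        _ ≤ _ := abs_inv_sub_mul_le _ _ _ (by positivity)
    · exact (norm_sub_le _ _).trans (add_le_add (hW τ hτ _).1 (hW τ hτ _).1)
    · refine (norm_add_le _ _).trans (add_le_add ?_ ((hM τ hτ).2.1 _))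
      rw [norm_smul]
      refine le_trans ?_ (abs_inv_sub_mul_le σ τ M hM0.le)
      gcongr
      refine ((hM τ hτ).2.2 _ _).trans_eq ?_
      rw [sub_sub_sub_cancel_left, abs_sub_comm]
  · have hne : ∀ᵐ r : ℝ, r ≠ τ := by simp [ae_iff, measure_singleton]
    filter_upwards [hne] with s hsτ hs
    exact tendsto_quotientError hτ hs hsτ

/-- The difference quotients of the velocity converge for `s ≠ τ`, by the equation and the uniform
convergence of the difference quotients of the state. -/
theorem tendsto_vel_quotient (hτ : τ ∈ Icc 0 S.b) {s : ℝ} (hs : s ∈ Ioc 0 S.T) (hsτ : s ≠ τ) :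
    Tendsto (fun σ => (σ - τ)⁻¹ • (S.vel σ s - S.vel τ s)) (S.puncturedNhds τ)
      (𝓝 (S.sensVel τ s)) := by
  obtain ⟨M, L, hM0, hL0, hM, hMσ, hL, hLf⟩ := S.exists_bounds
  have hb := S.b_pos
  rw [tendsto_iff_norm_sub_tendsto_zero, Metric.tendsto_nhds]
  intro ε hε
  have hC : 0 < L + ‖S.A‖ := by positivity
  filter_upwards [eventually_norm_state_quotient_sub_le hτ (ε / (4 * (L + ‖S.A‖)))
    (by positivity), (tendsto_quotientError hτ hs hsτ).eventually
      (gt_mem_nhds (show (0 : ℝ) < ε / 2 by positivity)), eventually_mem_punctured]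
    with σ h1 h2 hσ
  rw [dist_zero_right, norm_norm]
  refine (norm_vel_quotient_sub_le hL0.le hs
    (hL _ ((hM τ hτ).1 s ⟨by linarith [hs.1], hs.2⟩))).trans_lt ?_
  have h3 := h1 s hs.2
  have h4 := h1 (s - σ) (by linarith [hs.2, hσ.1.1])
  have h5 : (L + ‖S.A‖) * (‖(σ - τ)⁻¹ • (S.state σ s - S.state τ s) - S.sens τ s‖
      + ‖(σ - τ)⁻¹ • (S.state σ (s - σ) - S.state τ (s - σ)) - S.sens τ (s - σ)‖)
      ≤ (L + ‖S.A‖) * (ε / (4 * (L + ‖S.A‖)) + ε / (4 * (L + ‖S.A‖))) := by gcongr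
  have h6 : (L + ‖S.A‖) * (ε / (4 * (L + ‖S.A‖)) + ε / (4 * (L + ‖S.A‖))) = ε / 2 := by
    field_simp; ring
  linarith

end DelaySystem

namespace DelaySystem

/-! ### The adjoint state and the duality relation -/

variable {n : ℕ} {S : DelaySystem n} {τ σ : ℝ}

theorem intervalIntegrable_xd (S : DelaySystem n) : IntervalIntegrable S.xd volume 0 S.T := by
  rw [intervalIntegrable_iff_integrableOn_Ioc_of_le S.T_pos.le]
  exact S.xd_memLp.integrable one_le_two

theorem intervalIntegrable_reverse {E : Type*} [NormedAddCommGroup E] {T : ℝ} {u : ℝ → E}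
    (hu : IntervalIntegrable u volume 0 T) :
    IntervalIntegrable (fun s => u (T - s)) volume 0 T := by
  simpa using (hu.comp_sub_left T).symm

variable (S) in
/-- The coefficient of the adjoint equation after time reversal. -/
noncomputable def adjOp (τ s : ℝ) : Vec n →L[ℝ] Vec n :=
  -(fderiv ℝ S.f (S.state τ (S.T - s))).adjoint

theorem continuous_adjOp (hτ : τ ∈ Icc 0 S.b) : Continuous (S.adjOp τ) := by
  have h1 : Continuous fun s => fderiv ℝ S.f (S.state τ (S.T - s)) :=
    S.continuous_fderiv.comp ((continuous_state hτ).comp (by fun_prop))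
  exact ((ContinuousLinearMap.adjoint (𝕜 := ℝ) (E := Vec n) (F := Vec n)).continuous.comp h1).neg

theorem integrableOn_adjRhs (hτ : τ ∈ Icc 0 S.b) :
    IntegrableOn (fun s => S.state τ (S.T - s) - S.xd (S.T - s)) (Ioc 0 S.T) := by
  rw [← intervalIntegrable_iff_integrableOn_Ioc_of_le S.T_pos.le]
  exact intervalIntegrable_reverse
    (((continuous_state hτ).intervalIntegrable _ _).sub S.intervalIntegrable_xd)

variable (S) in
open Classical in
/-- The adjoint state with time reversed, which solves a forward delay equation with zero
history. -/
noncomputable def revCostate (τ : ℝ) : ℝ → Vec n :=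
  if h : τ ∈ Icc 0 S.b then Classical.choose (IsLinearSolution.exists_solution
    (B := S.A.adjoint) S.T_pos h.1 (continuous_adjOp h) (integrableOn_adjRhs h)) else 0

theorem isLinearSolution_revCostate (hτ : τ ∈ Icc 0 S.b) :
    IsLinearSolution S.T τ (S.adjOp τ) S.A.adjoint
      (fun s => S.state τ (S.T - s) - S.xd (S.T - s)) (S.revCostate τ) := by
  rw [revCostate, dif_pos hτ]
  exact Classical.choose_spec (IsLinearSolution.exists_solution
    (B := S.A.adjoint) S.T_pos hτ.1 (continuous_adjOp hτ) (integrableOn_adjRhs hτ))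

variable (S) in
/-- The adjoint state, extended by a constant to the left of `0`. -/
noncomputable def costate (τ t : ℝ) : Vec n := S.revCostate τ (S.T - t)

variable (S) in
/-- The derivative of the adjoint state on `[0, T)`, extended by zero. -/
noncomputable def costateVel (τ t : ℝ) : Vec n :=
  -(Ioc 0 S.T).indicator (fun s => S.adjOp τ s (S.revCostate τ s)
    + S.A.adjoint (S.revCostate τ (s - τ)) + (S.state τ (S.T - s) - S.xd (S.T - s))) (S.T - t)

theorem continuous_costate (hτ : τ ∈ Icc 0 S.b) : Continuous (S.costate τ) :=
  (isLinearSolution_revCostate hτ).continuous.comp (by fun_prop)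

theorem costate_of_ge (hτ : τ ∈ Icc 0 S.b) {t : ℝ} (ht : S.T ≤ t) : S.costate τ t = 0 :=
  (isLinearSolution_revCostate hτ).apply_of_nonpos S.T_pos.le (by linarith)

theorem costateVel_of_mem {t : ℝ} (ht : t ∈ Ico 0 S.T) :
    S.costateVel τ t = (fderiv ℝ S.f (S.state τ t)).adjoint (S.costate τ t)
      - S.A.adjoint (S.costate τ (t + τ)) - (S.state τ t - S.xd t) := by
  rw [costateVel, indicator_of_mem (show S.T - t ∈ Ioc 0 S.T from
    ⟨by linarith [ht.2], by linarith [ht.1]⟩), adjOp, costate, costate, sub_sub_cancel,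
    sub_sub S.T t τ, neg_apply]
  abel

theorem memLp_costateVel (hτ : τ ∈ Icc 0 S.b) : MemLp (S.costateVel τ) 2 volume := by
  set u : ℝ → Vec n := fun t => (fderiv ℝ S.f (S.state τ t)).adjoint (S.costate τ t)
    - S.A.adjoint (S.costate τ (t + τ)) - S.state τ t with hu
  have hP := continuous_costate hτ
  have hx := continuous_state hτ
  have huc : Continuous u := by
    have h1 : Continuous fun s => fderiv ℝ S.f (S.state τ s) := S.continuous_fderiv.comp hx
    have h2 := (ContinuousLinearMap.adjoint (𝕜 := ℝ) (E := Vec n) (F := Vec n)).continuous.comp h1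
    have h3 : Continuous fun t => (fderiv ℝ S.f (S.state τ t)).adjoint (S.costate τ t) :=
      h2.clm_apply hP
    have h4 : Continuous fun t => S.A.adjoint (S.costate τ (t + τ)) := by fun_prop
    exact (h3.sub h4).sub hx
  obtain ⟨M, hM⟩ := isCompact_Icc.exists_bound_of_continuousOn (huc.continuousOn (s := Icc 0 S.T))
  have h1 : MemLp u 2 (volume.restrict (Ioc 0 S.T)) :=
    MemLp.of_bound huc.aestronglyMeasurable M (by
      filter_upwards [ae_restrict_mem measurableSet_Ioc] with t ht using hM t ⟨ht.1.le, ht.2⟩)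
  have h2 := (memLp_indicator_iff_restrict measurableSet_Ioc).2 (h1.add S.xd_memLp)
  refine h2.ae_eq ?_
  have hne : ∀ c : ℝ, ∀ᵐ s : ℝ, s ≠ c := fun c => by simp [ae_iff, measure_singleton]
  filter_upwards [hne 0, hne S.T] with t h0 hT
  by_cases ht : t ∈ Ioc 0 S.T
  · rw [indicator_of_mem ht, costateVel_of_mem ⟨ht.1.le, lt_of_le_of_ne ht.2 hT⟩, Pi.add_apply]
    exact sub_add _ _ _
  · rw [indicator_of_notMem ht, costateVel, indicator_of_notMem, neg_zero]
    exact fun h => ht ⟨lt_of_le_of_ne (by linarith [h.2]) (Ne.symm h0), by linarith [h.1]⟩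

theorem intervalIntegrable_costateVel (hτ : τ ∈ Icc 0 S.b) (p q : ℝ) :
    IntervalIntegrable (S.costateVel τ) volume p q := by
  rw [intervalIntegrable_iff]
  have : IsFiniteMeasure (volume.restrict (uIoc p q)) := ⟨by simp [uIoc]⟩
  exact ((memLp_costateVel hτ).restrict _).integrable one_le_two

theorem costate_eq (hτ : τ ∈ Icc 0 S.b) (t : ℝ) :
    S.costate τ t = S.costate τ 0 + ∫ s in (0 : ℝ)..t, S.costateVel τ s := by
  set F := (Ioc 0 S.T).indicator (fun s => S.adjOp τ s (S.revCostate τ s)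
    + S.A.adjoint (S.revCostate τ (s - τ)) + (S.state τ (S.T - s) - S.xd (S.T - s))) with hF
  have hFq : F = fun s => -S.costateVel τ (S.T - s) := by
    ext1 s
    rw [costateVel, sub_sub_cancel, neg_neg]
  have hFi : ∀ p q, IntervalIntegrable F volume p q := fun p q => by
    rw [hFq]
    have := (intervalIntegrable_costateVel hτ (S.T - p) (S.T - q)).comp_sub_left S.T
    simp only [sub_sub_cancel] at this
    exact this.neg
  have h1 : ∀ t, S.costate τ t = ∫ s in (0 : ℝ)..S.T - t, F s := fun t =>
    (isLinearSolution_revCostate hτ).eq (S.T - t)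
  have h2 : ∫ s in (0 : ℝ)..t, S.costateVel τ s = -∫ s in S.T - t..S.T, F s := by
    have h3 : ∫ s in (0 : ℝ)..t, F (S.T - s) = ∫ s in S.T - t..S.T - 0, F s :=
      intervalIntegral.integral_comp_sub_left (fun s => F s) S.T
    rw [sub_zero] at h3
    rw [← h3, ← intervalIntegral.integral_neg]
    exact intervalIntegral.integral_congr fun s _ => rfl
  rw [h1 t, h1 0, h2, sub_zero, ← intervalIntegral.integral_add_adjacent_intervals (hFi 0 (S.T - t))
    (hFi (S.T - t) S.T), add_neg_cancel_right]

theorem eventually_norm_costate_sub_le {ι : Type*} {l : Filter ι} {s : ι → ℝ}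
    [l.IsCountablyGenerated] (hτ : τ ∈ Icc 0 S.b)
    (hs : Tendsto s l (𝓝 τ)) (hsI : ∀ᶠ i in l, s i ∈ Icc 0 S.b) :
    ∀ ε > 0, ∀ᶠ i in l, ∀ t, ‖S.costate (s i) t - S.costate τ t‖ ≤ ε := by
  obtain ⟨M, L, hM0, hL0, hM, -, hL, -⟩ := S.exists_bounds
  have hb := S.b_pos
  have hmem : ∀ r ∈ Ioc 0 S.T, S.T - r ∈ Icc (-S.b) S.T := fun r hr =>
    ⟨by linarith [hr.2], by linarith [hr.1]⟩
  have hN : ∀ τ ∈ Icc 0 S.b, ∀ s ∈ Ioc 0 S.T, ‖S.adjOp τ s‖ ≤ L := fun τ hτ s hs => by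
    rw [adjOp, norm_neg, LinearIsometryEquiv.norm_map]
    exact hL _ ((hM τ hτ).1 _ (hmem s hs))
  have hxt : ∀ r ∈ Ioc 0 S.T, Tendsto (fun i => S.state (s i) (S.T - r)) l
      (𝓝 (S.state τ (S.T - r))) := fun r hr =>
    tendsto_state hτ hs hsI tendsto_const_nhds (.of_forall fun _ => (hmem r hr).2)
  have main := (isLinearSolution_revCostate hτ).eventually_norm_sub_le (H := M + M) (l := l)
    (δ' := s) S.T_pos hL0 (continuous_adjOp hτ) (hN τ hτ) (integrableOn_adjRhs hτ)
    (hsI.mono fun i hi => hi.1) hs (hsI.mono fun i hi => isLinearSolution_revCostate hi)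
    (hsI.mono fun i hi => continuous_adjOp hi) (hsI.mono fun i hi => hN _ hi)
    (fun r hr => ?_) (hsI.mono fun i hi => integrableOn_adjRhs hi)
    (hsI.mono fun i hi r hr => ?_) (.of_forall fun r hr => ?_)
  · exact fun ε hε => (main ε hε).mono fun i hi t => hi (S.T - t)
  · exact (((ContinuousLinearMap.adjoint (𝕜 := ℝ) (E := Vec n) (F := Vec n)).continuous.tendsto
      _).comp ((S.continuous_fderiv.tendsto _).comp (hxt r hr))).neg
  · rw [sub_sub_sub_cancel_right]
    exact (norm_sub_le _ _).trans
      (add_le_add ((hM _ hi).1 _ (hmem r hr)) ((hM τ hτ).1 _ (hmem r hr)))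
  · simp_rw [sub_sub_sub_cancel_right]
    simpa using (hxt r hr).sub_const (S.state τ (S.T - r))

/-- The adjoint of a delay is an advance: both functions vanish where the shifted integral leaves
the interval `[0, T]`. -/
theorem integral_inner_costate_shift (hτ : τ ∈ Icc 0 S.b) {u : ℝ → Vec n} (hu : Continuous u)
    (hu0 : ∀ t ≤ 0, u t = 0) :
    ∫ t in (0 : ℝ)..S.T, ⟪S.costate τ (t + τ), S.A (u t)⟫
      = ∫ t in (0 : ℝ)..S.T, ⟪S.costate τ t, S.A (u (t - τ))⟫ := by
  set G : ℝ → ℝ := fun t => ⟪S.costate τ t, S.A (u (t - τ))⟫ with hG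
  have hP := continuous_costate hτ
  have hGc : Continuous G := by fun_prop
  have h1 : ∫ t in (0 : ℝ)..S.T, ⟪S.costate τ (t + τ), S.A (u t)⟫
      = ∫ t in (0 + τ)..(S.T + τ), G t := by
    rw [← intervalIntegral.integral_comp_add_right]
    simp [hG]
  have hi := fun p q => hGc.intervalIntegrable (μ := volume) p q
  have h2 : ∫ t in (0 : ℝ)..τ, G t = 0 := by
    refine intervalIntegral.integral_zero_ae (.of_forall fun t ht => ?_)
    rw [uIoc_of_le hτ.1] at ht
    simp [hG, hu0 (t - τ) (by linarith [ht.2])]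
  have h3 : ∫ t in S.T..S.T + τ, G t = 0 := by
    refine intervalIntegral.integral_zero_ae (.of_forall fun t ht => ?_)
    rw [uIoc_of_le (by linarith [hτ.1])] at ht
    simp [hG, costate_of_ge hτ ht.1.le]
  rw [h1, zero_add]
  have h4 := intervalIntegral.integral_add_adjacent_intervals (hi 0 τ) (hi τ (S.T + τ))
  have h5 := intervalIntegral.integral_add_adjacent_intervals (hi 0 S.T) (hi S.T (S.T + τ))
  rw [h2, zero_add] at h4
  rw [h3, add_zero] at h5
  rw [h4, ← h5]

theorem intervalIntegrable_inner {E : Type*} [NormedAddCommGroup E] [InnerProductSpace ℝ E]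
    {a b : ℝ} {u v : ℝ → E} (hu : IntervalIntegrable u volume a b) (hv : Continuous v) :
    IntervalIntegrable (fun t => ⟪v t, u t⟫) volume a b := by
  obtain ⟨M, hM⟩ := isCompact_uIcc.exists_bound_of_continuousOn (hv.continuousOn (s := uIcc a b))
  rw [intervalIntegrable_iff] at hu ⊢
  refine (hu.norm.const_mul M).mono' (hv.aestronglyMeasurable.inner hu.aestronglyMeasurable) ?_
  filter_upwards [ae_restrict_mem measurableSet_uIoc] with t ht
  exact (norm_inner_le_norm _ _).trans (by gcongr; exact hM t (uIoc_subset_uIcc ht))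

/-- The duality relation: the linear functional `u ↦ ∫ ⟨x - x_d, u⟩` is expressed through the
adjoint state and the residual of `u` in the linearized equation. -/
theorem integral_inner_eq_integral_costate (hτ : τ ∈ Icc 0 S.b) {u v : ℝ → Vec n}
    (hv : IntervalIntegrable v volume 0 S.T) (hu : Continuous u) (hu0 : ∀ t ≤ 0, u t = 0)
    (huv : ∀ t, u t = ∫ s in (0 : ℝ)..t, v s) :
    ∫ t in (0 : ℝ)..S.T, ⟪S.state τ t - S.xd t, u t⟫
      = ∫ t in (0 : ℝ)..S.T, ⟪S.costate τ t, v t - S.linOp τ t (u t) - S.A (u (t - τ))⟫ := by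
  have hT := S.T_pos.le
  have hP := continuous_costate hτ
  have hx := continuous_state hτ
  have hN := continuous_linOp hτ
  have hparts := integral_inner_add_inner (u := u) hT (intervalIntegrable_costateVel hτ 0 S.T) hv
    (fun t _ => costate_eq hτ t) (fun t _ => by rw [huv t, hu0 0 le_rfl, zero_add])
  rw [costate_of_ge hτ le_rfl, hu0 0 le_rfl, inner_zero_left, inner_zero_right, sub_zero] at hparts
  have i1 : IntervalIntegrable (fun t => ⟪S.state τ t - S.xd t, u t⟫) volume 0 S.T := by
    simpa only [real_inner_comm] using intervalIntegrable_inner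
      ((hx.intervalIntegrable _ _).sub S.intervalIntegrable_xd) hu
  have i2 : IntervalIntegrable (fun t => ⟪S.costate τ (t + τ), S.A (u t)⟫) volume 0 S.T :=
    Continuous.intervalIntegrable (by fun_prop) _ _
  have i3 : IntervalIntegrable (fun t => ⟪S.costate τ t, S.A (u (t - τ))⟫) volume 0 S.T :=
    Continuous.intervalIntegrable (by fun_prop) _ _
  have i4 : IntervalIntegrable (fun t => ⟪S.costate τ t, v t - S.linOp τ t (u t)⟫)
      volume 0 S.T :=
    intervalIntegrable_inner (hv.sub (Continuous.intervalIntegrable (by fun_prop) _ _)) hP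
  have e : ∫ t in (0 : ℝ)..S.T, (⟪S.costateVel τ t, u t⟫ + ⟪S.costate τ t, v t⟫)
      = ∫ t in (0 : ℝ)..S.T, (⟪S.costate τ t, v t - S.linOp τ t (u t)⟫
        - ⟪S.costate τ (t + τ), S.A (u t)⟫ - ⟪S.state τ t - S.xd t, u t⟫) := by
    have hne : ∀ᵐ s : ℝ, s ≠ S.T := by simp [ae_iff, measure_singleton]
    refine intervalIntegral.integral_congr_ae ?_
    filter_upwards [hne] with t htT ht
    rw [uIoc_of_le hT] at ht
    rw [costateVel_of_mem ⟨ht.1.le, lt_of_le_of_ne ht.2 htT⟩, inner_sub_left, inner_sub_left,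
      ContinuousLinearMap.adjoint_inner_left, ContinuousLinearMap.adjoint_inner_left,
      inner_sub_right, linOp, neg_apply, inner_neg_right]
    ring
  rw [e, intervalIntegral.integral_sub (i4.sub i2) i1, intervalIntegral.integral_sub i4 i2,
    integral_inner_costate_shift hτ hu hu0, ← intervalIntegral.integral_sub i4 i3] at hparts
  simp_rw [inner_sub_right _ (v _ - S.linOp τ _ (u _))]
  linarith

/-! ### The first derivative of the cost -/

variable (S) in
/-- The reduced cost. -/
noncomputable def cost (τ : ℝ) : ℝ := (1 / 2) * ∫ t in (0 : ℝ)..S.T, ‖S.state τ t - S.xd t‖ ^ 2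

variable (S) in
/-- The derivative of the reduced cost. -/
noncomputable def costDeriv (τ : ℝ) : ℝ :=
  ∫ t in (0 : ℝ)..S.T, ⟪S.state τ t - S.xd t, S.sens τ t⟫

theorem intervalIntegrable_sq (hτ : τ ∈ Icc 0 S.b) :
    IntervalIntegrable (fun t => ‖S.state τ t - S.xd t‖ ^ 2) volume 0 S.T := by
  obtain ⟨M, L, -, -, hM, -⟩ := S.exists_bounds
  rw [intervalIntegrable_iff_integrableOn_Ioc_of_le S.T_pos.le]
  have h1 : MemLp (S.state τ) 2 (volume.restrict (Ioc 0 S.T)) :=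
    MemLp.of_bound (continuous_state hτ).aestronglyMeasurable M (by
      filter_upwards [ae_restrict_mem measurableSet_Ioc] with t ht using
        (hM τ hτ).1 t ⟨by linarith [ht.1, S.b_pos], ht.2⟩)
  have h2 := h1.sub S.xd_memLp
  exact (memLp_two_iff_integrable_sq_norm h2.1).1 h2

theorem tendsto_state_quotient (hτ : τ ∈ Icc 0 S.b) {t : ℝ} (ht : t ≤ S.T) :
    Tendsto (fun σ => (σ - τ)⁻¹ • (S.state σ t - S.state τ t)) (S.puncturedNhds τ)
      (𝓝 (S.sens τ t)) := by
  rw [tendsto_iff_norm_sub_tendsto_zero, Metric.tendsto_nhds]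
  intro ε hε
  filter_upwards [eventually_norm_state_quotient_sub_le hτ (ε / 2) (half_pos hε)] with σ hσ
  rw [dist_zero_right, norm_norm]
  exact (hσ t ht).trans_lt (half_lt_self hε)

theorem hasDerivWithinAt_cost (hτ : τ ∈ Icc 0 S.b) :
    HasDerivWithinAt S.cost (S.costDeriv τ) (Icc 0 S.b) τ := by
  obtain ⟨M, L, hM0, -, hM, hMσ, -⟩ := S.exists_bounds
  have hT := S.T_pos.le
  have hb := S.b_pos
  rw [hasDerivWithinAt_iff_tendsto_slope]
  have hI : ∀ᶠ σ in S.puncturedNhds τ, σ ∈ Icc 0 S.b :=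
    eventually_mem_punctured.mono fun σ h => h.1
  have hlim : Tendsto (fun σ => ∫ t in (0 : ℝ)..S.T,
      ⟪(1 / 2 : ℝ) • (S.state σ t + S.state τ t) - S.xd t,
        (σ - τ)⁻¹ • (S.state σ t - S.state τ t)⟫) (S.puncturedNhds τ) (𝓝 (S.costDeriv τ)) := by
    refine intervalIntegral.tendsto_integral_filter_of_dominated_convergence
      (fun t => (M + ‖S.xd t‖) * M) ?_ ?_ ?_ (.of_forall fun t ht => ?_)
    · filter_upwards [hI] with σ hσ
      have hσc := continuous_state hσ
      have hτc := continuous_state hτ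
      rw [uIoc_of_le hT]
      have h1 : Continuous fun t => (1 / 2 : ℝ) • (S.state σ t + S.state τ t) := by fun_prop
      have h2 : Continuous fun t => (σ - τ)⁻¹ • (S.state σ t - S.state τ t) := by fun_prop
      exact (h1.aestronglyMeasurable.sub S.xd_memLp.1).inner h2.aestronglyMeasurable
    · filter_upwards [hI] with σ hσ
      refine .of_forall fun t ht => ?_
      rw [uIoc_of_le hT] at ht
      have ht' : t ∈ Icc (-S.b) S.T := ⟨by linarith [ht.1], ht.2⟩
      refine (norm_inner_le_norm _ _).trans ?_
      gcongr
      · refine (norm_sub_le _ _).trans ?_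
        gcongr
        rw [norm_smul, Real.norm_of_nonneg (by norm_num)]
        have h1 := norm_add_le (S.state σ t) (S.state τ t)
        have h2 := (hM σ hσ).1 t ht'
        have h3 := (hM τ hτ).1 t ht'
        linarith
      · rw [norm_smul]
        refine le_trans ?_ (abs_inv_sub_mul_le σ τ M hM0.le)
        gcongr
        exact (hMσ σ hσ τ hτ).1 t ht.2
    · exact (intervalIntegrable_const.add S.intervalIntegrable_xd.norm).mul_const M
    · rw [uIoc_of_le hT] at ht
      have h1 : Tendsto (fun σ => S.state σ t) (S.puncturedNhds τ) (𝓝 (S.state τ t)) :=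
        tendsto_state hτ tendsto_id_punctured hI (tendsto_const_nhds (x := t))
          (.of_forall fun _ => ht.2)
      have h2 := (((h1.add_const (S.state τ t)).const_smul (1 / 2 : ℝ)).sub_const (S.xd t)).inner
        (𝕜 := ℝ) (tendsto_state_quotient hτ ht.2)
      have h3 : (1 / 2 : ℝ) • (S.state τ t + S.state τ t) = S.state τ t := by
        rw [← two_smul ℝ, smul_smul]; norm_num
      rwa [h3] at h2
  refine hlim.congr' ?_
  filter_upwards [hI] with σ hσ
  rw [slope_def_module, cost, cost, ← mul_sub, ← intervalIntegral.integral_sub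
    (intervalIntegrable_sq hσ) (intervalIntegrable_sq hτ), smul_eq_mul, ← mul_assoc,
    ← intervalIntegral.integral_const_mul]
  refine intervalIntegral.integral_congr fun t _ => ?_
  rw [real_inner_smul_right, mul_assoc]
  congr 1
  have e1 : (1 / 2 : ℝ) • (S.state σ t + S.state τ t) - S.xd t
      = (1 / 2 : ℝ) • ((S.state σ t - S.xd t) + (S.state τ t - S.xd t)) := by
    module
  have e2 : S.state σ t - S.state τ t = (S.state σ t - S.xd t) - (S.state τ t - S.xd t) := by abel
  rw [e1, e2]
  generalize S.state σ t - S.xd t = p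
  generalize S.state τ t - S.xd t = q
  rw [real_inner_smul_left, inner_add_left, inner_sub_right, inner_sub_right,
    real_inner_self_eq_norm_sq, real_inner_self_eq_norm_sq, real_inner_comm p]
  ring

end DelaySystem

namespace DelaySystem

/-! ### The second time derivative of the state -/

variable {n : ℕ} {S : DelaySystem n} {τ σ : ℝ}

variable (S) in
/-- The right-hand limit `ẋ(0⁺)` of the velocity. -/
noncomputable def initVel (τ : ℝ) : Vec n := S.field τ (S.state τ) 0

variable (S) in
/-- The absolutely continuous part of the derivative of the velocity: `φ̈` on the left of `0` and
the derivative of the right-hand side of the delay equation on `(0, T]`. The velocity has in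
addition a jump at `0`. -/
noncomputable def acc (τ s : ℝ) : Vec n :=
  (Iic 0).indicator S.φ₂ s + (Ioc 0 S.T).indicator
    (fun s => S.linOp τ s (S.vel τ s) + S.A (S.vel τ (s - τ)) + S.g₁ s) s

theorem acc_of_nonpos {s : ℝ} (hs : s ≤ 0) : S.acc τ s = S.φ₂ s := by
  rw [acc, indicator_of_mem (mem_Iic.2 hs), indicator_of_notMem fun h => absurd h.1 (not_lt.2 hs),
    add_zero]

theorem acc_of_mem {s : ℝ} (hs : s ∈ Ioc 0 S.T) :
    S.acc τ s = S.linOp τ s (S.vel τ s) + S.A (S.vel τ (s - τ)) + S.g₁ s := by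
  rw [acc, indicator_of_notMem (show s ∉ Iic 0 from not_le.2 hs.1), indicator_of_mem hs, zero_add]

theorem acc_of_gt {s : ℝ} (hs : S.T < s) : S.acc τ s = 0 := by
  rw [acc, indicator_of_notMem (show s ∉ Iic 0 from not_le.2 (S.T_pos.trans hs)),
    indicator_of_notMem fun h => absurd h.2 (not_le.2 hs), add_zero]

theorem measurable_smooth_part (hτ : τ ∈ Icc 0 S.b) :
    Measurable fun s => S.linOp τ s (S.vel τ s) + S.A (S.vel τ (s - τ)) := by
  have hv := measurable_vel hτ
  have h1 : Measurable fun s => S.linOp τ s (S.vel τ s) :=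
    (isBoundedBilinearMap_apply (𝕜 := ℝ) (E := Vec n) (F := Vec n)).continuous.measurable.comp
      ((continuous_linOp hτ).measurable.prodMk hv)
  exact h1.add (S.A.continuous.measurable.comp (hv.comp (measurable_id.sub_const τ)))

theorem exists_norm_acc_le (S : DelaySystem n) : ∃ k : ℝ → ℝ, Integrable k ∧
    ∀ τ ∈ Icc 0 S.b, ∀ s, ‖S.acc τ s‖ ≤ k s := by
  obtain ⟨M, L, hM0, hL0, hM, -, hL, -⟩ := S.exists_bounds
  have hb := S.b_pos
  refine ⟨fun s => ‖S.φ₂ s‖ + (Ioc 0 S.T).indicator (fun _ => L * M + ‖S.A‖ * M) s + ‖S.g₁ s‖,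
    (S.φ₂_int.norm.add ((integrable_indicator_iff measurableSet_Ioc).2
      (integrableOn_const (by simp)))).add S.g₁_int.norm, fun τ hτ s => ?_⟩
  have h0 : 0 ≤ (Ioc 0 S.T).indicator (fun _ => L * M + ‖S.A‖ * M) s :=
    indicator_nonneg (fun _ _ => by positivity) s
  rcases le_or_gt s 0 with hs | hs
  · rw [acc_of_nonpos hs]
    linarith [norm_nonneg (S.g₁ s)]
  rcases le_or_gt s S.T with hsT | hsT
  · have hs' : s ∈ Ioc 0 S.T := ⟨hs, hsT⟩
    beta_reduce
    rw [acc_of_mem hs', indicator_of_mem hs']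
    have h1 : ‖S.linOp τ s (S.vel τ s)‖ ≤ L * M := by
      refine ((S.linOp τ s).le_opNorm _).trans ?_
      gcongr
      · rw [linOp, norm_neg]
        exact hL _ ((hM τ hτ).1 s ⟨by linarith, hsT⟩)
      · exact (hM τ hτ).2.1 s
    have h2 : ‖S.A (S.vel τ (s - τ))‖ ≤ ‖S.A‖ * M :=
      (S.A.le_opNorm _).trans (by gcongr; exact (hM τ hτ).2.1 _)
    refine norm_add₃_le.trans ?_
    linarith [norm_nonneg (S.φ₂ s)]
  · rw [acc_of_gt hsT, norm_zero]
    positivity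

theorem aestronglyMeasurable_acc (hτ : τ ∈ Icc 0 S.b) :
    AEStronglyMeasurable (S.acc τ) volume := by
  exact (S.φ₂_int.aestronglyMeasurable.indicator measurableSet_Iic).add
    (((measurable_smooth_part hτ).aestronglyMeasurable.add
      S.g₁_int.aestronglyMeasurable).indicator measurableSet_Ioc)

theorem integrable_acc (hτ : τ ∈ Icc 0 S.b) : Integrable (S.acc τ) := by
  obtain ⟨k, hk, hk'⟩ := S.exists_norm_acc_le
  exact hk.mono' (aestronglyMeasurable_acc hτ) (.of_forall (hk' τ hτ))

/-- On `[0, T]` the velocity is absolutely continuous: the chain rule is applied to each of the terms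
on the right-hand side of the delay equation. -/
theorem field_eq_integral (hτ : τ ∈ Icc 0 S.b) {t : ℝ} (ht : t ∈ Icc 0 S.T) :
    S.field τ (S.state τ) t = S.initVel τ + ∫ s in (0 : ℝ)..t, S.acc τ s := by
  obtain ⟨M, L, hM0, hL0, hM, -, hL, -⟩ := S.exists_bounds
  have hb := S.b_pos
  have i1 : IntervalIntegrable (fun s => S.linOp τ s (S.vel τ s)) volume 0 t := by
    rw [intervalIntegrable_iff_integrableOn_Ioc_of_le ht.1]
    have h1 : Measurable fun s => S.linOp τ s (S.vel τ s) :=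
      (isBoundedBilinearMap_apply (𝕜 := ℝ) (E := Vec n) (F := Vec n)).continuous.measurable.comp
        ((continuous_linOp hτ).measurable.prodMk (measurable_vel hτ))
    refine Integrable.of_bound h1.aestronglyMeasurable (L * M) ?_
    filter_upwards [ae_restrict_mem measurableSet_Ioc] with s hs
    refine ((S.linOp τ s).le_opNorm _).trans ?_
    gcongr
    · rw [linOp, norm_neg]
      exact hL _ ((hM τ hτ).1 s ⟨by linarith [hs.1], hs.2.trans ht.2⟩)
    · exact (hM τ hτ).2.1 s
  have i2 : IntervalIntegrable (fun s => S.vel τ (s - τ)) volume 0 t := by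
    simpa using (intervalIntegrable_vel hτ (0 - τ) (t - τ)).comp_sub_right τ
  have i2' : IntervalIntegrable (fun s => S.A (S.vel τ (s - τ))) volume 0 t :=
    ⟨S.A.integrable_comp i2.1, S.A.integrable_comp i2.2⟩
  have i3 : IntervalIntegrable S.g₁ volume 0 t := S.g₁_int.intervalIntegrable
  have e : ∫ s in (0 : ℝ)..t, S.acc τ s
      = ∫ s in (0 : ℝ)..t, (S.linOp τ s (S.vel τ s) + S.A (S.vel τ (s - τ)) + S.g₁ s) := by
    refine intervalIntegral.integral_congr_ae (.of_forall fun s hs => ?_)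
    rw [uIoc_of_le ht.1] at hs
    exact acc_of_mem ⟨hs.1, hs.2.trans ht.2⟩
  have e1 : ∫ s in (0 : ℝ)..t, S.linOp τ s (S.vel τ s)
      = -S.f (S.state τ t) - -S.f (S.state τ 0) := by
    refine intervalIntegral.integral_eq_sub_of_hasDerivAt_of_le
      (f := fun s => -S.f (S.state τ s)) ht.1
      (S.continuous_f.comp (continuous_state hτ)).neg.continuousOn (fun s hs => ?_) i1
    have h1 := ((S.contDiff.differentiable two_ne_zero) (S.state τ s)).hasFDerivAt.comp_hasDerivAt
      s (hasDerivAt_state hτ hs.1.ne')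
    exact h1.neg
  have e2 : ∫ s in (0 : ℝ)..t, S.A (S.vel τ (s - τ))
      = S.A (S.state τ (t - τ) - S.state τ (0 - τ)) := by
    rw [S.A.intervalIntegral_comp_comm i2, intervalIntegral.integral_comp_sub_right
      (fun s => S.vel τ s) τ]
    congr 1
    exact ((isSolution_state hτ).apply_sub hτ _ _).symm
  rw [e, intervalIntegral.integral_add (i1.add i2') i3, intervalIntegral.integral_add i1 i2', e1, e2,
    initVel, field, field, S.g_eq t, map_sub]
  abel

/-- The velocity is the sum of a step function, which carries the jump at `0`, and an absolutely
continuous function. -/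
theorem vel_eq (hτ : τ ∈ Icc 0 S.b) (t : ℝ) : S.vel τ t
    = (Ioi 0).indicator (fun _ => S.initVel τ - S.φ₁ 0) t
      + (S.φ₁ 0 + ∫ s in (0 : ℝ)..t, S.acc τ s) := by
  rcases le_or_gt t 0 with ht | ht
  · rw [vel_of_nonpos ht, indicator_of_notMem (by simpa using ht), zero_add, S.φ₁_eq t]
    congr 1
    refine intervalIntegral.integral_congr fun s hs => ?_
    rw [uIcc_of_ge ht] at hs
    exact (acc_of_nonpos hs.2).symm
  · have h1 : ∫ s in (0 : ℝ)..t, S.acc τ s = ∫ s in (0 : ℝ)..clamp S.T t, S.acc τ s := by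
      rw [← integral_indicator_Ioc S.T_pos.le]
      refine intervalIntegral.integral_congr_ae (.of_forall fun s hs => ?_)
      rw [uIoc_of_le ht.le] at hs
      rcases le_or_gt s S.T with h | h
      · rw [indicator_of_mem (show s ∈ Ioc 0 S.T from ⟨hs.1, h⟩)]
      · rw [indicator_of_notMem fun h' => absurd h'.2 (not_le.2 h), acc_of_gt h]
    rw [indicator_of_mem (by simpa using ht), h1, ← add_assoc, sub_add_cancel,
      ← field_eq_integral hτ (clamp_mem S.T_pos.le t), vel, slope, if_neg (not_le.2 ht)]

theorem tendsto_acc {ι : Type*} {l : Filter ι} {s : ι → ℝ} (hτ : τ ∈ Icc 0 S.b)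
    (hs : Tendsto s l (𝓝 τ)) (hsI : ∀ᶠ i in l, s i ∈ Icc 0 S.b) {t : ℝ} (ht : t ≠ τ) :
    Tendsto (fun i => S.acc (s i) t) l (𝓝 (S.acc τ t)) := by
  rcases le_or_gt t 0 with h0 | h0
  · simp_rw [acc_of_nonpos h0]; exact tendsto_const_nhds
  rcases le_or_gt t S.T with hT | hT
  · simp_rw [acc_of_mem (show t ∈ Ioc 0 S.T from ⟨h0, hT⟩)]
    have h1 : Tendsto (fun i => S.linOp (s i) t) l (𝓝 (S.linOp τ t)) :=
      ((S.continuous_fderiv.tendsto _).comp (tendsto_state hτ hs hsI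
        (tendsto_const_nhds (x := t)) (.of_forall fun _ => hT))).neg
    have h2 := tendsto_vel hτ hs hsI h0.ne' (tendsto_const_nhds (x := t))
    have h3 := tendsto_vel hτ hs hsI (sub_ne_zero.2 ht)
      (tendsto_const_nhds.sub hs : Tendsto (fun i => t - s i) l (𝓝 (t - τ)))
    exact ((tendsto_clm_apply h1 h2).add ((S.A.continuous.tendsto _).comp h3)).add_const _
  · simp_rw [acc_of_gt hT]; exact tendsto_const_nhds

/-! ### The second derivative of the cost -/

/-- Averages over intervals shrinking to `τ` of functions that converge jointly at `τ`. -/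
theorem tendsto_inv_smul_integral {l : Filter ℝ} (hl : l ≤ 𝓝[≠] τ) {G : ℝ → ℝ → ℝ} {G₀ : ℝ}
    (hG : Tendsto (Function.uncurry G) (l ×ˢ 𝓝 τ) (𝓝 G₀)) (hGc : ∀ᶠ σ in l, Continuous (G σ)) :
    Tendsto (fun σ => (σ - τ)⁻¹ * ∫ r in τ..σ, G σ r) l (𝓝 G₀) := by
  rw [Metric.tendsto_nhds]
  intro ε hε
  have h1 := hG.eventually (Metric.ball_mem_nhds G₀ (half_pos hε))
  rw [eventually_prod_iff] at h1
  obtain ⟨P, hP, Q, hQ, hPQ⟩ := h1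
  obtain ⟨η, hη, hball⟩ := Metric.eventually_nhds_iff_ball.1 hQ
  have hnear : ∀ᶠ σ in l, σ ∈ Metric.ball τ η :=
    (hl.trans nhdsWithin_le_nhds) (Metric.ball_mem_nhds τ hη)
  have hne : ∀ᶠ σ in l, σ ≠ τ := hl self_mem_nhdsWithin
  filter_upwards [hP, hnear, hne, hGc] with σ hPσ hσ hne hGc
  have hne' : σ - τ ≠ 0 := sub_ne_zero.2 hne
  have e : (σ - τ)⁻¹ * (∫ r in τ..σ, G σ r) - G₀ = (σ - τ)⁻¹ * ∫ r in τ..σ, (G σ r - G₀) := by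
    rw [intervalIntegral.integral_sub (hGc.intervalIntegrable _ _) intervalIntegrable_const,
      intervalIntegral.integral_const, smul_eq_mul]
    field_simp
  have h2 : ‖∫ r in τ..σ, (G σ r - G₀)‖ ≤ ε / 2 * |σ - τ| := by
    refine intervalIntegral.norm_integral_le_of_norm_le_const fun r hr => ?_
    have hr' : r ∈ Metric.ball τ η := by
      rw [Metric.mem_ball, Real.dist_eq] at hσ ⊢
      have := abs_sub_left_of_mem_uIcc (uIoc_subset_uIcc hr)
      exact this.trans_lt hσ
    have := hPQ hPσ (hball r hr')
    exact le_of_lt (by simpa [Real.dist_eq] using this)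
  rw [Real.dist_eq, e, ← Real.norm_eq_abs, norm_mul]
  calc _ ≤ ‖(σ - τ)⁻¹‖ * (ε / 2 * |σ - τ|) := by gcongr
    _ ≤ ε / 2 := abs_inv_sub_mul_le _ _ _ (by positivity)
    _ < ε := half_lt_self hε

variable (S) in
/-- The pairing `∫₀ᵀ ⟨p(t), A K(t - r)⟩ dt` of the adjoint state with a translate of `K`. -/
noncomputable def pairing (τ : ℝ) (K : ℝ → Vec n) (r : ℝ) : ℝ :=
  ∫ t in (0 : ℝ)..S.T, ⟪S.costate τ t, S.A (K (t - r))⟫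

theorem continuous_pairing (hτ : τ ∈ Icc 0 S.b) {K : ℝ → Vec n} (hK : Integrable K) :
    Continuous (S.pairing τ K) :=
  continuous_iff_continuousAt.2 fun r =>
    tendsto_integral_inner_translate (l := 𝓝 r) (p := fun _ => S.costate τ) (K := fun _ => K)
      (ρ := id) S.T_pos.le S.A tendsto_id (.of_forall fun _ => continuous_costate hτ)
      (continuous_costate hτ) (fun ε hε => .of_forall fun _ _ _ => by simpa using hε.le)
      (.of_forall fun _ => hK.aestronglyMeasurable) hK.norm (.of_forall fun _ _ => le_rfl)
      (.of_forall fun _ => tendsto_const_nhds)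

theorem puncturedNhds_le (τ : ℝ) : S.puncturedNhds τ ≤ 𝓝[≠] τ :=
  nhdsWithin_mono τ fun _ hσ => hσ.2

/-- The translation of `x'[σ]` by `σ` instead of `τ`. -/
theorem tendsto_quotient_sens_translate (hτ : τ ∈ Icc 0 S.b) :
    Tendsto (fun σ => (σ - τ)⁻¹ * ∫ t in (0 : ℝ)..S.T,
      ⟪S.costate τ t, S.A (S.sens σ (t - σ) - S.sens σ (t - τ))⟫) (S.puncturedNhds τ)
      (𝓝 (-S.pairing τ (S.sensVel τ) τ)) := by
  obtain ⟨W, hW0, hW⟩ := S.exists_sens_bounds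
  have hI : ∀ᶠ σ in S.puncturedNhds τ, σ ∈ Icc 0 S.b :=
    eventually_mem_punctured.mono fun σ h => h.1
  have hfst : Tendsto Prod.fst (S.puncturedNhds τ ×ˢ 𝓝 τ) (𝓝 τ) :=
    tendsto_id_punctured.comp tendsto_fst
  have hI' : ∀ᶠ i in S.puncturedNhds τ ×ˢ 𝓝 τ, i.1 ∈ Icc 0 S.b := tendsto_fst.eventually hI
  have hne : ∀ᵐ r : ℝ, r ≠ τ := by simp [ae_iff, measure_singleton]
  have h1 := tendsto_integral_inner_translate (l := S.puncturedNhds τ ×ˢ 𝓝 τ)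
    (p := fun _ => S.costate τ) (K := fun i => S.sensVel i.1) (K₀ := S.sensVel τ)
    (ρ := Prod.snd) (ρ₀ := τ) (k := (Ioc 0 S.T).indicator fun _ => W) S.T_pos.le S.A tendsto_snd
    (.of_forall fun _ => continuous_costate hτ)
    (continuous_costate hτ) (fun ε hε => .of_forall fun _ _ _ => by simpa using hε.le)
    (hI'.mono fun i hi => (measurable_sensVel hi).aestronglyMeasurable)
    ((integrable_indicator_iff measurableSet_Ioc).2 (integrableOn_const (by simp)))
    (hI'.mono fun i hi s => (hW _ hi s).2)
    (hne.mono fun s hs => tendsto_sensVel hτ hfst hI' hs)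
  have h2 := (tendsto_inv_smul_integral (G := fun σ r => S.pairing τ (S.sensVel σ) r)
    (puncturedNhds_le τ) h1 (hI.mono fun σ hσ =>
      continuous_pairing hτ (integrable_sensVel hσ))).neg
  refine h2.congr' ?_
  filter_upwards [hI] with σ hσ
  have h3 := integral_inner_translate_sub S.T_pos.le (continuous_costate hτ)
    (integrable_sensVel hσ) (Y := S.sens σ)
    (fun t => by rw [sens_of_nonpos hσ le_rfl, zero_add, sens_eq hσ t]) S.A σ τ
  rw [h3, mul_neg]
  rfl

/-- The variation of the velocity with the delay, at fixed translation. -/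
theorem tendsto_quotient_vel (hτ : τ ∈ Icc 0 S.b) :
    Tendsto (fun σ => (σ - τ)⁻¹ * ∫ t in (0 : ℝ)..S.T,
      ⟪S.costate τ t, S.A (S.vel σ (t - σ) - S.vel τ (t - σ))⟫) (S.puncturedNhds τ)
      (𝓝 (S.pairing τ (S.sensVel τ) τ)) := by
  obtain ⟨M, L, hM0, -, -, hMσ, -⟩ := S.exists_bounds
  have hI : ∀ᶠ σ in S.puncturedNhds τ, σ ∈ Icc 0 S.b :=
    eventually_mem_punctured.mono fun σ h => h.1
  have hne : ∀ᵐ r : ℝ, r ≠ τ := by simp [ae_iff, measure_singleton]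
  have h1 := tendsto_integral_inner_translate (l := S.puncturedNhds τ)
    (p := fun _ => S.costate τ)
    (K := fun σ => (Ioc 0 S.T).indicator fun s => (σ - τ)⁻¹ • (S.vel σ s - S.vel τ s))
    (K₀ := S.sensVel τ) (ρ := id) (ρ₀ := τ) (k := (Ioc 0 S.T).indicator fun _ => M) S.T_pos.le S.A
    tendsto_id_punctured (.of_forall fun _ => continuous_costate hτ)
    (continuous_costate hτ) (fun ε hε => .of_forall fun _ _ _ => by simpa using hε.le)
    (hI.mono fun σ hσ => ((((measurable_vel hσ).sub (measurable_vel hτ)).const_smul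
      (σ - τ)⁻¹).indicator measurableSet_Ioc).aestronglyMeasurable)
    ((integrable_indicator_iff measurableSet_Ioc).2 (integrableOn_const (by simp)))
    (hI.mono fun σ hσ s => by
      rw [norm_indicator_eq_indicator_norm]
      refine indicator_le_indicator ?_
      rw [norm_smul]
      exact (mul_le_mul_of_nonneg_left ((hMσ σ hσ τ hτ).2 s) (norm_nonneg _)).trans
        (abs_inv_sub_mul_le σ τ M hM0.le))
    (hne.mono fun s hs => by
      by_cases hsT : s ∈ Ioc 0 S.T
      · simp_rw [indicator_of_mem hsT]
        exact tendsto_vel_quotient hτ hsT hs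
      · simp_rw [indicator_of_notMem hsT, sensVel_of_notMem hsT]
        exact tendsto_const_nhds)
  refine h1.congr' ?_
  filter_upwards [hI] with σ hσ
  rw [← intervalIntegral.integral_const_mul]
  refine intervalIntegral.integral_congr fun t ht => ?_
  rw [uIcc_of_le S.T_pos.le] at ht
  simp only [id]
  by_cases hsT : t - σ ∈ Ioc 0 S.T
  · rw [indicator_of_mem hsT, map_smul, real_inner_smul_right]
  · have h0 : t - σ ≤ 0 := by
      by_contra h
      exact hsT ⟨not_le.1 h, by linarith [ht.2, hσ.1]⟩
    rw [indicator_of_notMem hsT, vel_of_nonpos h0, vel_of_nonpos h0, sub_self, map_zero,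
      inner_zero_right, mul_zero]

theorem integral_indicator_Ioi_sub (hτ : τ ∈ Icc 0 S.b) (hσ : 0 ≤ σ) (J : Vec n) :
    ∫ t in (0 : ℝ)..S.T, ⟪S.costate τ t, S.A ((Ioi 0).indicator (fun _ => J) (t - σ))⟫
      = ∫ t in σ..S.T, ⟪S.costate τ t, S.A J⟫ := by
  have hP := continuous_costate hτ
  have hT := S.T_pos.le
  have e : ∀ t, ⟪S.costate τ t, S.A ((Ioi 0).indicator (fun _ => J) (t - σ))⟫
      = (Ioi σ).indicator (fun t => ⟪S.costate τ t, S.A J⟫) t := fun t => by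
    simp only [indicator_apply, mem_Ioi, sub_pos]
    split_ifs <;> simp
  simp_rw [e]
  rw [intervalIntegral.integral_of_le hT, setIntegral_indicator measurableSet_Ioi, Ioc_inter_Ioi,
    max_eq_right hσ]
  rcases le_total σ S.T with h | h
  · rw [intervalIntegral.integral_of_le h]
  · rw [Ioc_eq_empty (not_lt.2 h), intervalIntegral.integral_symm,
      intervalIntegral.integral_zero_ae, setIntegral_empty, neg_zero]
    refine .of_forall fun t ht => ?_
    rw [uIoc_of_le h] at ht
    rw [costate_of_ge hτ ht.1.le, inner_zero_left]

/-- The variation of the translation of the velocity. The jump of the velocity at `0` produces the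
point evaluation of the adjoint state at `τ`. -/
theorem tendsto_quotient_vel_translate (hτ : τ ∈ Icc 0 S.b) :
    Tendsto (fun σ => (σ - τ)⁻¹ * ∫ t in (0 : ℝ)..S.T,
      ⟪S.costate τ t, S.A (S.vel τ (t - σ) - S.vel τ (t - τ))⟫) (S.puncturedNhds τ)
      (𝓝 (-(⟪S.costate τ τ, S.A (S.initVel τ - S.φ₁ 0)⟫ + S.pairing τ (S.acc τ) τ))) := by
  have hP := continuous_costate hτ
  have hK := integrable_acc hτ
  set J := S.initVel τ - S.φ₁ 0 with hJ
  set Y : ℝ → Vec n := fun t => S.φ₁ 0 + ∫ s in (0 : ℝ)..t, S.acc τ s with hY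
  have hYc : Continuous Y :=
    continuous_const.add (intervalIntegral.continuous_primitive (fun _ _ => hK.intervalIntegrable) 0)
  have hI : ∀ᶠ σ in S.puncturedNhds τ, σ ∈ Icc 0 S.b :=
    eventually_mem_punctured.mono fun σ h => h.1
  have hJc : Continuous fun t => ⟪S.costate τ t, S.A J⟫ := by fun_prop
  have h1 := tendsto_inv_smul_integral (G := fun _ r => ⟪S.costate τ r, S.A J⟫)
    (l := S.puncturedNhds τ) (puncturedNhds_le τ)
    ((hJc.tendsto τ).comp tendsto_snd) (.of_forall fun _ => hJc)
  have h2 := tendsto_inv_smul_integral (G := fun _ r => S.pairing τ (S.acc τ) r)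
    (l := S.puncturedNhds τ) (puncturedNhds_le τ)
    (((continuous_pairing hτ hK).tendsto τ).comp tendsto_snd)
    (.of_forall fun _ => continuous_pairing hτ hK)
  refine (h1.add h2).neg.congr' ?_
  filter_upwards [hI] with σ hσ
  have h3 := integral_inner_translate_sub S.T_pos.le hP hK (Y := Y) (fun t => by simp [hY]) S.A σ τ
  have hind : ∀ r, IntervalIntegrable
      (fun t => ⟪S.costate τ t, S.A ((Ioi 0).indicator (fun _ => J) (t - r))⟫) volume 0 S.T := by
    intro r
    have e : ∀ t, ⟪S.costate τ t, S.A ((Ioi 0).indicator (fun _ => J) (t - r))⟫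
        = (Ioi r).indicator (fun t => ⟪S.costate τ t, S.A J⟫) t := fun t => by
      simp only [indicator_apply, mem_Ioi, sub_pos]
      split_ifs <;> simp
    simp_rw [e]
    have := hJc.intervalIntegrable (μ := volume) 0 S.T
    exact ⟨this.1.indicator measurableSet_Ioi, this.2.indicator measurableSet_Ioi⟩
  have h4 : ∀ t, ⟪S.costate τ t, S.A (S.vel τ (t - σ) - S.vel τ (t - τ))⟫
      = (⟪S.costate τ t, S.A ((Ioi 0).indicator (fun _ => J) (t - σ))⟫
        - ⟪S.costate τ t, S.A ((Ioi 0).indicator (fun _ => J) (t - τ))⟫)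
        + ⟪S.costate τ t, S.A (Y (t - σ) - Y (t - τ))⟫ := by
    intro t
    rw [← inner_sub_right, ← inner_add_right, ← map_sub, ← map_add, vel_eq hτ, vel_eq hτ]
    congr 2
    simp only [hY, hJ]
    abel
  simp_rw [h4]
  rw [intervalIntegral.integral_add ((hind σ).sub (hind τ))
    (Continuous.intervalIntegrable (by fun_prop) _ _),
    intervalIntegral.integral_sub (hind σ) (hind τ), integral_indicator_Ioi_sub hτ hσ.1,
    integral_indicator_Ioi_sub hτ hτ.1, h3,
    ← intervalIntegral.integral_add_adjacent_intervals (hJc.intervalIntegrable τ σ)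
      (hJc.intervalIntegrable σ S.T)]
  simp only [pairing]
  ring

variable (S) in
/-- The second derivative of the reduced cost. -/
noncomputable def costDeriv₂ (τ : ℝ) : ℝ :=
  (∫ t in (0 : ℝ)..S.T, ‖S.sens τ t‖ ^ 2)
    - (∫ t in (0 : ℝ)..S.T, ⟪S.costate τ t,
        fderiv ℝ (fderiv ℝ S.f) (S.state τ t) (S.sens τ t) (S.sens τ t)⟫)
    - 2 * S.pairing τ (S.sensVel τ) τ
    + ⟪S.costate τ τ, S.A (S.initVel τ - S.φ₁ 0)⟫ + S.pairing τ (S.acc τ) τ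

theorem contDiff_fderiv (S : DelaySystem n) : ContDiff ℝ 1 (fderiv ℝ S.f) :=
  S.contDiff.fderiv_right (by norm_num)

theorem tendsto_sens {ι : Type*} {l : Filter ι} {s : ι → ℝ} [l.IsCountablyGenerated]
    (hτ : τ ∈ Icc 0 S.b) (hs : Tendsto s l (𝓝 τ)) (hsI : ∀ᶠ i in l, s i ∈ Icc 0 S.b) (t : ℝ) :
    Tendsto (fun i => S.sens (s i) t) l (𝓝 (S.sens τ t)) :=
  tendsto_of_uniform (eventually_norm_sens_sub_le hτ hs hsI) (continuous_sens hτ)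
    tendsto_const_nhds

theorem tendsto_quotient_state_sens (hτ : τ ∈ Icc 0 S.b) :
    Tendsto (fun σ => (σ - τ)⁻¹ * ∫ t in (0 : ℝ)..S.T,
      ⟪S.state σ t - S.state τ t, S.sens σ t⟫) (S.puncturedNhds τ)
      (𝓝 (∫ t in (0 : ℝ)..S.T, ‖S.sens τ t‖ ^ 2)) := by
  obtain ⟨M, L, hM0, -, -, hMσ, -⟩ := S.exists_bounds
  obtain ⟨W, hW0, hW⟩ := S.exists_sens_bounds
  have hI : ∀ᶠ σ in S.puncturedNhds τ, σ ∈ Icc 0 S.b :=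
    eventually_mem_punctured.mono fun σ h => h.1
  have h := intervalIntegral.tendsto_integral_filter_of_dominated_convergence
    (μ := volume) (a := 0) (b := S.T) (l := S.puncturedNhds τ)
    (F := fun σ t => ⟪(σ - τ)⁻¹ • (S.state σ t - S.state τ t), S.sens σ t⟫)
    (f := fun t => ⟪S.sens τ t, S.sens τ t⟫) (fun _ => M * W)
    (hI.mono fun σ hσ => by
      have h1 := continuous_state hσ
      have h2 := continuous_state hτ
      have h3 := continuous_sens hσ
      exact Continuous.aestronglyMeasurable (by fun_prop))
    (hI.mono fun σ hσ => .of_forall fun t ht => by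
      rw [uIoc_of_le S.T_pos.le] at ht
      refine (norm_inner_le_norm _ _).trans ?_
      gcongr
      · rw [norm_smul]
        refine le_trans ?_ (abs_inv_sub_mul_le σ τ M hM0.le)
        gcongr
        exact (hMσ σ hσ τ hτ).1 t ht.2
      · exact (hW σ hσ t).1)
    intervalIntegrable_const
    (.of_forall fun t ht => by
      rw [uIoc_of_le S.T_pos.le] at ht
      exact (tendsto_state_quotient hτ ht.2).inner (tendsto_sens hτ tendsto_id_punctured hI t))
  simp_rw [real_inner_self_eq_norm_sq] at h
  refine h.congr' (.of_forall fun σ => ?_)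
  beta_reduce
  rw [← intervalIntegral.integral_const_mul]
  exact intervalIntegral.integral_congr fun t _ => real_inner_smul_left _ _ _

/-- The variation of the coefficient `-Df(x[τ])` of the linearized equation. -/
theorem tendsto_quotient_linOp (hτ : τ ∈ Icc 0 S.b) :
    Tendsto (fun σ => (σ - τ)⁻¹ * ∫ t in (0 : ℝ)..S.T,
      ⟪S.costate τ t, (S.linOp σ t - S.linOp τ t) (S.sens σ t)⟫) (S.puncturedNhds τ)
      (𝓝 (-∫ t in (0 : ℝ)..S.T, ⟪S.costate τ t,
        fderiv ℝ (fderiv ℝ S.f) (S.state τ t) (S.sens τ t) (S.sens τ t)⟫)) := by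
  obtain ⟨M, L, hM0, -, hM, hMσ, -⟩ := S.exists_bounds
  obtain ⟨W, hW0, hW⟩ := S.exists_sens_bounds
  obtain ⟨L₂, hL0, -, hL₂⟩ := exists_lipschitz_ball S.contDiff_fderiv M
  obtain ⟨Q, hQ⟩ := isCompact_Icc.exists_bound_of_continuousOn
    ((continuous_costate hτ).continuousOn (s := Icc 0 S.T))
  have hQ0 : 0 ≤ Q := (norm_nonneg _).trans (hQ 0 ⟨le_rfl, S.T_pos.le⟩)
  have hb := S.b_pos
  have hI : ∀ᶠ σ in S.puncturedNhds τ, σ ∈ Icc 0 S.b :=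
    eventually_mem_punctured.mono fun σ h => h.1
  rw [← intervalIntegral.integral_neg]
  have h := intervalIntegral.tendsto_integral_filter_of_dominated_convergence
    (μ := volume) (a := 0) (b := S.T) (l := S.puncturedNhds τ)
    (F := fun σ t => ⟪S.costate τ t, ((σ - τ)⁻¹ • (S.linOp σ t - S.linOp τ t)) (S.sens σ t)⟫)
    (f := fun t => -⟪S.costate τ t,
      fderiv ℝ (fderiv ℝ S.f) (S.state τ t) (S.sens τ t) (S.sens τ t)⟫) (fun _ => Q * (L₂ * M * W))
    (hI.mono fun σ hσ => by
      have h1 := continuous_linOp hσ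
      have h2 := continuous_linOp hτ
      have h3 := continuous_sens hσ
      have h4 := continuous_costate hτ
      exact Continuous.aestronglyMeasurable (by fun_prop))
    (hI.mono fun σ hσ => .of_forall fun t ht => by
      rw [uIoc_of_le S.T_pos.le] at ht
      have ht' : t ∈ Icc (-S.b) S.T := ⟨by linarith [ht.1], ht.2⟩
      refine (norm_inner_le_norm _ _).trans ?_
      gcongr
      · exact hQ t ⟨ht.1.le, ht.2⟩
      · refine (ContinuousLinearMap.le_opNorm _ _).trans ?_
        gcongr
        · rw [norm_smul]
          refine le_trans ?_ (abs_inv_sub_mul_le σ τ (L₂ * M) (by positivity))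
          rw [mul_assoc]
          gcongr
          rw [linOp, linOp, neg_sub_neg, norm_sub_rev]
          exact (hL₂ _ _ ((hM σ hσ).1 t ht') ((hM τ hτ).1 t ht')).trans
            (by gcongr; exact (hMσ σ hσ τ hτ).1 t ht.2)
        · exact (hW σ hσ t).1)
    intervalIntegrable_const
    (.of_forall fun t ht => by
      rw [uIoc_of_le S.T_pos.le] at ht
      have hd := ((S.contDiff_fderiv.differentiable one_ne_zero) (S.state τ t)).hasFDerivAt
      have hx : Tendsto (fun σ => S.state σ t) (S.puncturedNhds τ) (𝓝 (S.state τ t)) :=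
        tendsto_state hτ tendsto_id_punctured hI (tendsto_const_nhds (x := t))
          (.of_forall fun _ => ht.2)
      have h1 := (hasFDerivWithinAt_univ.2 hd).lim (l := S.puncturedNhds τ)
        (c := fun σ => (σ - τ)⁻¹) (d := fun σ => S.state σ t - S.state τ t)
        (by simpa using hx.sub_const (S.state τ t)) (.of_forall fun _ => mem_univ _)
        (tendsto_state_quotient hτ ht.2)
      have h2 := (tendsto_clm_apply h1 (tendsto_sens hτ tendsto_id_punctured hI t)).neg
      have h3 := (tendsto_const_nhds (x := S.costate τ t) (f := S.puncturedNhds τ)).inner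
        (𝕜 := ℝ) h2
      rw [inner_neg_right] at h3
      refine h3.congr fun σ => ?_
      simp only [id, add_sub_cancel, linOp, neg_sub_neg]
      rw [← neg_apply, ← smul_neg, neg_sub])
  refine h.congr' (.of_forall fun σ => ?_)
  beta_reduce
  rw [← intervalIntegral.integral_const_mul]
  refine intervalIntegral.integral_congr fun t _ => ?_
  simp only [smul_apply, real_inner_smul_right]

/-- The first derivative of the cost is differentiable. The difference `x'[σ] - x'[τ]` solves the
linearized equation at `τ` up to a residual, and duality turns its product with `x[τ] - x_d` into the
pairing of the adjoint state at `τ` with this residual. -/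
theorem hasDerivWithinAt_costDeriv (hτ : τ ∈ Icc 0 S.b) :
    HasDerivWithinAt S.costDeriv (S.costDeriv₂ τ) (Icc 0 S.b) τ := by
  have hT := S.T_pos.le
  rw [hasDerivWithinAt_iff_tendsto_slope]
  have hI : ∀ᶠ σ in S.puncturedNhds τ, σ ∈ Icc 0 S.b :=
    eventually_mem_punctured.mono fun σ h => h.1
  have h := (((tendsto_quotient_state_sens hτ).add (tendsto_quotient_linOp hτ)).add
    (tendsto_quotient_sens_translate hτ)).sub
      ((tendsto_quotient_vel hτ).add (tendsto_quotient_vel_translate hτ))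
  have e : (∫ t in (0 : ℝ)..S.T, ‖S.sens τ t‖ ^ 2)
      + (-∫ t in (0 : ℝ)..S.T, ⟪S.costate τ t,
        fderiv ℝ (fderiv ℝ S.f) (S.state τ t) (S.sens τ t) (S.sens τ t)⟫)
      + -S.pairing τ (S.sensVel τ) τ - (S.pairing τ (S.sensVel τ) τ
        + -(⟪S.costate τ τ, S.A (S.initVel τ - S.φ₁ 0)⟫ + S.pairing τ (S.acc τ) τ))
      = S.costDeriv₂ τ := by
    rw [costDeriv₂]; ring
  rw [e] at h
  refine h.congr' ?_
  filter_upwards [hI] with σ hσ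
  have hP := continuous_costate hτ
  have hxσ := continuous_state hσ
  have hxτ := continuous_state hτ
  have hwσ := continuous_sens hσ
  have hwτ := continuous_sens hτ
  have hNσ := continuous_linOp hσ
  have hNτ := continuous_linOp hτ
  have iσ : IntervalIntegrable (S.sensVel σ) volume 0 S.T :=
    (integrable_sensVel hσ).intervalIntegrable
  have iτ : IntervalIntegrable (S.sensVel τ) volume 0 S.T :=
    (integrable_sensVel hτ).intervalIntegrable
  have hdual := integral_inner_eq_integral_costate hτ (u := fun t => S.sens σ t - S.sens τ t)
    (v := fun t => S.sensVel σ t - S.sensVel τ t) (iσ.sub iτ) (hwσ.sub hwτ)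
    (fun t ht => by rw [sens_of_nonpos hσ ht, sens_of_nonpos hτ ht, sub_self])
    (fun t => by
      rw [intervalIntegral.integral_sub (integrable_sensVel hσ).intervalIntegrable
        (integrable_sensVel hτ).intervalIntegrable, sens_eq hσ t, sens_eq hτ t])
  have ixd : ∀ {u : ℝ → Vec n}, Continuous u →
      IntervalIntegrable (fun t => ⟪S.state τ t - S.xd t, u t⟫) volume 0 S.T := fun hu => by
    simpa only [real_inner_comm] using intervalIntegrable_inner
      ((hxτ.intervalIntegrable _ _).sub S.intervalIntegrable_xd) hu
  have e1 : S.costDeriv σ - S.costDeriv τ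
      = (∫ t in (0 : ℝ)..S.T, ⟪S.state σ t - S.state τ t, S.sens σ t⟫)
        + ∫ t in (0 : ℝ)..S.T, ⟪S.state τ t - S.xd t, S.sens σ t - S.sens τ t⟫ := by
    simp_rw [inner_sub_right (S.state τ _ - S.xd _)]
    rw [intervalIntegral.integral_sub (ixd hwσ) (ixd hwτ), ← add_sub_assoc,
      ← intervalIntegral.integral_add (Continuous.intervalIntegrable (by fun_prop) _ _) (ixd hwσ),
      costDeriv, costDeriv]
    congr 1
    refine intervalIntegral.integral_congr fun t _ => ?_
    rw [← inner_add_left, sub_add_sub_cancel]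
  -- the residual of the difference in the linearized equation at `τ`
  have e2 : ∫ t in (0 : ℝ)..S.T, ⟪S.costate τ t, (S.sensVel σ t - S.sensVel τ t)
        - S.linOp τ t (S.sens σ t - S.sens τ t)
        - S.A (S.sens σ (t - τ) - S.sens τ (t - τ))⟫
      = ∫ t in (0 : ℝ)..S.T, (⟪S.costate τ t, (S.linOp σ t - S.linOp τ t) (S.sens σ t)⟫
        + ⟪S.costate τ t, S.A (S.sens σ (t - σ) - S.sens σ (t - τ))⟫
        - (⟪S.costate τ t, S.A (S.vel σ (t - σ) - S.vel τ (t - σ))⟫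
          + ⟪S.costate τ t, S.A (S.vel τ (t - σ) - S.vel τ (t - τ))⟫)) := by
    refine intervalIntegral.integral_congr_ae (.of_forall fun t ht => ?_)
    rw [uIoc_of_le hT] at ht
    rw [← inner_add_right, ← inner_add_right, ← inner_sub_right, sensVel_of_mem ht,
      sensVel_of_mem ht]
    congr 1
    simp only [map_sub, _root_.sub_apply]
    abel
  have ivel : ∀ ρ ∈ Icc 0 S.b, ∀ r, IntervalIntegrable (fun t => S.vel ρ (t - r))
      volume 0 S.T := fun ρ hρ r => by
    simpa using (intervalIntegrable_vel hρ (0 - r) (S.T - r)).comp_sub_right r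
  have iA : ∀ {u : ℝ → Vec n}, IntervalIntegrable u volume 0 S.T →
      IntervalIntegrable (fun t => ⟪S.costate τ t, S.A (u t)⟫) volume 0 S.T := fun hu =>
    intervalIntegrable_inner ⟨S.A.integrable_comp hu.1, S.A.integrable_comp hu.2⟩ hP
  rw [e2, intervalIntegral.integral_sub
    (Continuous.intervalIntegrable (by fun_prop) _ _)
    ((iA ((ivel σ hσ σ).sub (ivel τ hτ σ))).add (iA ((ivel τ hτ σ).sub (ivel τ hτ τ)))),
    intervalIntegral.integral_add (Continuous.intervalIntegrable (by fun_prop) _ _)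
      (Continuous.intervalIntegrable (by fun_prop) _ _),
    intervalIntegral.integral_add (iA ((ivel σ hσ σ).sub (ivel τ hτ σ)))
      (iA ((ivel τ hτ σ).sub (ivel τ hτ τ)))] at hdual
  rw [slope_def_module, smul_eq_mul, e1, hdual]
  ring

/-- Continuity in `τ` of the pairings in the formula, where the adjoint state, the function `K` and its
translation vary together. Convergence of `K` may fail at the point `τ`, where `K` can jump. -/
theorem tendsto_pairing_self {K : ℝ → ℝ → Vec n} {k : ℝ → ℝ} (hτ : τ ∈ Icc 0 S.b)
    (hKm : ∀ σ ∈ Icc 0 S.b, AEStronglyMeasurable (K σ)) (hk : Integrable k)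
    (hKk : ∀ σ ∈ Icc 0 S.b, ∀ s, ‖K σ s‖ ≤ k s)
    (hKt : ∀ s ≠ τ, Tendsto (fun σ => K σ s) (𝓝[Icc 0 S.b] τ) (𝓝 (K τ s))) :
    Tendsto (fun σ => S.pairing σ (K σ) σ) (𝓝[Icc 0 S.b] τ) (𝓝 (S.pairing τ (K τ) τ)) := by
  have hI : ∀ᶠ σ in 𝓝[Icc 0 S.b] τ, σ ∈ Icc 0 S.b := self_mem_nhdsWithin
  have hid : Tendsto id (𝓝[Icc 0 S.b] τ) (𝓝 τ) := tendsto_id.mono_left nhdsWithin_le_nhds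
  have hne : ∀ᵐ r : ℝ, r ≠ τ := by simp [ae_iff, measure_singleton]
  exact tendsto_integral_inner_translate S.T_pos.le S.A hid
    (hI.mono fun σ hσ => continuous_costate hσ) (continuous_costate hτ)
    (fun ε hε => (eventually_norm_costate_sub_le hτ hid hI ε hε).mono fun σ hσ t _ => hσ t)
    (hI.mono hKm) hk (hI.mono hKk) (hne.mono hKt)

theorem continuousOn_costDeriv₂ (S : DelaySystem n) :
    ContinuousOn S.costDeriv₂ (Icc 0 S.b) := by
  intro τ hτ
  obtain ⟨M, L, hM0, -, hM, hMσ, -⟩ := S.exists_bounds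
  obtain ⟨W, hW0, hW⟩ := S.exists_sens_bounds
  obtain ⟨k, hk, hk'⟩ := S.exists_norm_acc_le
  obtain ⟨L₂, hL0, hL₂, -⟩ := exists_lipschitz_ball S.contDiff_fderiv M
  obtain ⟨Q, hQ⟩ := isCompact_Icc.exists_bound_of_continuousOn
    ((continuous_costate hτ).continuousOn (s := Icc 0 S.T))
  have hQ0 : 0 ≤ Q := (norm_nonneg _).trans (hQ 0 ⟨le_rfl, S.T_pos.le⟩)
  have hb := S.b_pos
  have hT := S.T_pos.le
  have hI : ∀ᶠ σ in 𝓝[Icc 0 S.b] τ, σ ∈ Icc 0 S.b := self_mem_nhdsWithin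
  have hid : Tendsto id (𝓝[Icc 0 S.b] τ) (𝓝 τ) := tendsto_id.mono_left nhdsWithin_le_nhds
  have hPu := eventually_norm_costate_sub_le hτ hid hI
  have hPc := continuous_costate hτ
  have hD := S.contDiff_fderiv.continuous_fderiv one_ne_zero
  have t1 : Tendsto (fun σ => ∫ t in (0 : ℝ)..S.T, ‖S.sens σ t‖ ^ 2) (𝓝[Icc 0 S.b] τ)
      (𝓝 (∫ t in (0 : ℝ)..S.T, ‖S.sens τ t‖ ^ 2)) := by
    refine intervalIntegral.tendsto_integral_filter_of_dominated_convergence (fun _ => W ^ 2)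
      (hI.mono fun σ hσ => ((continuous_sens hσ).norm.pow 2).aestronglyMeasurable)
      (hI.mono fun σ hσ => .of_forall fun t _ => ?_) intervalIntegrable_const
      (.of_forall fun t _ => ((tendsto_sens hτ hid hI t).norm.pow 2))
    rw [norm_pow, norm_norm]
    have := (hW σ hσ t).1
    gcongr
  have t2 : Tendsto (fun σ => ∫ t in (0 : ℝ)..S.T, ⟪S.costate σ t,
      fderiv ℝ (fderiv ℝ S.f) (S.state σ t) (S.sens σ t) (S.sens σ t)⟫) (𝓝[Icc 0 S.b] τ)
      (𝓝 (∫ t in (0 : ℝ)..S.T, ⟪S.costate τ t,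
      fderiv ℝ (fderiv ℝ S.f) (S.state τ t) (S.sens τ t) (S.sens τ t)⟫)) := by
    refine intervalIntegral.tendsto_integral_filter_of_dominated_convergence
      (fun _ => (Q + 1) * (L₂ * W * W))
      (hI.mono fun σ hσ => ?_) ?_ intervalIntegrable_const
      (.of_forall fun t ht => ?_)
    · have h1 := continuous_state hσ
      have h2 := continuous_sens hσ
      have h3 := continuous_costate hσ
      have h4 : Continuous fun t => fderiv ℝ (fderiv ℝ S.f) (S.state σ t) := hD.comp h1
      exact Continuous.aestronglyMeasurable (by fun_prop)
    · filter_upwards [hI, hPu 1 one_pos] with σ hσ hP1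
      refine .of_forall fun t ht => ?_
      rw [uIoc_of_le hT] at ht
      have hw := (hW σ hσ t).1
      refine (norm_inner_le_norm _ _).trans ?_
      gcongr
      · have h1 := hQ t ⟨ht.1.le, ht.2⟩
        have h2 := norm_add_le (S.costate σ t - S.costate τ t) (S.costate τ t)
        rw [sub_add_cancel] at h2
        have h3 : ‖S.costate σ t - S.costate τ t‖ ≤ 1 := hP1 t
        linarith
      · refine (ContinuousLinearMap.le_opNorm₂ _ _ _).trans ?_
        gcongr
        exact hL₂ _ ((hM σ hσ).1 t ⟨by linarith [ht.1], ht.2⟩)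
    · rw [uIoc_of_le hT] at ht
      have hx : Tendsto (fun σ => S.state σ t) (𝓝[Icc 0 S.b] τ) (𝓝 (S.state τ t)) :=
        tendsto_state hτ hid hI (tendsto_const_nhds (x := t)) (.of_forall fun _ => ht.2)
      have hw := tendsto_sens hτ hid hI t
      exact (tendsto_of_uniform hPu hPc (tendsto_const_nhds (x := t))).inner
        (tendsto_clm_apply (tendsto_clm_apply ((hD.tendsto _).comp hx) hw) hw)
  have t3 := tendsto_pairing_self (K := S.sensVel) (k := (Ioc 0 S.T).indicator fun _ => W) hτ
    (fun σ hσ => (measurable_sensVel hσ).aestronglyMeasurable)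
    ((integrable_indicator_iff measurableSet_Ioc).2 (integrableOn_const (by simp)))
    (fun σ hσ s => (hW σ hσ s).2) (fun s hs => tendsto_sensVel hτ hid hI hs)
  have t4 : Tendsto (fun σ => ⟪S.costate σ σ, S.A (S.initVel σ - S.φ₁ 0)⟫) (𝓝[Icc 0 S.b] τ)
      (𝓝 ⟪S.costate τ τ, S.A (S.initVel τ - S.φ₁ 0)⟫) := by
    have h1 : Tendsto (fun σ => S.state σ 0) (𝓝[Icc 0 S.b] τ) (𝓝 (S.state τ 0)) :=
      tendsto_state hτ hid hI (tendsto_const_nhds (x := 0)) (.of_forall fun _ => hT)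
    have h2 : Tendsto (fun σ => S.state σ (0 - σ)) (𝓝[Icc 0 S.b] τ) (𝓝 (S.state τ (0 - τ))) :=
      tendsto_state hτ hid hI (tendsto_const_nhds.sub hid) (hI.mono fun σ hσ => by
        have := hσ.1
        linarith)
    have h3 : Tendsto S.initVel (𝓝[Icc 0 S.b] τ) (𝓝 (S.initVel τ)) :=
      (((S.continuous_f.tendsto _).comp h1).neg.add ((S.A.continuous.tendsto _).comp h2)).add_const _
    exact (tendsto_of_uniform hPu hPc hid).inner
      ((S.A.continuous.tendsto _).comp (h3.sub_const (S.φ₁ 0)))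
  have t5 := tendsto_pairing_self (K := S.acc) hτ (fun σ hσ => aestronglyMeasurable_acc hσ)
    hk hk' (fun s hs => tendsto_acc hτ hid hI hs)
  exact (((t1.sub t2).sub (t3.const_mul 2)).add t4).add t5

theorem contDiffOn_cost (S : DelaySystem n) : ContDiffOn ℝ 2 S.cost (Icc 0 S.b) := by
  have hu := uniqueDiffOn_Icc S.b_pos
  have h1 : EqOn (derivWithin S.cost (Icc 0 S.b)) S.costDeriv (Icc 0 S.b) := fun τ hτ =>
    (hasDerivWithinAt_cost hτ).derivWithin (hu τ hτ)
  have h2 : EqOn (derivWithin S.costDeriv (Icc 0 S.b)) S.costDeriv₂ (Icc 0 S.b) := fun τ hτ =>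
    (hasDerivWithinAt_costDeriv hτ).derivWithin (hu τ hτ)
  rw [show (2 : WithTop ℕ∞) = 1 + 1 from one_add_one_eq_two.symm, contDiffOn_succ_iff_derivWithin hu]
  refine ⟨fun τ hτ => (hasDerivWithinAt_cost hτ).differentiableWithinAt, by simp, ?_⟩
  refine ContDiffOn.congr ?_ h1
  rw [contDiffOn_one_iff_derivWithin hu]
  exact ⟨fun τ hτ => (hasDerivWithinAt_costDeriv hτ).differentiableWithinAt,
    S.continuousOn_costDeriv₂.congr h2⟩

theorem iteratedDerivWithin_two_cost (hτ : τ ∈ Icc 0 S.b) :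
    iteratedDerivWithin 2 S.cost (Icc 0 S.b) τ = S.costDeriv₂ τ := by
  have hu := uniqueDiffOn_Icc S.b_pos
  have h1 : EqOn (derivWithin S.cost (Icc 0 S.b)) S.costDeriv (Icc 0 S.b) := fun τ hτ =>
    (hasDerivWithinAt_cost hτ).derivWithin (hu τ hτ)
  rw [iteratedDerivWithin_succ', iteratedDerivWithin_one]
  rw [derivWithin_congr h1 (h1 hτ)]
  exact (hasDerivWithinAt_costDeriv hτ).derivWithin (hu τ hτ)

end DelaySystem

/-! ### Sobolev functions of one variable -/

section Sobolev

variable {n : ℕ} {a b : ℝ} {u v : ℝ → Vec n}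

namespace HasH1Deriv

theorem intervalIntegrable (h : HasH1Deriv a b u v) (hab : a ≤ b) :
    IntervalIntegrable v volume a b := by
  rw [intervalIntegrable_iff_integrableOn_Ioc_of_le hab]
  exact h.1.integrable one_le_two

theorem continuousOn (h : HasH1Deriv a b u v) (hab : a ≤ b) : ContinuousOn u (Icc a b) := by
  have h1 := intervalIntegral.continuousOn_primitive_interval (f := v) (a := a) (b := b)
    (μ := volume) (by
      rw [uIcc_of_le hab, integrableOn_Icc_iff_integrableOn_Ioc]
      exact h.1.integrable one_le_two)
  rw [uIcc_of_le hab] at h1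
  exact (continuousOn_const.add h1).congr h.2

theorem sub_eq (h : HasH1Deriv a b u v) {s t : ℝ} (hs : s ∈ Icc a b) (ht : t ∈ Icc a b) :
    u t - u s = ∫ r in s..t, v r := by
  have hab : a ≤ b := hs.1.trans hs.2
  have hi : ∀ r ∈ Icc a b, IntervalIntegrable v volume a r := fun r hr =>
    (h.intervalIntegrable hab).mono_set (by
      rw [uIcc_of_le hr.1, uIcc_of_le hab]; exact Icc_subset_Icc_right hr.2)
  rw [h.2 t ht, h.2 s hs, add_sub_add_left_eq_sub,
    intervalIntegral.integral_interval_sub_left (hi t ht) (hi s hs)]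

theorem congr_left (h : HasH1Deriv a b u v) {u' : ℝ → Vec n} (he : EqOn u' u (Icc a b)) :
    HasH1Deriv a b u' v :=
  ⟨h.1, fun t ht => by rw [he ht, he ⟨le_rfl, ht.1.trans ht.2⟩, h.2 t ht]⟩

/-- Weak derivatives are unique almost everywhere, by Lebesgue's differentiation theorem. -/
theorem ae_eq (h : HasH1Deriv a b u v) {u' v' : ℝ → Vec n} (h' : HasH1Deriv a b u' v')
    (hab : a ≤ b) (he : EqOn u u' (Icc a b)) : ∀ᵐ t, t ∈ Ioc a b → v t = v' t := by
  have hne : ∀ c : ℝ, ∀ᵐ s : ℝ, s ≠ c := fun c => by simp [ae_iff, measure_singleton]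
  filter_upwards [(h.intervalIntegrable hab).ae_hasDerivAt_integral,
    (h'.intervalIntegrable hab).ae_hasDerivAt_integral, hne b] with t h1 h2 htb ht
  have ht' : t ∈ uIcc a b := by rw [uIcc_of_le hab]; exact ⟨ht.1.le, ht.2⟩
  have d1 := h1 ht' a left_mem_uIcc
  have d2 := h2 ht' a left_mem_uIcc
  refine d1.unique (d2.congr_of_eventuallyEq ?_)
  filter_upwards [Ioo_mem_nhds ht.1 (lt_of_le_of_ne ht.2 htb)] with s hs
  have hs' : s ∈ Icc a b := ⟨hs.1.le, hs.2.le⟩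
  have ha : a ∈ Icc a b := ⟨le_rfl, hab⟩
  rw [← h.sub_eq ha hs', ← h'.sub_eq ha hs', he hs', he ha]

end HasH1Deriv

theorem MemLp.of_bound_Ioc {a b M : ℝ} {u : ℝ → Vec n} (hu : AEStronglyMeasurable u volume)
    (hM : ∀ t ∈ Ioc a b, ‖u t‖ ≤ M) : MemLp u 2 (volume.restrict (Ioc a b)) :=
  MemLp.of_bound hu.restrict M (by
    filter_upwards [ae_restrict_mem measurableSet_Ioc] with t ht using hM t ht)

theorem eLpNorm_le_h1Norm (a b : ℝ) (u : ℝ → Vec n) :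
    eLpNorm u 2 (volume.restrict (Ioc a b)) ≤ h1Norm a b u := by
  refine le_iInf fun v => le_iInf fun _ => ?_
  have h1 : eLpNorm u 2 (volume.restrict (Ioc a b))
      = (eLpNorm u 2 (volume.restrict (Ioc a b)) ^ 2) ^ (1 / 2 : ℝ) := by
    rw [← ENNReal.rpow_natCast, ← ENNReal.rpow_mul]
    norm_num
  conv_lhs => rw [h1]
  gcongr
  exact le_self_add

theorem h1Norm_le (h : HasH1Deriv a b u v) : h1Norm a b u ≤
    (eLpNorm u 2 (volume.restrict (Ioc a b)) ^ 2
      + eLpNorm v 2 (volume.restrict (Ioc a b)) ^ 2) ^ (1 / 2 : ℝ) :=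
  iInf₂_le v h

theorem tendsto_eLpNorm_zero {ι : Type*} {l : Filter ι} [l.IsCountablyGenerated] {M : ℝ}
    {F : ι → ℝ → Vec n} (hm : ∀ᶠ i in l, AEStronglyMeasurable (F i) volume)
    (hM : ∀ᶠ i in l, ∀ t ∈ Ioc a b, ‖F i t‖ ≤ M)
    (hF : ∀ᵐ t, t ∈ Ioc a b → Tendsto (fun i => F i t) l (𝓝 0)) :
    Tendsto (fun i => eLpNorm (F i) 2 (volume.restrict (Ioc a b))) l (𝓝 0) := by
  simp_rw [eLpNorm_eq_lintegral_rpow_enorm_toReal two_ne_zero ENNReal.ofNat_ne_top]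
  have h1 : Tendsto (fun i => ∫⁻ t in Ioc a b, ‖F i t‖ₑ ^ (2 : ℝ≥0∞).toReal) l (𝓝 0) := by
    have h2 := tendsto_lintegral_filter_of_dominated_convergence'
      (μ := volume.restrict (Ioc a b)) (l := l)
      (F := fun i t => ‖F i t‖ₑ ^ (2 : ℝ≥0∞).toReal) (f := fun _ => 0)
      (fun _ => ENNReal.ofReal M ^ (2 : ℝ≥0∞).toReal)
      (hm.mono fun i hi => hi.restrict.enorm.pow_const _)
      (hM.mono fun i hi => by
        filter_upwards [ae_restrict_mem measurableSet_Ioc] with t ht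
        gcongr
        rw [← ofReal_norm]
        exact ENNReal.ofReal_le_ofReal (hi t ht))
      (by
        rw [lintegral_const]
        exact ENNReal.mul_ne_top (ENNReal.rpow_ne_top_of_nonneg (by simp) ENNReal.ofReal_ne_top)
          (by simp))
      (by
        filter_upwards [(ae_restrict_iff' measurableSet_Ioc).2 hF] with t ht
        have h3 := (ENNReal.continuous_rpow_const (y := (2 : ℝ≥0∞).toReal)).tendsto ‖(0 : Vec n)‖ₑ
        have h4 := h3.comp ((continuous_enorm.tendsto (0 : Vec n)).comp ht)
        simpa [Function.comp_def] using h4)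
    simpa using h2
  have h5 := ((ENNReal.continuous_rpow_const (y := 1 / (2 : ℝ≥0∞).toReal)).tendsto 0).comp h1
  simpa [Function.comp_def] using h5

end Sobolev

/-! ### Comparison with the Sobolev formulation -/

namespace DelaySystem

variable {n : ℕ} {S : DelaySystem n} {τ σ : ℝ}

theorem hasH1Deriv_state (hτ : τ ∈ Icc 0 S.b) {a b : ℝ} :
    HasH1Deriv a b (S.state τ) (S.vel τ) := by
  obtain ⟨M, L, -, -, hM, -⟩ := S.exists_bounds
  refine ⟨MemLp.of_bound_Ioc (measurable_vel hτ).aestronglyMeasurable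
    fun t _ => (hM τ hτ).2.1 t, fun t _ => ?_⟩
  rw [← sub_eq_iff_eq_add']
  exact (isSolution_state hτ).apply_sub hτ a t

theorem hasH1Deriv_sens (hτ : τ ∈ Icc 0 S.b) {a b : ℝ} :
    HasH1Deriv a b (S.sens τ) (S.sensVel τ) := by
  obtain ⟨W, hW0, hW⟩ := S.exists_sens_bounds
  refine ⟨MemLp.of_bound_Ioc (M := W) (measurable_sensVel hτ).aestronglyMeasurable
    fun t _ => (hW τ hτ t).2.trans (indicator_le_self' (fun _ _ => hW0.le) t), fun t _ => ?_⟩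
  have hi : ∀ p q, IntervalIntegrable (S.sensVel τ) volume p q := fun p q =>
    (integrable_sensVel hτ).intervalIntegrable
  rw [← sub_eq_iff_eq_add', sens_eq hτ t, sens_eq hτ a,
    intervalIntegral.integral_interval_sub_left (hi _ _) (hi _ _)]

theorem hasH2Derivs_state (hτ : τ ∈ Icc 0 S.b)
    (hg : MemLp S.g₁ 2 (volume.restrict (Ioc 0 S.T))) :
    HasH2Derivs 0 S.T (S.state τ) (S.field τ (S.state τ)) (S.acc τ) := by
  obtain ⟨M, L, hM0, hL0, hM, -, hL, -⟩ := S.exists_bounds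
  have hb := S.b_pos
  have h1 : MemLp (S.acc τ) 2 (volume.restrict (Ioc 0 S.T)) := by
    have h2 : MemLp (fun s => S.linOp τ s (S.vel τ s) + S.A (S.vel τ (s - τ))) 2
        (volume.restrict (Ioc 0 S.T)) := by
      refine MemLp.of_bound_Ioc (M := L * M + ‖S.A‖ * M)
        (measurable_smooth_part hτ).aestronglyMeasurable fun s hs => ?_
      refine (norm_add_le _ _).trans (add_le_add ?_ ?_)
      · refine ((S.linOp τ s).le_opNorm _).trans ?_
        gcongr
        · rw [linOp, norm_neg]
          exact hL _ ((hM τ hτ).1 s ⟨by linarith [hs.1], hs.2⟩)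
        · exact (hM τ hτ).2.1 s
      · exact (S.A.le_opNorm _).trans (by gcongr; exact (hM τ hτ).2.1 _)
    refine (h2.add hg).ae_eq ?_
    filter_upwards [ae_restrict_mem measurableSet_Ioc] with s hs
    exact (acc_of_mem hs).symm
  refine ⟨⟨(hasH1Deriv_state hτ).1.ae_eq ?_, fun t ht => ?_⟩, h1, fun t ht => ?_⟩
  · filter_upwards [ae_restrict_mem measurableSet_Ioc] with s hs
    exact slope_of_mem hs
  · rw [← integral_slope_of_mem ht]
    exact (hasH1Deriv_state hτ (b := S.T)).2 t ht
  · exact field_eq_integral hτ ht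

/-- The first and the second derivative of the state on `(0, T)` are determined by the state. -/
theorem eq_of_hasH2Derivs (hτ : τ ∈ Icc 0 S.b)
    (hg : MemLp S.g₁ 2 (volume.restrict (Ioc 0 S.T))) {x x₁ x₂ : ℝ → Vec n}
    (hx : EqOn x (S.state τ) (Icc 0 S.T)) (h : HasH2Derivs 0 S.T x x₁ x₂) :
    x₁ 0 = S.initVel τ ∧ ∀ᵐ t, t ∈ Ioc 0 S.T → x₂ t = S.acc τ t := by
  have hT := S.T_pos
  have h' := hasH2Derivs_state hτ hg
  have h1 := h.1.ae_eq h'.1 hT.le hx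
  have h2 : EqOn x₁ (S.field τ (S.state τ)) (Icc 0 S.T) := by
    refine Measure.eqOn_Icc_of_ae_eq volume hT.ne ?_ (h.2.continuousOn hT.le)
      (h'.2.continuousOn hT.le)
    rw [Measure.restrict_congr_set Ioc_ae_eq_Icc.symm]
    exact (ae_restrict_iff' measurableSet_Ioc).2 h1
  exact ⟨h2 ⟨le_rfl, hT.le⟩, h.2.ae_eq h'.2 hT.le h2⟩

section DelayDerivative

variable {x : ℝ → ℝ → Vec n}

theorem hasH1Deriv_quotient (hσ : σ ∈ Icc 0 S.b) (hτ : τ ∈ Icc 0 S.b) :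
    HasH1Deriv (-S.b) S.T
      (fun t => (σ - τ)⁻¹ • (S.state σ t - S.state τ t) - S.sens τ t)
      (fun t => (σ - τ)⁻¹ • (S.vel σ t - S.vel τ t) - S.sensVel τ t) := by
  have h1 := hasH1Deriv_state hσ (a := -S.b) (b := S.T)
  have h2 := hasH1Deriv_state hτ (a := -S.b) (b := S.T)
  have h3 := hasH1Deriv_sens hτ (a := -S.b) (b := S.T)
  refine ⟨((h1.1.sub h2.1).const_smul (σ - τ)⁻¹).sub h3.1, fun t ht => ?_⟩
  have i1 := intervalIntegrable_vel hσ (-S.b) t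
  have i2 := intervalIntegrable_vel hτ (-S.b) t
  have i3 : IntervalIntegrable (fun s => (σ - τ)⁻¹ • (S.vel σ s - S.vel τ s)) volume (-S.b) t :=
    (i1.sub i2).smul (σ - τ)⁻¹
  rw [intervalIntegral.integral_sub i3 (integrable_sensVel hτ).intervalIntegrable,
    intervalIntegral.integral_smul, intervalIntegral.integral_sub i1 i2]
  beta_reduce
  rw [h1.2 t ht, h2.2 t ht, h3.2 t ht]
  module

theorem tendsto_eLpNorm_quotient (hτ : τ ∈ Icc 0 S.b) :
    Tendsto (fun σ => eLpNorm (fun t => (σ - τ)⁻¹ • (S.state σ t - S.state τ t) - S.sens τ t) 2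
      (volume.restrict (Ioc (-S.b) S.T))) (S.puncturedNhds τ) (𝓝 0) := by
  have hI : ∀ᶠ σ in S.puncturedNhds τ, σ ∈ Icc 0 S.b :=
    eventually_mem_punctured.mono fun σ h => h.1
  refine tendsto_eLpNorm_zero (M := 1) (hI.mono fun σ hσ =>
    ((((continuous_state hσ).sub (continuous_state hτ)).const_smul (σ - τ)⁻¹).sub
      (continuous_sens hτ)).aestronglyMeasurable) ?_ (.of_forall fun t ht => ?_)
  · filter_upwards [eventually_norm_state_quotient_sub_le hτ 1 one_pos] with σ hσ t ht
    exact hσ t ht.2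
  · simpa using (tendsto_state_quotient hτ ht.2).sub_const (S.sens τ t)

/-- The difference quotients of the state converge in `H¹(-b, T)`, uniformly for the functions and
boundedly almost everywhere for their derivatives. -/
theorem hasDelayDeriv_sens (hτ : τ ∈ Icc 0 S.b)
    (hx : ∀ σ ∈ Icc 0 S.b, EqOn (x σ) (S.state σ) (Icc (-S.b) S.T)) :
    HasDelayDeriv S.b S.T x τ (S.sens τ) := by
  obtain ⟨M, L, hM0, -, -, hMσ, -⟩ := S.exists_bounds
  obtain ⟨W, hW0, hW⟩ := S.exists_sens_bounds
  have hI : ∀ᶠ σ in S.puncturedNhds τ, σ ∈ Icc 0 S.b :=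
    eventually_mem_punctured.mono fun σ h => h.1
  refine ⟨⟨_, hasH1Deriv_sens hτ⟩, ?_⟩
  have hu := tendsto_eLpNorm_quotient hτ
  have hv : Tendsto (fun σ => eLpNorm
      (fun t => (σ - τ)⁻¹ • (S.vel σ t - S.vel τ t) - S.sensVel τ t) 2
      (volume.restrict (Ioc (-S.b) S.T))) (S.puncturedNhds τ) (𝓝 0) := by
    have hne : ∀ᵐ r : ℝ, r ≠ τ := by simp [ae_iff, measure_singleton]
    refine tendsto_eLpNorm_zero (M := M + W) (hI.mono fun σ hσ =>
      ((((measurable_vel hσ).sub (measurable_vel hτ)).const_smul (σ - τ)⁻¹).sub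
        (measurable_sensVel hτ)).aestronglyMeasurable) (hI.mono fun σ hσ t _ => ?_) ?_
    · refine (norm_sub_le _ _).trans (add_le_add ?_
        ((hW τ hτ t).2.trans (indicator_le_self' (fun _ _ => hW0.le) t)))
      rw [norm_smul]
      exact (mul_le_mul_of_nonneg_left ((hMσ σ hσ τ hτ).2 t) (norm_nonneg _)).trans
        (abs_inv_sub_mul_le σ τ M hM0.le)
    · filter_upwards [hne] with t htτ ht
      rcases le_or_gt t 0 with h0 | h0
      · have h1 : S.sensVel τ t = 0 := sensVel_of_notMem fun h => absurd h.1 (not_lt.2 h0)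
        simp_rw [vel_of_nonpos h0, h1]
        simp only [sub_self, smul_zero]
        exact tendsto_const_nhds
      · simpa using (tendsto_vel_quotient hτ ⟨h0, ht.2⟩ htτ).sub_const (S.sensVel τ t)
  have hlim : Tendsto (fun σ => (eLpNorm
      (fun t => (σ - τ)⁻¹ • (S.state σ t - S.state τ t) - S.sens τ t) 2
        (volume.restrict (Ioc (-S.b) S.T)) ^ 2
      + eLpNorm (fun t => (σ - τ)⁻¹ • (S.vel σ t - S.vel τ t) - S.sensVel τ t) 2
        (volume.restrict (Ioc (-S.b) S.T)) ^ 2) ^ (1 / 2 : ℝ)) (S.puncturedNhds τ) (𝓝 0) := by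
    have h1 := (((ENNReal.continuous_pow 2).tendsto 0).comp hu).add
      (((ENNReal.continuous_pow 2).tendsto 0).comp hv)
    have h2 := ((ENNReal.continuous_rpow_const (y := (1 / 2 : ℝ))).tendsto _).comp h1
    simpa [Function.comp_def] using h2
  refine tendsto_of_tendsto_of_tendsto_of_le_of_le' tendsto_const_nhds hlim
    (.of_forall fun _ => zero_le) ?_
  filter_upwards [hI] with σ hσ
  have h1 := hasH1Deriv_quotient hσ hτ
  have he : EqOn (fun t => (σ - τ)⁻¹ • (x σ t - x τ t) - S.sens τ t)
      (fun t => (σ - τ)⁻¹ • (S.state σ t - S.state τ t) - S.sens τ t) (Icc (-S.b) S.T) :=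
    fun t ht => by simp only [hx σ hσ ht, hx τ hτ ht]
  refine (h1Norm_le (h1.congr_left he)).trans_eq ?_
  rw [eLpNorm_congr_ae]
  filter_upwards [ae_restrict_mem measurableSet_Ioc] with t ht using he ⟨ht.1.le, ht.2⟩

theorem neBot_puncturedNhds (hτ : τ ∈ Icc 0 S.b) : (S.puncturedNhds τ).NeBot :=
  accPt_principal_iff_nhdsWithin.1 ((uniqueDiffOn_Icc S.b_pos) τ hτ).accPt

/-- The derivative with respect to the delay is unique, since `τ` is an accumulation point of
`[0, b]` and the `H¹` norm dominates the `L²` norm. -/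
theorem eqOn_of_hasDelayDeriv (hτ : τ ∈ Icc 0 S.b)
    (hx : ∀ σ ∈ Icc 0 S.b, EqOn (x σ) (S.state σ) (Icc (-S.b) S.T)) {w : ℝ → Vec n}
    (hw : HasDelayDeriv S.b S.T x τ w) : EqOn w (S.sens τ) (Icc (-S.b) S.T) := by
  have hbT : -S.b < S.T := by linarith [S.b_pos, S.T_pos]
  have hI : ∀ᶠ σ in S.puncturedNhds τ, σ ∈ Icc 0 S.b :=
    eventually_mem_punctured.mono fun σ h => h.1
  have := neBot_puncturedNhds hτ
  obtain ⟨w₁, hw₁⟩ := hw.1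
  have hwc := hw₁.continuousOn hbT.le
  set μ := (volume : Measure ℝ).restrict (Ioc (-S.b) S.T)
  have hwm : AEStronglyMeasurable w μ :=
    (hwc.mono Ioc_subset_Icc_self).aestronglyMeasurable measurableSet_Ioc
  have h0 : Tendsto (fun _ : ℝ => eLpNorm (w - S.sens τ) 2 μ) (S.puncturedNhds τ) (𝓝 0) := by
    have h1 := (tendsto_eLpNorm_quotient hτ).add hw.2
    rw [add_zero] at h1
    refine tendsto_of_tendsto_of_tendsto_of_le_of_le' tendsto_const_nhds h1
      (.of_forall fun _ => zero_le) ?_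
    filter_upwards [hI] with σ hσ
    have hq : Continuous fun t => (σ - τ)⁻¹ • (S.state σ t - S.state τ t) :=
      ((continuous_state hσ).sub (continuous_state hτ)).const_smul (σ - τ)⁻¹
    have e : w - S.sens τ = (fun t => (σ - τ)⁻¹ • (S.state σ t - S.state τ t) - S.sens τ t)
        - fun t => (σ - τ)⁻¹ • (S.state σ t - S.state τ t) - w t := by
      ext1 t
      simp only [Pi.sub_apply]
      abel
    rw [e]
    refine (eLpNorm_sub_le (hq.sub (continuous_sens hτ)).aestronglyMeasurable
      (hq.aestronglyMeasurable.sub hwm) one_le_two).trans ?_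
    refine add_le_add le_rfl (le_trans (le_of_eq ?_) (eLpNorm_le_h1Norm _ _ _))
    refine eLpNorm_congr_ae ?_
    filter_upwards [ae_restrict_mem measurableSet_Ioc] with t ht
    have ht' : t ∈ Icc (-S.b) S.T := ⟨ht.1.le, ht.2⟩
    rw [hx σ hσ ht', hx τ hτ ht']
    rfl
  have h1 : eLpNorm (w - S.sens τ) 2 μ = 0 := tendsto_nhds_unique tendsto_const_nhds h0
  have h2 := (eLpNorm_eq_zero_iff (hwm.sub (continuous_sens hτ).aestronglyMeasurable)
    two_ne_zero).1 h1
  refine Measure.eqOn_Icc_of_ae_eq volume hbT.ne ?_ hwc (continuous_sens hτ).continuousOn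
  rw [Measure.restrict_congr_set Ioc_ae_eq_Icc.symm]
  exact h2.mono fun t ht => sub_eq_zero.1 ht

end DelayDerivative

end DelaySystem

namespace DelaySystem

/-! ### Uniqueness and identification of the objects in the formula -/

variable {n : ℕ} {S : DelaySystem n} {τ : ℝ} {A : Matrix (Fin n) (Fin n) ℝ}

/-- Solutions in the sense of `IsState` are the functions that agree with `state` on `[-b, T]`. -/
theorem isState_iff (hτ : τ ∈ Icc 0 S.b) (hA : S.A = act A) {φ g x : ℝ → Vec n}
    (hφ : EqOn S.φ φ (Icc (-S.b) 0)) (hg : EqOn S.g g (Icc 0 S.T)) :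
    IsState S.b S.T A S.f φ g τ x ↔ EqOn x (S.state τ) (Icc (-S.b) S.T) := by
  have hb := S.b_pos
  have hT := S.T_pos
  have h0 : (0 : ℝ) ∈ Icc (-S.b) 0 := ⟨by linarith, le_rfl⟩
  constructor
  · rintro ⟨hc, hh, v, hv, he⟩
    have hh' : ∀ t ∈ Icc (-S.b) 0, x t = S.φ t := fun t ht => by rw [hh t ht, hφ ht]
    have he' := (ae_restrict_iff' measurableSet_Ioc).1 he
    obtain ⟨h1, h2⟩ := isSolution_extension hτ hc hh' fun t ht => by
      rw [hv.2 t ht, hh' 0 h0]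
      congr 1
      refine intervalIntegral.integral_congr_ae ?_
      filter_upwards [he'] with s hs hst
      rw [uIoc_of_le ht.1] at hst
      have hs' : s ∈ Ioc 0 S.T := ⟨hst.1, hst.2.trans ht.2⟩
      rw [field, hA, hg ⟨hs'.1.le, hs'.2⟩, add_assoc, ← hs hs']
      abel
    rw [(isSolution_state hτ).unique hτ h1]
    exact h2.symm
  · intro hx
    have hx' : EqOn x (S.state τ) (Icc 0 S.T) := hx.mono (Icc_subset_Icc_left (by linarith))
    refine ⟨(continuous_state hτ).continuousOn.congr hx, fun t ht => ?_, S.vel τ,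
      (hasH1Deriv_state hτ).congr_left hx', ?_⟩
    · rw [hx ⟨ht.1, ht.2.trans hT.le⟩, state_of_nonpos hτ ht.2, hφ ht]
    · filter_upwards [ae_restrict_mem measurableSet_Ioc] with t ht
      rw [vel_of_mem ht, ← hA, hx' ⟨ht.1.le, ht.2⟩, hg ⟨ht.1.le, ht.2⟩,
        hx ⟨by linarith [ht.1, hτ.2], by linarith [ht.2, hτ.1]⟩]
      abel

theorem act_transpose (A : Matrix (Fin n) (Fin n) ℝ) : act A.transpose = (act A).adjoint := by
  rw [← ContinuousLinearMap.star_eq_adjoint, act, act, ← map_star, Matrix.star_eq_conjTranspose,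
    Matrix.conjTranspose_eq_transpose_of_trivial]

theorem isAdjoint_costate (hτ : τ ∈ Icc 0 S.b) (hA : S.A = act A) {x : ℝ → Vec n}
    (hx : EqOn x (S.state τ) (Icc 0 S.T)) :
    IsAdjoint S.b S.T A S.f S.xd τ x (S.costate τ) := by
  refine ⟨fun t ht => costate_of_ge hτ ht.1, S.costateVel τ,
    ⟨(memLp_costateVel hτ).restrict _, fun t _ => costate_eq hτ t⟩, ?_⟩
  have hne : ∀ᵐ s : ℝ, s ≠ S.T := by simp [ae_iff, measure_singleton]
  filter_upwards [ae_restrict_mem measurableSet_Ioc, ae_restrict_of_ae hne] with t ht htT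
  rw [costateVel_of_mem ⟨ht.1.le, lt_of_le_of_ne ht.2 htT⟩, hx ⟨ht.1.le, ht.2⟩, act_transpose, hA]
  abel

/-- Time reversal turns a solution of the adjoint equation into a solution of a forward linear
delay equation with zero history, which is unique. -/
theorem eqOn_costate (hτ : τ ∈ Icc 0 S.b) (hA : S.A = act A) {x p : ℝ → Vec n}
    (hx : EqOn x (S.state τ) (Icc 0 S.T)) (hp : IsAdjoint S.b S.T A S.f S.xd τ x p) :
    EqOn p (S.costate τ) (Icc 0 (S.T + S.b)) := by
  have hb := S.b_pos
  have hT := S.T_pos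
  obtain ⟨hterm, q, hq, he⟩ := hp
  have he' := (ae_restrict_iff' measurableSet_Ioc).1 he
  have hpT : p S.T = 0 := hterm _ ⟨le_rfl, by linarith⟩
  have hc := fun t => clamp_mem hT.le t
  have hz : IsLinearSolution S.T τ (S.adjOp τ) S.A.adjoint
      (fun s => S.state τ (S.T - s) - S.xd (S.T - s)) (fun s => p (S.T - clamp S.T s)) := by
    refine ⟨(hq.continuousOn (by linarith)).comp_continuous
      (continuous_const.sub (continuous_clamp _))
      fun t => ⟨by linarith [(hc t).2], by linarith [(hc t).1]⟩, fun t => ?_⟩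
    rw [integral_indicator_Ioc hT.le]
    set r := clamp S.T t with hr
    have hrm : r ∈ Icc 0 S.T := hc t
    set G : ℝ → Vec n := fun u => -(fderiv ℝ S.f (S.state τ u)).adjoint (p u)
      + S.A.adjoint (p (u + τ)) + (S.state τ u - S.xd u) with hG
    have h1 : p (S.T - r) = ∫ u in (S.T - r)..S.T, G u := by
      have h2 := hq.sub_eq (s := S.T - r) (t := S.T) ⟨by linarith [hrm.2], by linarith [hrm.1]⟩
        ⟨hT.le, by linarith⟩
      rw [hpT, zero_sub, neg_eq_iff_eq_neg] at h2
      rw [h2, ← intervalIntegral.integral_neg]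
      refine intervalIntegral.integral_congr_ae ?_
      filter_upwards [he'] with u hu hur
      rw [uIoc_of_le (by linarith [hrm.1])] at hur
      have hu' : u ∈ Ioc 0 S.T := ⟨by linarith [hur.1, hrm.2], hur.2⟩
      have h3 := hu hu'
      rw [act_transpose, ← hA, hx ⟨hu'.1.le, hu'.2⟩] at h3
      have h4 : -q u = G u := by
        rw [eq_sub_of_add_eq h3]
        simp only [hG]
        abel
      exact h4
    have h2 : ∫ s in (0 : ℝ)..r, G (S.T - s) = ∫ u in (S.T - r)..(S.T - 0), G u :=
      intervalIntegral.integral_comp_sub_left G S.T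
    rw [sub_zero] at h2
    rw [h1, ← h2]
    refine intervalIntegral.integral_congr fun s hs => ?_
    rw [uIcc_of_le hrm.1] at hs
    have hs' : s ∈ Icc 0 S.T := ⟨hs.1, hs.2.trans hrm.2⟩
    have h3 : p (S.T - clamp S.T (s - τ)) = p (S.T - s + τ) := by
      rcases le_total s τ with h | h
      · rw [clamp_of_le (by linarith), sub_zero, hpT, hterm]
        exact ⟨by linarith, by linarith [hs.1, hτ.2]⟩
      · rw [clamp_of_mem ⟨by linarith, by linarith [hs'.2, hτ.1]⟩]
        congr 1
        ring
    simp only [hG, h3, clamp_of_mem hs', adjOp, neg_apply]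
  have h := IsLinearSolution.unique hT hτ.1 (continuous_adjOp hτ) (integrableOn_adjRhs hτ)
    (isLinearSolution_revCostate hτ) hz
  intro t ht
  rcases le_total t S.T with h1 | h1
  · rw [costate, ← h]
    beta_reduce
    rw [clamp_of_mem ⟨by linarith, by linarith [ht.1]⟩, sub_sub_cancel]
  · rw [hterm t ⟨h1, ht.2⟩, costate_of_ge hτ h1]

theorem reducedCost_eq (S : DelaySystem n) {x : ℝ → ℝ → Vec n}
    (hx : EqOn (x τ) (S.state τ) (Icc 0 S.T)) : reducedCost S.T S.xd x τ = S.cost τ := by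
  rw [reducedCost, cost]
  congr 1
  refine intervalIntegral.integral_congr fun t ht => ?_
  rw [uIcc_of_le S.T_pos.le] at ht
  simp only [hx ht]

/-- A pairing split at `τ`, where the argument of `K` changes sign. On the right of `τ` only the
values of `K` on `(0, T)` up to a null set matter. -/
theorem pairing_self_eq (hτ : τ ∈ Icc 0 S.b) {p K k : ℝ → Vec n}
    (hp : EqOn p (S.costate τ) (Icc 0 (S.T + S.b))) (hK : Integrable K)
    (hk : ∀ᵐ s, s ∈ Ioc 0 S.T → k s = K s) :
    S.pairing τ K τ = (∫ t in (0 : ℝ)..τ, ⟪p t, S.A (K (t - τ))⟫)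
      + ∫ t in τ..S.T, ⟪p t, S.A (k (t - τ))⟫ := by
  have hT := S.T_pos
  have hi : ∀ a b, IntervalIntegrable (fun t => ⟪S.costate τ t, S.A (K (t - τ))⟫) volume a b :=
    fun a b => intervalIntegrable_inner
      (S.A.integrable_comp (hK.comp_sub_right τ)).intervalIntegrable (continuous_costate hτ)
  rw [pairing, ← intervalIntegral.integral_add_adjacent_intervals (hi 0 τ) (hi τ S.T)]
  congr 1
  · refine intervalIntegral.integral_congr fun t ht => ?_
    rw [uIcc_of_le hτ.1] at ht
    simp only [hp (x := t) ⟨ht.1, by linarith [ht.2, hτ.2]⟩]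
  · refine intervalIntegral.integral_congr_ae ?_
    have hk' := (measurePreserving_sub_right (volume : Measure ℝ) τ).quasiMeasurePreserving.ae hk
    filter_upwards [hk'] with t ht htm
    rw [uIoc, mem_Ioc, min_lt_iff, le_max_iff] at htm
    rcases le_or_gt t S.T with h | h
    · have h1 : τ < t := htm.1.resolve_right (not_lt.2 h)
      rw [ht ⟨by linarith, by linarith [hτ.1]⟩, hp ⟨by linarith [hτ.1], by linarith [S.b_pos]⟩]
    -- for `τ > T` the integral runs over a set where the adjoint state vanishes
    · have h1 : t ≤ τ := htm.2.resolve_right (not_le.2 h)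
      rw [hp ⟨by linarith, by linarith [hτ.2]⟩, costate_of_ge hτ h.le, inner_zero_left,
        inner_zero_left]

theorem costDeriv₂_eq (hτ : τ ∈ Icc 0 S.b) {p w w₁ x x₁ x₂ φ₁ φ₂ : ℝ → Vec n}
    (hp : EqOn p (S.costate τ) (Icc 0 (S.T + S.b)))
    (hx : EqOn x (S.state τ) (Icc 0 S.T)) (hw : EqOn w (S.sens τ) (Icc 0 S.T))
    (hw₁ : ∀ᵐ t, t ∈ Ioc 0 S.T → w₁ t = S.sensVel τ t) (hx₁ : x₁ 0 = S.initVel τ)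
    (hx₂ : ∀ᵐ t, t ∈ Ioc 0 S.T → x₂ t = S.acc τ t) (hφ₁ : S.φ₁ 0 = φ₁ 0)
    (hφ₂ : EqOn S.φ₂ φ₂ (Ioc (-S.b) 0)) :
    S.costDeriv₂ τ = (∫ t in (0 : ℝ)..S.T, ‖w t‖ ^ 2)
      - (∫ t in (0 : ℝ)..S.T, ⟪p t, fderiv ℝ (fderiv ℝ S.f) (x t) (w t) (w t)⟫)
      - 2 * (∫ t in τ..S.T, ⟪p t, S.A (w₁ (t - τ))⟫)
      + ⟪p τ, S.A (x₁ 0 - φ₁ 0)⟫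
      + (∫ t in (0 : ℝ)..τ, ⟪p t, S.A (φ₂ (t - τ))⟫)
      + (∫ t in τ..S.T, ⟪p t, S.A (x₂ (t - τ))⟫) := by
  have hT := S.T_pos
  have hb := S.b_pos
  have e1 : ∫ t in (0 : ℝ)..S.T, ‖S.sens τ t‖ ^ 2 = ∫ t in (0 : ℝ)..S.T, ‖w t‖ ^ 2 :=
    intervalIntegral.integral_congr fun t ht => by
      rw [uIcc_of_le hT.le] at ht
      simp only [hw ht]
  have e2 : ∫ t in (0 : ℝ)..S.T, ⟪S.costate τ t,
        fderiv ℝ (fderiv ℝ S.f) (S.state τ t) (S.sens τ t) (S.sens τ t)⟫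
      = ∫ t in (0 : ℝ)..S.T, ⟪p t, fderiv ℝ (fderiv ℝ S.f) (x t) (w t) (w t)⟫ :=
    intervalIntegral.integral_congr fun t ht => by
      rw [uIcc_of_le hT.le] at ht
      simp only [hw ht, hx ht, hp (x := t) ⟨ht.1, by linarith [ht.2]⟩]
  have e3 : ∫ t in (0 : ℝ)..τ, ⟪p t, S.A (S.sensVel τ (t - τ))⟫ = 0 :=
    intervalIntegral.integral_zero_ae (.of_forall fun t ht => by
      rw [uIoc_of_le hτ.1] at ht
      rw [sensVel_of_notMem fun h => by linarith [h.1, ht.2], map_zero, inner_zero_right])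
  have e4 : ∫ t in (0 : ℝ)..τ, ⟪p t, S.A (S.acc τ (t - τ))⟫
      = ∫ t in (0 : ℝ)..τ, ⟪p t, S.A (φ₂ (t - τ))⟫ :=
    intervalIntegral.integral_congr_ae (.of_forall fun t ht => by
      rw [uIoc_of_le hτ.1] at ht
      rw [acc_of_nonpos (by linarith [ht.2]), hφ₂ ⟨by linarith [ht.1, hτ.2], by linarith [ht.2]⟩])
  rw [costDeriv₂, pairing_self_eq hτ hp (integrable_sensVel hτ) hw₁,
    pairing_self_eq hτ hp (integrable_acc hτ) hx₂, e1, e2, e3, e4, zero_add, hx₁, hφ₁,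
    hp ⟨hτ.1, by linarith [hτ.2]⟩]
  ring

/-! ### Normalization of the data -/

/-- The lower bound for `Df`, integrated along the segment from `0` to `y`. -/
theorem growth_of_fderiv {f : Vec n → Vec n} (hf : Differentiable ℝ f) {c : ℝ}
    (h : ∀ y v : Vec n, 0 ≤ ⟪fderiv ℝ f y v + c • v, v⟫) (y : Vec n) :
    -(c * ‖y‖ ^ 2) - ‖f 0‖ * ‖y‖ ≤ ⟪f y, y⟫ := by
  have hd : ∀ s : ℝ, HasDerivAt (fun s : ℝ => ⟪f (s • y) + c • s • y, y⟫)
      ⟪fderiv ℝ f (s • y) y + c • y, y⟫ s := fun s => by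
    have h1 : HasDerivAt (fun s : ℝ => s • y) y s := by
      simpa using (hasDerivAt_id s).smul_const y
    have h2 := ((hf (s • y)).hasFDerivAt.comp_hasDerivAt s h1).add (h1.const_smul c)
    simpa using h2.inner ℝ (hasDerivAt_const s y)
  have hm : Monotone fun s : ℝ => ⟪f (s • y) + c • s • y, y⟫ :=
    monotone_of_deriv_nonneg (fun s => (hd s).differentiableAt) fun s => by
      rw [(hd s).deriv]
      exact h _ _
  have h1 := hm zero_le_one
  simp only [zero_smul, smul_zero, add_zero, one_smul, inner_add_left, real_inner_smul_left,
    real_inner_self_eq_norm_sq] at h1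
  have h2 := neg_le_of_abs_le (abs_real_inner_le_norm (f 0) y)
  linarith

theorem eqOn_add_integral {a b c : ℝ} {u v v' : ℝ → Vec n} (h : HasH1Deriv a b u v)
    (hc : c ∈ Icc a b) (hv : EqOn v' v (Ioc a b)) :
    EqOn (fun t => u c + ∫ s in c..t, v' s) u (Icc a b) := by
  intro t ht
  have h1 : ∫ s in c..t, v' s = ∫ s in c..t, v s := by
    refine intervalIntegral.integral_congr_ae (.of_forall fun s hs => hv ?_)
    rw [uIoc, mem_Ioc] at hs
    exact ⟨(le_min hc.1 ht.1).trans_lt hs.1, hs.2.trans (max_le hc.2 ht.2)⟩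
  simp only [h1, ← h.sub_eq hc ht, add_sub_cancel]

/-- The data of the delay equation extend to the whole line: the second derivative of the history
and the derivative of the inhomogeneity are extended by zero. -/
theorem exists_of_data {b T : ℝ} (hb : 0 < b) (hT : 0 < T) (A : Vec n →L[ℝ] Vec n)
    {f : Vec n → Vec n} (hf : ContDiff ℝ 2 f)
    (hmono : ∃ c : ℝ, 0 < c ∧ ∀ y v : Vec n, 0 ≤ ⟪fderiv ℝ f y v + c • v, v⟫)
    {φ φ₁ φ₂ : ℝ → Vec n} (hφ : HasH2Derivs (-b) 0 φ φ₁ φ₂)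
    {g : ℝ → Vec n} (hg : MemH1 0 T g)
    {xd : ℝ → Vec n} (hxd : MemLp xd 2 (volume.restrict (Ioc 0 T))) :
    ∃ S : DelaySystem n, S.b = b ∧ S.T = T ∧ S.A = A ∧ S.f = f ∧ S.xd = xd ∧
      EqOn S.φ φ (Icc (-b) 0) ∧ EqOn S.φ₁ φ₁ (Icc (-b) 0) ∧ EqOn S.φ₂ φ₂ (Ioc (-b) 0) ∧
      EqOn S.g g (Icc 0 T) ∧ MemLp S.g₁ 2 (volume.restrict (Ioc 0 T)) := by
  obtain ⟨c, hc, hmono⟩ := hmono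
  obtain ⟨g₁, hg⟩ := hg
  set ψ₂ := (Ioc (-b) 0).indicator φ₂ with hψ₂
  set ψ₁ : ℝ → Vec n := fun t => φ₁ 0 + ∫ s in (0 : ℝ)..t, ψ₂ s with hψ₁
  set γ₁ := (Ioc 0 T).indicator g₁ with hγ₁
  have h0 : (0 : ℝ) ∈ Icc (-b) 0 := ⟨by linarith, le_rfl⟩
  have h2 : EqOn ψ₂ φ₂ (Ioc (-b) 0) := fun t ht => indicator_of_mem ht _
  have h1 : EqOn ψ₁ φ₁ (Icc (-b) 0) := eqOn_add_integral hφ.2 h0 h2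
  have hγ : EqOn γ₁ g₁ (Ioc 0 T) := fun t ht => indicator_of_mem ht _
  refine ⟨⟨b, T, hb, hT, A, f, hf, c, ‖f 0‖, hc.le, norm_nonneg _,
    growth_of_fderiv (hf.differentiable two_ne_zero) hmono,
    fun t => φ 0 + ∫ s in (0 : ℝ)..t, ψ₁ s, ψ₁, ψ₂, fun t => g 0 + ∫ s in (0 : ℝ)..t, γ₁ s, γ₁, xd,
    fun t => by simp, fun t => by simp [hψ₁], fun t => by simp,
    (integrable_indicator_iff measurableSet_Ioc).2 (hφ.2.1.integrable one_le_two),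
    (integrable_indicator_iff measurableSet_Ioc).2 (hg.1.integrable one_le_two), hxd⟩,
    rfl, rfl, rfl, rfl, rfl, eqOn_add_integral hφ.1 h0 (h1.mono Ioc_subset_Icc_self), h1, h2,
    eqOn_add_integral hg ⟨le_rfl, hT.le⟩ hγ, hg.1.ae_eq ?_⟩
  filter_upwards [ae_restrict_mem measurableSet_Ioc] with t ht using (hγ ht).symm

end DelaySystem

end DelayControl

open DelayControl in
theorem proposition4p3 {n : ℕ} (b T : ℝ) (hb : 0 < b) (hT : 0 < T)
    (A : Matrix (Fin n) (Fin n) ℝ)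
    (f : Vec n → Vec n) (hf : ContDiff ℝ 2 f)
    (hmono : ∃ c : ℝ, 0 < c ∧ ∀ y v : Vec n, 0 ≤ ⟪fderiv ℝ f y v + c • v, v⟫)
    (φ φ₁ φ₂ : ℝ → Vec n) (hφ : HasH2Derivs (-b) 0 φ φ₁ φ₂)
    (g : ℝ → Vec n) (hg : MemH1 0 T g)
    (xd : ℝ → Vec n) (hxd : MemLp xd 2 (volume.restrict (Ioc 0 T))) :
    -- the delay equation has a unique solution for every delay
    (∀ τ ∈ Icc 0 b, ∃ x, IsState b T A f φ g τ x ∧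
      ∀ y, IsState b T A f φ g τ y → EqOn y x (Icc (-b) T)) ∧
    -- for the family `x[τ]` of these solutions
    ∀ x : ℝ → ℝ → Vec n, (∀ τ ∈ Icc 0 b, IsState b T A f φ g τ (x τ)) →
      ContDiffOn ℝ 2 (reducedCost T xd x) (Icc 0 b) ∧
      ∀ τ ∈ Icc 0 b,
        -- the objects that enter the formula exist
        (∃ p, IsAdjoint b T A f xd τ (x τ) p ∧
          ∀ q, IsAdjoint b T A f xd τ (x τ) q → EqOn q p (Icc 0 (T + b))) ∧
        (∃ w, HasDelayDeriv b T x τ w) ∧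
        (∃ x₁ x₂, HasH2Derivs 0 T (x τ) x₁ x₂) ∧
        -- the formula: `p = p[τ]`, `w = x'[τ]`, `w₁ = ∂ₜ x'[τ]`,
        -- `x₁`, `x₂` are the first and second time derivatives of `x[τ]` on `(0, T)`
        ∀ p w w₁ x₁ x₂ : ℝ → Vec n,
          IsAdjoint b T A f xd τ (x τ) p →
          HasDelayDeriv b T x τ w → HasH1Deriv (-b) T w w₁ →
          HasH2Derivs 0 T (x τ) x₁ x₂ →
          iteratedDerivWithin 2 (reducedCost T xd x) (Icc 0 b) τ
            = (∫ t in (0 : ℝ)..T, ‖w t‖ ^ 2)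
              - (∫ t in (0 : ℝ)..T, ⟪p t, fderiv ℝ (fderiv ℝ f) (x τ t) (w t) (w t)⟫)
              - 2 * (∫ t in τ..T, ⟪p t, act A (w₁ (t - τ))⟫)
              + ⟪p τ, act A (x₁ 0 - φ₁ 0)⟫
              + (∫ t in (0 : ℝ)..τ, ⟪p t, act A (φ₂ (t - τ))⟫)
              + (∫ t in τ..T, ⟪p t, act A (x₂ (t - τ))⟫) := by
  obtain ⟨S, rfl, rfl, hA, rfl, rfl, hSφ, hSφ₁, hSφ₂, hSg, hSg₁⟩ :=
    DelaySystem.exists_of_data hb hT (act A) hf hmono hφ hg hxd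
  have hsub : Icc 0 S.T ⊆ Icc (-S.b) S.T := Icc_subset_Icc_left (by linarith)
  refine ⟨fun τ hτ => ⟨S.state τ, (DelaySystem.isState_iff hτ hA hSφ hSg).2 (eqOn_refl _ _),
    fun y hy => (DelaySystem.isState_iff hτ hA hSφ hSg).1 hy⟩, fun x hx => ?_⟩
  have hx' : ∀ τ ∈ Icc 0 S.b, EqOn (x τ) (S.state τ) (Icc (-S.b) S.T) := fun τ hτ =>
    (DelaySystem.isState_iff hτ hA hSφ hSg).1 (hx τ hτ)
  have hx0 : ∀ τ ∈ Icc 0 S.b, EqOn (x τ) (S.state τ) (Icc 0 S.T) := fun τ hτ =>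
    (hx' τ hτ).mono hsub
  have hcost : EqOn (reducedCost S.T S.xd x) S.cost (Icc 0 S.b) := fun τ hτ =>
    S.reducedCost_eq (hx0 τ hτ)
  refine ⟨S.contDiffOn_cost.congr hcost, fun τ hτ => ⟨⟨S.costate τ,
    DelaySystem.isAdjoint_costate hτ hA (hx0 τ hτ),
    fun q hq => DelaySystem.eqOn_costate hτ hA (hx0 τ hτ) hq⟩,
    ⟨S.sens τ, DelaySystem.hasDelayDeriv_sens hτ hx'⟩, ?_, ?_⟩⟩
  · obtain ⟨h1, h2⟩ := DelaySystem.hasH2Derivs_state hτ hSg₁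
    exact ⟨_, _, h1.congr_left (hx0 τ hτ), h2⟩
  · intro p w w₁ x₁ x₂ hp hw hw₁ hx₁₂
    have hwe := DelaySystem.eqOn_of_hasDelayDeriv hτ hx' hw
    have hw₁e := hw₁.ae_eq (DelaySystem.hasH1Deriv_sens hτ) (by linarith) hwe
    obtain ⟨hx₁, hx₂⟩ := DelaySystem.eq_of_hasH2Derivs hτ hSg₁ (hx0 τ hτ) hx₁₂
    rw [iteratedDerivWithin_congr hcost hτ, DelaySystem.iteratedDerivWithin_two_cost hτ, ← hA]
    refine DelaySystem.costDeriv₂_eq hτ (DelaySystem.eqOn_costate hτ hA (hx0 τ hτ) hp) (hx0 τ hτ)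
      (hwe.mono hsub) ?_ hx₁ hx₂ (hSφ₁ ⟨by linarith, le_rfl⟩) hSφ₂
    filter_upwards [hw₁e] with t h ht using h ⟨by linarith [ht.1], ht.2⟩
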